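/- \textbf{Setting.} A base station (BS) with $M$ antennas serves $K$ single-antenna users, aided by a reflecting surface (RIS) with $N$ elements and a fixed phase matrix $\mathbf\Phi=\mathrm{diag}(e^{j\theta_1},\dots,e^{j\theta_N})$. Let $\alpha_k,\beta,\gamma_k\ge 0$ (path losses), $\varepsilon_k,\delta\ge 0$ (Rician factors), $p>0$, $\sigma^2>0$, and integers $\tau\le\tau_c$ with $\tau_c\ge1$. Let $\overline{\mathbf h}_k=\mathbf a_N(\varphi^a_{kr},\varphi^e_{kr})$, $\mathbf a_N=\mathbf a_N(\varphi^a_t,\varphi^e_t)$, $\mathbf a_M=\mathbf a_M(\phi^a_r,\phi^e_r)$ and $\overline{\mathbf H}_2=\mathbf a_M\mathbf a_N^H$, where for real angles $\vartheta^a,\vartheta^e$ $$[\mathbf a_M(\vartheta^a,\vartheta^e)]_x=e^{j2\pi\frac{d_{bs}}{\lambda}(x-1)\sin\vartheta^e\sin\vartheta^a},\qquad [\mathbf a_N(\vartheta^a,\vartheta^e)]_x=e^{j2\pi\frac{d_{ris}}{\lambda}\left(\lfloor (x-1)/\sqrt N\rfloor\sin\vartheta^e\sin\vartheta^a+((x-1)\bmod\sqrt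 N)\cos\vartheta^e\right)} .$$ The channels are $\mathbf h_k=\sqrt{\tfrac{\alpha_k}{\varepsilon_k+1}}(\sqrt{\varepsilon_k}\,\overline{\mathbf h}_k+\tilde{\mathbf h}_k)$, $\mathbf H_2=\sqrt{\tfrac{\beta}{\delta+1}}(\sqrt\delta\,\overline{\mathbf H}_2+\tilde{\mathbf H}_2)$, $\mathbf d_k=\sqrt{\gamma_k}\,\tilde{\mathbf d}_k$, and $\mathbf q_k=\mathbf H_2\mathbf\Phi\mathbf h_k+\mathbf d_k$. With pilots $\mathbf S=[\mathbf s_1,\dots,\mathbf s_K]\in\mathbb C^{\tau\times K}$, $\mathbf S^H\mathbf S=\mathbf I_K$, the BS receives $\mathbf Y_p=\sqrt{\tau p}\,[\mathbf q_1,\dots,\mathbf q_K]\mathbf S^H+\mathbf N$ and forms $\mathbf y_p^k=\mathbf Y_p\mathbf s_k/\sqrt{\tau p}$ and the LMMSE estimate $\hat{\mathbf q}_k=\mathbb E\{\mathbf q_k\}+\mathrm{Cov}\{\mathbf q_k,\mathbf y_p^k\}\mathrm{Cov}^{-1}\{\mathbf y_p^k,\mathbf y_p^k\}(\mathbf y_p^k-\mathbb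 E\{\mathbf y_p^k\})$. In the data phase it receives $\mathbf y=\sqrt p\sum_i\mathbf q_ix_i+\mathbf n$ and forms the MRC output $r_k=\hat{\mathbf q}_k^H\mathbf y$. All entries of $\tilde{\mathbf h}_k,\tilde{\mathbf H}_2,\tilde{\mathbf d}_k$ and the symbols $x_k$ are $\mathcal{CN}(0,1)$, all entries of $\mathbf N,\mathbf n$ are $\mathcal{CN}(0,\sigma^2)$, and all of these are mutually independent. \textbf{Use-and-then-forget bound.} Put $\tau^o=\frac{\tau_c-\tau}{\tau_c}$ and $\underline R_k=\tau^o\log_2(1+\mathrm{SINR}_k)$ with $$\mathrm{SINR}_k=\frac{p\,|\mathbb E\{\hat{\mathbf q}_k^H\mathbf q_k\}|^2}{p\left(\mathbb E\{|\hat{\mathbf q}_k^H\mathbf q_k|^2\}-|\mathbb E\{\hat{\mathbf q}_k^H\mathbf q_k\}|^2\right)+p\sum_{i\ne k}\mathbb E\{|\hat{\mathbf q}_k^H\mathbf q_i|^2\}+\sigma^2\,\mathbb E\{\|\hat{\mathbf q}_k\|^2\}} .$$ \textbf{Auxiliary quantities.} $c_k=\frac{\beta\alpha_k}{(\delta+1)(\varepsilon_k+1)}$,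 $s=\frac{\sigma^2}{\tau p}$, $a_{k1}=Nc_k\delta$, $a_{k2}=Nc_k(\varepsilon_k+1)+\gamma_k$, $a_{k3}=\frac{a_{k1}s}{(a_{k2}+s)(a_{k2}+s+Ma_{k1})}$, $a_{k4}=\frac{a_{k2}}{a_{k2}+s}$, $e_{k1}=a_{k3}+a_{k4}$, $e_{k2}=Ma_{k3}+a_{k4}$, $e_{k3}=Ma_{k3}^2+2a_{k3}a_{k4}+a_{k4}^2$, and $f_k=\mathbf a_N^H\mathbf\Phi\overline{\mathbf h}_k$. \textbf{Theorem.} All the expectations above exist, $\mathrm{Cov}\{\mathbf y_p^k,\mathbf y_p^k\}$ is invertible, and $$\underline R_k=\tau^o\log_2(1+\mathrm{SINR}_k),\qquad \mathrm{SINR}_k=\frac{pE_k^{\rm signal}}{pE_k^{\rm leak}+p\sum_{i\neq k}I_{ki}+\sigma^2E_k^{\rm noise}},$$ where $E_k^{\rm signal}=|\mathbb E\{\hat{\mathbf q}_k^H\mathbf q_k\}|^2=(E_k^{\rm noise})^2$, $$E_k^{\rm noise}=\mathbb E\{\|\hat{\mathbf q}_k\|^2\}=M\{|f_k|^2c_k\delta\varepsilon_k+Nc_k\delta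 e_{k2}+(Nc_k(\varepsilon_k+1)+\gamma_k)e_{k1}\},$$ and $E_k^{\rm leak}=\mathbb E\{|\hat{\mathbf q}_k^H\mathbf q_k|^2\}-|\mathbb E\{\hat{\mathbf q}_k^H\mathbf q_k\}|^2$ equals $$\begin{aligned} &M|f_k|^2c_k^2\delta\varepsilon_k\{N(M\delta+\varepsilon_k+1)(e_{k2}^2+1)+2(Me_{k1}+e_{k2})(e_{k2}+1)\}+M|f_k|^2c_k\delta\varepsilon_k\{\gamma_k+(\gamma_k+s)e_{k2}^2\}\\ &+M^2N^2c_k^2\delta^2e_{k2}^2+MN^2c_k^2\{2\delta(\varepsilon_k+1)e_{k2}^2+(\varepsilon_k+1)^2e_{k3}\}+M^2Nc_k^2\{(2\varepsilon_k+1)e_{k1}^2+2\delta e_{k1}e_{k2}\}\\ &+MNc_k\{c_k(2\delta e_{k2}^2+(2\varepsilon_k+1)e_{k3})+(2\gamma_k+s)(\delta e_{k2}^2+(\varepsilon_k+1)e_{k3})\}+M\gamma_k(\gamma_k+s)e_{k3}, \end{aligned}$$ and, for $i\ne k$, $I_{ki}=\mathbb E\{|\hat{\mathbf q}_k^H\mathbf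 q_i|^2\}$ equals $$\begin{aligned} &M^2|f_k|^2|f_i|^2c_kc_i\delta^2\varepsilon_k\varepsilon_i+M|f_k|^2c_k\delta\varepsilon_k\{c_i(MN\delta+N\varepsilon_i+N+2Me_{k1})+\gamma_i\}\\ &+M|f_i|^2c_i\delta\varepsilon_i\{c_ke_{k2}(MN\delta e_{k2}+N\varepsilon_ke_{k2}+Ne_{k2}+2Me_{k1})+(\gamma_k+s)e_{k2}^2\}+M^2N^2c_kc_i\delta^2e_{k2}^2\\ &+MN^2c_kc_i\{\delta(\varepsilon_k+\varepsilon_i+2)e_{k2}^2+(\varepsilon_k+1)(\varepsilon_i+1)e_{k3}\}+M^2Nc_kc_ie_{k1}\{(\varepsilon_k+\varepsilon_i+1)e_{k1}+2\delta e_{k2}\}\\ &+M^2c_kc_i\varepsilon_k\varepsilon_ie_{k1}\left(|\overline{\mathbf h}_k^H\overline{\mathbf h}_i|^2e_{k1}+2\delta\,\mathrm{Re}\{f_k^Hf_i\,\overline{\mathbf h}_i^H\overline{\mathbf h}_k\}\right)\\ &+MN\{(\gamma_k+s)c_i(\delta e_{k2}^2+(\varepsilon_i+1)e_{k3})+\gamma_ic_k(\delta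 e_{k2}^2+(\varepsilon_k+1)e_{k3})\}+M\gamma_i(\gamma_k+s)e_{k3}. \end{aligned}$$ Moreover $f_k=\sum_{n=1}^Ne^{j(\zeta_n^k+\theta_n)}$ with $\zeta_n^k=2\pi\frac{d_{ris}}{\lambda}\big(\lfloor\frac{n-1}{\sqrt N}\rfloor(\sin\varphi^e_{kr}\sin\varphi^a_{kr}-\sin\varphi^e_t\sin\varphi^a_t)+((n-1)\bmod\sqrt N)(\cos\varphi^e_{kr}-\cos\varphi^e_t)\big)$. Finally, $\underline R_k$ is a lower bound for the ergodic rate of user $k$: with mutual information measured in bits, $\underline R_k\le\tau^oI(x_k;r_k)$ and $\underline R_k\le\tau^oI(x_k;(r_k,\hat{\mathbf q}_1,\dots,\hat{\mathbf q}_K))$. -/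

import Mathlib

open MeasureTheory ProbabilityTheory Matrix
open scoped ENNReal NNReal

noncomputable section

/-- The circularly symmetric complex Gaussian law `CN(0, v)`: real and imaginary parts are
independent centred real Gaussians of variance `v / 2`. -/
def complexGaussian (v : ℝ≥0) : Measure ℂ :=
  ((gaussianReal 0 (v / 2)).prod (gaussianReal 0 (v / 2))).map
    (fun z : ℝ × ℝ => (z.1 : ℂ) + (z.2 : ℂ) * Complex.I)

/-- Mutual information (in nats) between two random variables: the Kullback-Leibler divergence of
the joint law from the product of the marginal laws. -/
def mutualInformation {Ω α β : Type*} [MeasurableSpace Ω] [MeasurableSpace α] [MeasurableSpace β]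
    (P : Measure Ω) (X : Ω → α) (Y : Ω → β) : ℝ≥0∞ :=
  InformationTheory.klDiv (P.map (fun ω => (X ω, Y ω))) ((P.map X).prod (P.map Y))

/-- Mean vector `E{X}` of a complex random vector. -/
def meanVec {Ω : Type*} [MeasurableSpace Ω] {m : ℕ} (P : Measure Ω)
    (X : Ω → Fin m → ℂ) : Fin m → ℂ :=
  fun i => ∫ ω, X ω i ∂P

/-- `Cov{X, Y} = E{(X - E X)(Y - E Y)ᴴ}`. -/
def crossCov {Ω : Type*} [MeasurableSpace Ω] {m n : ℕ} (P : Measure Ω)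
    (X : Ω → Fin m → ℂ) (Y : Ω → Fin n → ℂ) : Matrix (Fin m) (Fin n) ℂ :=
  Matrix.of fun i j => ∫ ω, (X ω i - meanVec P X i) * star (Y ω j - meanVec P Y j) ∂P

/-- The LMMSE estimate of `X` from the observation `Y`:
`E{X} + Cov{X,Y} Cov{Y,Y}⁻¹ (Y - E{Y})`. -/
def lmmse {Ω : Type*} [MeasurableSpace Ω] {m n : ℕ} (P : Measure Ω)
    (X : Ω → Fin m → ℂ) (Y : Ω → Fin n → ℂ) (ω : Ω) : Fin m → ℂ :=
  meanVec P X + (crossCov P X Y * (crossCov P Y Y)⁻¹) *ᵥ (Y ω - meanVec P Y)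

/-- Deterministic parameters of an uplink with `M` base-station antennas, `N` reflecting elements,
`K` users and pilots of length `τ`. -/
structure RISSystem (M N K τ : ℕ) where
  /-- length of the coherence interval -/
  τc : ℕ
  /-- average transmit power of each user -/
  p : ℝ
  /-- noise standard deviation (the noise power is `σ ^ 2`) -/
  σ : ℝ
  /-- path loss RIS - BS -/
  β : ℝ
  /-- Rician factor RIS - BS -/
  δ : ℝ
  /-- path losses user - RIS -/
  α : Fin K → ℝ
  /-- Rician factors user - RIS -/
  ε : Fin K → ℝ
  /-- path losses user - BS -/
  γ : Fin K → ℝ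
  /-- BS antenna spacing -/
  dBS : ℝ
  /-- RIS element spacing -/
  dRIS : ℝ
  /-- wavelength -/
  lam : ℝ
  /-- azimuth angles of arrival at the RIS from the users -/
  azUser : Fin K → ℝ
  /-- elevation angles of arrival at the RIS from the users -/
  elUser : Fin K → ℝ
  /-- azimuth angle of departure from the RIS towards the BS -/
  azDep : ℝ
  /-- elevation angle of departure from the RIS towards the BS -/
  elDep : ℝ
  /-- azimuth angle of arrival at the BS from the RIS -/
  azBS : ℝ
  /-- elevation angle of arrival at the BS from the RIS -/
  elBS : ℝ
  /-- RIS phase shifts -/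
  θ : Fin N → ℝ
  /-- pilot matrix; its columns are the pilot sequences of the users -/
  S : Matrix (Fin τ) (Fin K) ℂ
  τc_pos : 0 < τc
  τ_le_τc : τ ≤ τc
  p_pos : 0 < p
  σ_pos : 0 < σ
  β_nonneg : 0 ≤ β
  δ_nonneg : 0 ≤ δ
  α_nonneg : ∀ k, 0 ≤ α k
  ε_nonneg : ∀ k, 0 ≤ ε k
  γ_nonneg : ∀ k, 0 ≤ γ k
  lam_pos : 0 < lam
  pilots_orthonormal : Sᴴ * S = 1

/-- Index set of all scalar random quantities of the model. -/
inductive RISSource (M N K τ : ℕ) : Type where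
  /-- entry `m` of the fast fading of the direct channel of user `k` -/
  | direct (k : Fin K) (m : Fin M)
  /-- entry `n` of the NLoS channel from user `k` to the RIS -/
  | userRIS (k : Fin K) (n : Fin N)
  /-- entry `(m, n)` of the NLoS channel from the RIS to the BS -/
  | risBS (m : Fin M) (n : Fin N)
  /-- noise at antenna `m` in pilot slot `t` -/
  | pilotNoise (m : Fin M) (t : Fin τ)
  /-- noise at antenna `m` during data transmission -/
  | dataNoise (m : Fin M)
  /-- data symbol of user `k` -/
  | symbol (k : Fin K)

namespace RISSystem

variable {M N K τ : ℕ}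

/-! ### Deterministic quantities -/

/-- Phase of the `x`-th entry of the planar-array response of the RIS; `x` counts from `0`, and
the remainder modulo `√N` is `x - √N ⌊x / √N⌋`. -/
def risPhase (sys : RISSystem M N K τ) (az el : ℝ) (x : Fin N) : ℝ :=
  2 * Real.pi * (sys.dRIS / sys.lam) *
    ((⌊(x : ℝ) / Real.sqrt N⌋ : ℝ) * (Real.sin el * Real.sin az)
      + ((x : ℝ) - Real.sqrt N * (⌊(x : ℝ) / Real.sqrt N⌋ : ℝ)) * Real.cos el)

/-- Array response vector of the RIS. -/
def risResponse (sys : RISSystem M N K τ) (az el : ℝ) : Fin N → ℂ :=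
  fun x => Complex.exp (Complex.I * (sys.risPhase az el x : ℂ))

/-- Array response vector of the BS (uniform linear array). -/
def bsResponse (sys : RISSystem M N K τ) (az el : ℝ) : Fin M → ℂ :=
  fun x => Complex.exp (Complex.I *
    ((2 * Real.pi * (sys.dBS / sys.lam) * (x : ℝ) * Real.sin el * Real.sin az : ℝ) : ℂ))

/-- LoS vector `h̄_k` from user `k` to the RIS. -/
def hBar (sys : RISSystem M N K τ) (k : Fin K) : Fin N → ℂ :=
  sys.risResponse (sys.azUser k) (sys.elUser k)

/-- `a_N`, the RIS response in the direction of the BS. -/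
def aN (sys : RISSystem M N K τ) : Fin N → ℂ := sys.risResponse sys.azDep sys.elDep

/-- `a_M`, the BS response in the direction of the RIS. -/
def aM (sys : RISSystem M N K τ) : Fin M → ℂ := sys.bsResponse sys.azBS sys.elBS

/-- LoS matrix `H̄₂ = a_M a_Nᴴ`. -/
def H2Bar (sys : RISSystem M N K τ) : Matrix (Fin M) (Fin N) ℂ :=
  Matrix.vecMulVec sys.aM (star sys.aN)

/-- Phase shift matrix `Φ` of the RIS. -/
def Phi (sys : RISSystem M N K τ) : Matrix (Fin N) (Fin N) ℂ :=
  Matrix.diagonal fun n => Complex.exp (Complex.I * (sys.θ n : ℂ))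

/-- `f_k(Φ) = a_Nᴴ Φ h̄_k`. -/
def f (sys : RISSystem M N K τ) (k : Fin K) : ℂ :=
  star sys.aN ⬝ᵥ (sys.Phi *ᵥ sys.hBar k)

/-- The phases `ζ_n^k`; `n` counts from `0`. -/
def zeta (sys : RISSystem M N K τ) (k : Fin K) (n : Fin N) : ℝ :=
  2 * Real.pi * (sys.dRIS / sys.lam) *
    ((⌊(n : ℝ) / Real.sqrt N⌋ : ℝ) *
        (Real.sin (sys.elUser k) * Real.sin (sys.azUser k)
          - Real.sin sys.elDep * Real.sin sys.azDep)
      + ((n : ℝ) - Real.sqrt N * (⌊(n : ℝ) / Real.sqrt N⌋ : ℝ)) *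
        (Real.cos (sys.elUser k) - Real.cos sys.elDep))

/-- `c_k = β α_k / ((δ + 1)(ε_k + 1))`. -/
def c (sys : RISSystem M N K τ) (k : Fin K) : ℝ :=
  sys.β * sys.α k / ((sys.δ + 1) * (sys.ε k + 1))

/-- The ratio `σ² / (τ p)`. -/
def s (sys : RISSystem M N K τ) : ℝ := sys.σ ^ 2 / (τ * sys.p)

def a1 (sys : RISSystem M N K τ) (k : Fin K) : ℝ := N * sys.c k * sys.δ

def a2 (sys : RISSystem M N K τ) (k : Fin K) : ℝ := N * sys.c k * (sys.ε k + 1) + sys.γ k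

def a3 (sys : RISSystem M N K τ) (k : Fin K) : ℝ :=
  sys.a1 k * sys.s / ((sys.a2 k + sys.s) * (sys.a2 k + sys.s + M * sys.a1 k))

def a4 (sys : RISSystem M N K τ) (k : Fin K) : ℝ := sys.a2 k / (sys.a2 k + sys.s)

def e1 (sys : RISSystem M N K τ) (k : Fin K) : ℝ := sys.a3 k + sys.a4 k

def e2 (sys : RISSystem M N K τ) (k : Fin K) : ℝ := M * sys.a3 k + sys.a4 k

def e3 (sys : RISSystem M N K τ) (k : Fin K) : ℝ :=
  M * sys.a3 k ^ 2 + 2 * sys.a3 k * sys.a4 k + sys.a4 k ^ 2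

/-- Pre-log factor `τ° = (τ_c - τ) / τ_c`. -/
def preLog (sys : RISSystem M N K τ) : ℝ := ((sys.τc : ℝ) - τ) / sys.τc

/-! ### Closed forms -/

/-- Closed form of the noise term. -/
def noiseTerm (sys : RISSystem M N K τ) (k : Fin K) : ℝ :=
  M * (‖sys.f k‖ ^ 2 * sys.c k * sys.δ * sys.ε k + N * sys.c k * sys.δ * sys.e2 k
    + (N * sys.c k * (sys.ε k + 1) + sys.γ k) * sys.e1 k)

/-- Closed form of the signal term. -/
def signalTerm (sys : RISSystem M N K τ) (k : Fin K) : ℝ := sys.noiseTerm k ^ 2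

/-- Closed form of the leakage term. -/
def leakTerm (sys : RISSystem M N K τ) (k : Fin K) : ℝ :=
  M * ‖sys.f k‖ ^ 2 * sys.c k ^ 2 * sys.δ * sys.ε k *
      (N * (M * sys.δ + sys.ε k + 1) * (sys.e2 k ^ 2 + 1)
        + 2 * (M * sys.e1 k + sys.e2 k) * (sys.e2 k + 1))
    + M * ‖sys.f k‖ ^ 2 * sys.c k * sys.δ * sys.ε k *
      (sys.γ k + (sys.γ k + sys.s) * sys.e2 k ^ 2)
    + M ^ 2 * N ^ 2 * sys.c k ^ 2 * sys.δ ^ 2 * sys.e2 k ^ 2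
    + M * N ^ 2 * sys.c k ^ 2 *
      (2 * sys.δ * (sys.ε k + 1) * sys.e2 k ^ 2 + (sys.ε k + 1) ^ 2 * sys.e3 k)
    + M ^ 2 * N * sys.c k ^ 2 *
      ((2 * sys.ε k + 1) * sys.e1 k ^ 2 + 2 * sys.δ * sys.e1 k * sys.e2 k)
    + M * N * sys.c k *
      (sys.c k * (2 * sys.δ * sys.e2 k ^ 2 + (2 * sys.ε k + 1) * sys.e3 k)
        + (2 * sys.γ k + sys.s) * (sys.δ * sys.e2 k ^ 2 + (sys.ε k + 1) * sys.e3 k))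
    + M * sys.γ k * (sys.γ k + sys.s) * sys.e3 k

/-- Closed form of the interference caused to user `k` by user `i`. -/
def interferenceTerm (sys : RISSystem M N K τ) (k i : Fin K) : ℝ :=
  M ^ 2 * ‖sys.f k‖ ^ 2 * ‖sys.f i‖ ^ 2 * sys.c k * sys.c i * sys.δ ^ 2 * sys.ε k * sys.ε i
    + M * ‖sys.f k‖ ^ 2 * sys.c k * sys.δ * sys.ε k *
      (sys.c i * (M * N * sys.δ + N * sys.ε i + N + 2 * M * sys.e1 k) + sys.γ i)
    + M * ‖sys.f i‖ ^ 2 * sys.c i * sys.δ * sys.ε i *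
      (sys.c k * sys.e2 k *
          (M * N * sys.δ * sys.e2 k + N * sys.ε k * sys.e2 k + N * sys.e2 k + 2 * M * sys.e1 k)
        + (sys.γ k + sys.s) * sys.e2 k ^ 2)
    + M ^ 2 * N ^ 2 * sys.c k * sys.c i * sys.δ ^ 2 * sys.e2 k ^ 2
    + M * N ^ 2 * sys.c k * sys.c i *
      (sys.δ * (sys.ε k + sys.ε i + 2) * sys.e2 k ^ 2
        + (sys.ε k + 1) * (sys.ε i + 1) * sys.e3 k)
    + M ^ 2 * N * sys.c k * sys.c i * sys.e1 k *
      ((sys.ε k + sys.ε i + 1) * sys.e1 k + 2 * sys.δ * sys.e2 k)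
    + M ^ 2 * sys.c k * sys.c i * sys.ε k * sys.ε i * sys.e1 k *
      (‖star (sys.hBar k) ⬝ᵥ sys.hBar i‖ ^ 2 * sys.e1 k
        + 2 * sys.δ * (star (sys.f k) * sys.f i * (star (sys.hBar i) ⬝ᵥ sys.hBar k)).re)
    + M * N *
      ((sys.γ k + sys.s) * sys.c i * (sys.δ * sys.e2 k ^ 2 + (sys.ε i + 1) * sys.e3 k)
        + sys.γ i * sys.c k * (sys.δ * sys.e2 k ^ 2 + (sys.ε k + 1) * sys.e3 k))
    + M * sys.γ i * (sys.γ k + sys.s) * sys.e3 k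

/-- Closed form of the SINR of user `k`. -/
def closedSINR (sys : RISSystem M N K τ) (k : Fin K) : ℝ :=
  sys.p * sys.signalTerm k /
    (sys.p * sys.leakTerm k + sys.p * ∑ i ∈ Finset.univ.erase k, sys.interferenceTerm k i
      + sys.σ ^ 2 * sys.noiseTerm k)

/-! ### Random quantities -/

/-- Variances of the scalar random quantities. -/
def sourceVar (sys : RISSystem M N K τ) : RISSource M N K τ → ℝ≥0
  | .direct _ _ => 1
  | .userRIS _ _ => 1
  | .risBS _ _ => 1
  | .pilotNoise _ _ => (sys.σ ^ 2).toNNReal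
  | .dataNoise _ => (sys.σ ^ 2).toNNReal
  | .symbol _ => 1

/-- All scalar random quantities are independent and circularly symmetric complex Gaussian with
the prescribed variances. -/
structure IsModel (sys : RISSystem M N K τ) {Ω : Type*} [MeasurableSpace Ω]
    (P : Measure Ω) (Z : RISSource M N K τ → Ω → ℂ) : Prop where
  hasLaw : ∀ a, HasLaw (Z a) (complexGaussian (sys.sourceVar a)) P
  indep : iIndepFun Z P

variable {Ω : Type*} (sys : RISSystem M N K τ) (Z : RISSource M N K τ → Ω → ℂ)

/-- Rician channel `h_k` from user `k` to the RIS. -/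
def h (k : Fin K) (ω : Ω) : Fin N → ℂ :=
  ((Real.sqrt (sys.α k / (sys.ε k + 1)) : ℝ) : ℂ) •
    (((Real.sqrt (sys.ε k) : ℝ) : ℂ) • sys.hBar k + fun n => Z (.userRIS k n) ω)

/-- Rician channel `H₂` from the RIS to the BS. -/
def H2 (ω : Ω) : Matrix (Fin M) (Fin N) ℂ :=
  ((Real.sqrt (sys.β / (sys.δ + 1)) : ℝ) : ℂ) •
    (((Real.sqrt sys.δ : ℝ) : ℂ) • sys.H2Bar + Matrix.of fun m n => Z (.risBS m n) ω)

/-- Rayleigh channel `d_k` from user `k` to the BS. -/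
def d (k : Fin K) (ω : Ω) : Fin M → ℂ :=
  ((Real.sqrt (sys.γ k) : ℝ) : ℂ) • fun m => Z (.direct k m) ω

/-- Aggregated channel `q_k = H₂ Φ h_k + d_k`. -/
def q (k : Fin K) (ω : Ω) : Fin M → ℂ :=
  sys.H2 Z ω *ᵥ (sys.Phi *ᵥ sys.h Z k ω) + sys.d Z k ω

/-- The matrix `Q` whose columns are the aggregated channels. -/
def Q (ω : Ω) : Matrix (Fin M) (Fin K) ℂ := Matrix.of fun m k => sys.q Z k ω m

/-- Received pilot signal `Y_p = √(τ p) Q Sᴴ + N`. -/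
def pilotSignal (ω : Ω) : Matrix (Fin M) (Fin τ) ℂ :=
  ((Real.sqrt (τ * sys.p) : ℝ) : ℂ) • (sys.Q Z ω * sys.Sᴴ)
    + Matrix.of fun m t => Z (.pilotNoise m t) ω

/-- Observation `y_p^k = Y_p s_k / √(τ p)` for user `k`. -/
def obs (k : Fin K) (ω : Ω) : Fin M → ℂ :=
  ((1 / Real.sqrt (τ * sys.p) : ℝ) : ℂ) • (sys.pilotSignal Z ω *ᵥ fun t => sys.S t k)

/-- Received data signal `y = √p ∑ q_k x_k + n`. -/
def received (ω : Ω) : Fin M → ℂ :=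
  ((Real.sqrt sys.p : ℝ) : ℂ) • (∑ i, Z (.symbol i) ω • sys.q Z i ω)
    + fun m => Z (.dataNoise m) ω

variable [MeasurableSpace Ω] (P : Measure Ω)

/-- LMMSE estimate of `q_k` from the observation of user `k`. -/
def qHat (k : Fin K) (ω : Ω) : Fin M → ℂ := lmmse P (sys.q Z k) (sys.obs Z k) ω

/-- MRC output `r_k`, the `k`-th entry of `Q̂ᴴ y`. -/
def mrc (k : Fin K) (ω : Ω) : ℂ := star (sys.qHat Z P k ω) ⬝ᵥ sys.received Z ω

/-- The inner product `q̂_kᴴ q_i`. -/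
def gain (k i : Fin K) (ω : Ω) : ℂ := star (sys.qHat Z P k ω) ⬝ᵥ sys.q Z i ω

/-- Use-and-then-forget SINR of user `k`, in terms of expectations. -/
def uatfSINR (k : Fin K) : ℝ :=
  sys.p * ‖∫ ω, sys.gain Z P k k ω ∂P‖ ^ 2 /
    (sys.p * ((∫ ω, ‖sys.gain Z P k k ω‖ ^ 2 ∂P) - ‖∫ ω, sys.gain Z P k k ω ∂P‖ ^ 2)
      + sys.p * ∑ i ∈ Finset.univ.erase k, ∫ ω, ‖sys.gain Z P k i ω‖ ^ 2 ∂P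
      + sys.σ ^ 2 * ∫ ω, ∑ m, ‖sys.qHat Z P k ω m‖ ^ 2 ∂P)

/-- Use-and-then-forget bound on the ergodic rate of user `k`, in bits per channel use. -/
def uatfRate (k : Fin K) : ℝ := sys.preLog * Real.logb 2 (1 + sys.uatfSINR Z P k)

/-- Ergodic rate of user `k` (bits per channel use, pilot overhead included) when its Gaussian
symbol is decoded from the random observation `Y`. -/
def ergodicRate {B : Type*} [MeasurableSpace B] (k : Fin K) (Y : Ω → B) : ℝ≥0∞ :=
  ENNReal.ofReal (sys.preLog / Real.log 2) * mutualInformation P (Z (.symbol k)) Y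

end RISSystem

end

/-! ### Moments of real and complex Gaussian laws -/

/-! The randomness is exposed in three layers. Given the user-RIS fading `u`, each `q_k` is affine
in the remaining Gaussians (RIS-BS fading, direct fading, pilot noise): since `H̄₂` is rank one, its
conditional mean is a scalar multiple of `a_M`, and since distinct antennas see independent rows,
its conditional covariance is a scalar matrix (`q_eq`, `formCov_chanCoef`). The same holds for the
pilot observation.

By the law of total covariance, the unconditional covariances then have the form `r a_M a_Mᴴ + t I`.
Because `a_Mᴴ a_M = M`, such matrices are closed under multiplication (`rankOneAdd_mul`), and the
LMMSE matrix is `A = a3 a_M a_Mᴴ + a4 I`. Three numbers describe it: its diagonal entry `e1`, its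
eigenvalue `e2` on `a_M`, and the diagonal entry `e3` of `A Aᴴ`. Hence `q̂_k` is affine in the same
Gaussians (`qHat_eq`).

Moments of `q̂_kᴴ q_i` are computed by Wick's formula (`hasMean_affine_two_two`), first
conditionally on `u` (`hasMean_inner_sq`). The result is a polynomial in products of cascaded
channels and inner products of user-RIS channels, which are sesquilinear in affine forms of `u`;
Wick's formula applied once more, now over `u`, gives `gainSqMean`. Fubini for independent blocks
(`HasMean.of_indepFun`) joins the layers, and the closed forms follow by algebra. The equality
`E{q̂_kᴴ q_k} = E‖q̂_k‖²` is the orthogonality of the LMMSE error.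

For the rate, the third layer is the data phase: given everything else, `r_k` is linear in the
symbols and the noise, so `E{r_k x_k*}` and `E|r_k|²` are known. Gibbs' variational bound, with the
log-likelihood ratio of the jointly Gaussian channel having these second moments as test function,
gives `I(x_k; r_k) ≥ log(1 + SINR)` whatever the law of `r_k` (`log_le_mutualInformation`).
Adjoining the channel estimates can only increase the information. -/

lemma integral_pow_four_gaussianReal (v : ℝ≥0) :
    ∫ x, x ^ 4 ∂(gaussianReal 0 v) = 3 * (v : ℝ) ^ 2 := by
  have h := iteratedDeriv_mgf_zero (X := fun x : ℝ => x) (μ := gaussianReal 0 v)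
    (by simp [integrableExpSet_fun_id_gaussianReal]) 4
  simp only [Pi.pow_apply] at h
  rw [← h, mgf_fun_id_gaussianReal]
  simp only [iteratedDeriv_succ, iteratedDeriv_zero]
  have e (t : ℝ) : HasDerivAt (fun t : ℝ => Real.exp (0 * t + v * t ^ 2 / 2))
      (Real.exp (0 * t + v * t ^ 2 / 2) * (v * t)) t := by
    have := (((hasDerivAt_id t).const_mul 0).add
      ((((hasDerivAt_id t).pow 2).const_mul (v : ℝ)).div_const 2)).exp
    convert! this using 1
    simp; ring
  -- Differentiating `exp(v t²/2) g` replaces `g` by `v t g + g'`. Starting from `1`, the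
  -- polynomials are `v t`, `v² t² + v`, `v³ t³ + 3 v² t`, and then one with value `3 v²` at `0`.
  have d (g g' : ℝ → ℝ) (hg : ∀ t, HasDerivAt g (g' t) t) :
      deriv (fun t : ℝ => Real.exp (0 * t + v * t ^ 2 / 2) * g t) =
        fun t => Real.exp (0 * t + v * t ^ 2 / 2) * (v * t * g t + g' t) := funext fun t => by
    rw [((e t).fun_mul (hg t)).deriv]; ring
  have d1 : deriv (fun t : ℝ => Real.exp (0 * t + v * t ^ 2 / 2)) =
      fun t => Real.exp (0 * t + v * t ^ 2 / 2) * (v * t) := funext fun t => (e t).deriv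
  rw [d1, d _ (fun _ => v) fun t => by simpa using (hasDerivAt_id t).const_mul (v : ℝ),
    d _ (fun t => 2 * v ^ 2 * t) fun t => ?_,
    d _ (fun t => 3 * v ^ 2 + 3 * v ^ 3 * t ^ 2) fun t => ?_]
  · simp
  · have := ((hasDerivAt_id t).fun_pow 3).const_mul ((v : ℝ) ^ 3) |>.add
      ((hasDerivAt_id t).const_mul (3 * (v : ℝ) ^ 2))
    convert! this using 1
    · ext t; simp; ring
    · simp; ring
  · have := (((hasDerivAt_id t).fun_pow 2).const_mul ((v : ℝ) ^ 2)).const_add (v : ℝ)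
    convert! this using 1
    · ext t; simp; ring
    · simp; ring

lemma integrable_pow_gaussianReal (v : ℝ≥0) (n : ℕ) :
    Integrable (fun x : ℝ => x ^ n) (gaussianReal 0 v) := by
  rcases Nat.eq_zero_or_pos n with rfl | hn
  · simp
  · exact (memLp_id_gaussianReal (n : ℝ≥0)).integrable_norm_pow (by omega) |>.mono'
      (by fun_prop) (by simp)

lemma integral_pow_two_gaussianReal (v : ℝ≥0) : ∫ x, x ^ 2 ∂(gaussianReal 0 v) = v := by
  have h := variance_fun_id_gaussianReal (μ := 0) (v := v)
  rw [variance_eq_integral (by fun_prop)] at h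
  simpa using h

lemma integral_pow_three_gaussianReal (v : ℝ≥0) : ∫ x, x ^ 3 ∂(gaussianReal 0 v) = 0 := by
  have h : ∫ x, x ^ 3 ∂((gaussianReal 0 v).map fun x => -x) = ∫ x, x ^ 3 ∂(gaussianReal 0 v) := by
    rw [gaussianReal_map_neg, neg_zero]
  rw [integral_map (by fun_prop) (by fun_prop)] at h
  have : ∫ x : ℝ, (-x) ^ 3 ∂(gaussianReal 0 v) = - ∫ x, x ^ 3 ∂(gaussianReal 0 v) := by
    rw [← integral_neg]; congr 1; ext x; ring
  linarith

lemma integral_complexGaussian (v : ℝ≥0) (F : ℂ → ℂ) (hF : Continuous F) :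
    ∫ z, F z ∂(complexGaussian v) =
      ∫ z : ℝ × ℝ, F ((z.1 : ℂ) + (z.2 : ℂ) * Complex.I)
        ∂((gaussianReal 0 (v / 2)).prod (gaussianReal 0 (v / 2))) :=
  integral_map (by fun_prop) hF.aestronglyMeasurable

lemma memLp_id_complexGaussian (v p : ℝ≥0) : MemLp id p (complexGaussian v) := by
  rw [complexGaussian, memLp_map_measure_iff (by fun_prop) (by fun_prop)]
  have h := memLp_id_gaussianReal (μ := 0) (v := v / 2) p
  have h1 : MemLp (fun z : ℝ × ℝ => (z.1 : ℂ)) p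
      ((gaussianReal 0 (v / 2)).prod (gaussianReal 0 (v / 2))) :=
    MemLp.ofReal (h.comp_measurePreserving (measurePreserving_fst))
  have h2 : MemLp (fun z : ℝ × ℝ => (z.2 : ℂ)) p
      ((gaussianReal 0 (v / 2)).prod (gaussianReal 0 (v / 2))) :=
    MemLp.ofReal (h.comp_measurePreserving (measurePreserving_snd))
  exact h1.add (h2.mul_const Complex.I)

/-- `f` is integrable with expectation `m`. -/
def HasMean {Ω : Type*} [MeasurableSpace Ω] (P : Measure Ω) (f : Ω → ℂ) (m : ℂ) : Prop :=
  Integrable f P ∧ ∫ ω, f ω ∂P = m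

/-! ### Calculus of expectations bundled with integrability -/

namespace HasMean

variable {Ω : Type*} [MeasurableSpace Ω] {P : Measure Ω} {f g : Ω → ℂ} {m m' : ℂ}

lemma add (hf : HasMean P f m) (hg : HasMean P g m') : HasMean P (fun ω => f ω + g ω) (m + m') :=
  ⟨hf.1.add hg.1, by rw [integral_add hf.1 hg.1, hf.2, hg.2]⟩

lemma sub (hf : HasMean P f m) (hg : HasMean P g m') : HasMean P (fun ω => f ω - g ω) (m - m') :=
  ⟨hf.1.sub hg.1, by rw [integral_sub hf.1 hg.1, hf.2, hg.2]⟩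

lemma const_mul (c : ℂ) (hf : HasMean P f m) : HasMean P (fun ω => c * f ω) (c * m) :=
  ⟨hf.1.const_mul c, by rw [integral_const_mul, hf.2]⟩

lemma mul_const (hf : HasMean P f m) (c : ℂ) : HasMean P (fun ω => f ω * c) (m * c) :=
  ⟨hf.1.mul_const c, by rw [integral_mul_const, hf.2]⟩

lemma sum {ι : Type*} {s : Finset ι} {f : ι → Ω → ℂ} {m : ι → ℂ}
    (h : ∀ i ∈ s, HasMean P (f i) (m i)) :
    HasMean P (fun ω => ∑ i ∈ s, f i ω) (∑ i ∈ s, m i) :=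
  ⟨integrable_finsetSum s fun i hi => (h i hi).1, by
    rw [integral_finsetSum s fun i hi => (h i hi).1]
    exact Finset.sum_congr rfl fun i hi => (h i hi).2⟩

lemma const [IsProbabilityMeasure P] (c : ℂ) : HasMean P (fun _ => c) c :=
  ⟨integrable_const c, by simp⟩

lemma conj (hf : HasMean P f m) : HasMean P (fun ω => star (f ω)) (star m) :=
  ⟨(LinearIsometryEquiv.integrable_comp_iff Complex.conjLIE).2 hf.1, by
    rw [← hf.2]; exact integral_conj⟩

lemma of_eq (hf : HasMean P f m) (hfg : ∀ ω, g ω = f ω) (hm : m' = m) : HasMean P g m' := by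
  rw [hm, funext hfg]; exact hf

lemma norm_sq (hf : HasMean P (fun ω => f ω * star (f ω)) m) :
    ((∫ ω, ‖f ω‖ ^ 2 ∂P : ℝ) : ℂ) = m := by
  rw [← hf.2, ← integral_complex_ofReal]
  congr 1; ext ω
  exact (by rw [Complex.star_def, Complex.mul_conj, Complex.normSq_eq_norm_sq] :
    f ω * star (f ω) = ((‖f ω‖ ^ 2 : ℝ) : ℂ)).symm

end HasMean

lemma hasMean_monomial_gaussianReal (v : ℝ≥0) (a b : ℕ) :
    HasMean ((gaussianReal 0 v).prod (gaussianReal 0 v))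
      (fun z : ℝ × ℝ => (z.1 : ℂ) ^ a * (z.2 : ℂ) ^ b)
      (((∫ x, x ^ a ∂(gaussianReal 0 v) : ℝ) : ℂ) *
          ((∫ x, x ^ b ∂(gaussianReal 0 v) : ℝ) : ℂ)) := by
  constructor
  · exact (((integrable_pow_gaussianReal v a).mul_prod (integrable_pow_gaussianReal v b)).ofReal
      (𝕜 := ℂ)).congr (ae_of_all _ fun z => by simp)
  · rw [← Complex.ofReal_mul, ← integral_prod_mul (fun x : ℝ => x ^ a) (fun x : ℝ => x ^ b),
      ← integral_complex_ofReal]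
    simp

/-- The mixed moments of order at most `(2, 2)` of the law `CN(0, v)`. -/
lemma hasMean_complexGaussian (v : ℝ≥0) {p q : ℕ} (hp : p ≤ 2) (hq : q ≤ 2) :
    HasMean (complexGaussian v) (fun z => z ^ p * star z ^ q)
      (if p = q then (p.factorial : ℂ) * (v : ℂ) ^ p else 0) := by
  suffices h : HasMean ((gaussianReal 0 (v / 2)).prod (gaussianReal 0 (v / 2)))
      (fun z : ℝ × ℝ => ((z.1 : ℂ) + (z.2 : ℂ) * Complex.I) ^ p *
        star ((z.1 : ℂ) + (z.2 : ℂ) * Complex.I) ^ q)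
      (if p = q then (p.factorial : ℂ) * (v : ℂ) ^ p else 0) by
    refine ⟨?_, ?_⟩
    · exact (integrable_map_measure (by fun_prop) (by fun_prop)).2 h.1
    · rw [integral_complexGaussian v _ (by fun_prop)]; exact h.2
  have hI := Complex.I_sq
  have hI3 : Complex.I ^ 3 = - Complex.I := by rw [pow_succ, hI]; ring
  have hI4 : Complex.I ^ 4 = 1 := Complex.I_pow_four
  have key (a b : ℕ) := hasMean_monomial_gaussianReal (v / 2) a b
  have m0 : ∫ x : ℝ, x ^ 0 ∂(gaussianReal 0 (v / 2)) = 1 := by simp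
  have m1 : ∫ x : ℝ, x ^ 1 ∂(gaussianReal 0 (v / 2)) = 0 := by
    simp
  have m2 := integral_pow_two_gaussianReal (v / 2)
  have m3 := integral_pow_three_gaussianReal (v / 2)
  have m4 := integral_pow_four_gaussianReal (v / 2)
  have cs (x y : ℝ) : star ((x : ℂ) + (y : ℂ) * Complex.I) = x - y * Complex.I := by
    simp [sub_eq_add_neg]
  -- Conjugation exchanges `p` and `q`, which leaves six cases.
  wlog hpq : q ≤ p generalizing p q
  · have := (this hq hp (by omega)).conj
    refine this.of_eq (fun z => ?_) ?_
    · simp [mul_comm]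
    · have h1 : p ≠ q := by omega
      simp [h1, h1.symm]
  have h00 := key 0 0
  have h10 := key 1 0
  have h01 := key 0 1
  have h11 := key 1 1
  have h20 := key 2 0
  have h02 := key 0 2
  have h30 := key 3 0
  have h03 := key 0 3
  have h21 := key 2 1
  have h12 := key 1 2
  have h22 := key 2 2
  have h40 := key 4 0
  have h04 := key 0 4
  rw [m0] at h00 h10 h01 h20 h02 h30 h03 h40 h04
  rw [m1] at h10 h01 h11 h21 h12
  rw [m2] at h20 h02 h21 h12 h22
  rw [m3] at h30 h03
  rw [m4] at h40 h04
  -- Each case expands `z = x + i y` into real monomials. In the case `(2, 2)`, `x⁴ + 2 x² y² + y⁴`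
  -- has mean `(3 + 2 + 3) (v/2)² = 2 v²`.
  interval_cases p <;> interval_cases q
  · exact h00.of_eq (by simp) (by simp)
  · exact (h10.add (h01.mul_const Complex.I)).of_eq (fun z => by simp) (by simp)
  · refine (h20.add h02).of_eq (fun z => by rw [cs]; linear_combination -z.2 ^ 2 * hI) ?_
    push_cast; simp
  · refine ((h20.sub h02).add (h11.mul_const (2 * Complex.I))).of_eq
      (fun z => by linear_combination z.2 ^ 2 * hI) ?_
    simp
  · refine ((h30.add (h21.mul_const Complex.I)).add (h12.add (h03.mul_const Complex.I))).of_eq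
      (fun z => ?_) ?_
    · simp only [cs]; linear_combination (-z.1 * z.2 ^ 2 - z.2 ^ 3 * Complex.I) * hI
    · simp
  · refine ((h40.add (h22.mul_const 2)).add h04).of_eq (fun z => ?_) ?_
    · simp only [cs]; linear_combination
        (-2 * z.1 ^ 2 * z.2 ^ 2 + z.2 ^ 4 * (Complex.I ^ 2 - 1)) * hI
    · push_cast; simp; ring

/-! ### Random variables with moments of all orders -/

section Moments

variable {Ω : Type*} [MeasurableSpace Ω] {P : Measure Ω}

/-- `f` has finite absolute moments of all orders. -/
def HasMoments (P : Measure Ω) (f : Ω → ℂ) : Prop := ∀ p : ℝ≥0, MemLp f p P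

namespace HasMoments

variable {f g : Ω → ℂ}

lemma add (hf : HasMoments P f) (hg : HasMoments P g) : HasMoments P (fun ω => f ω + g ω) :=
  fun p => (hf p).add (hg p)

lemma sub (hf : HasMoments P f) (hg : HasMoments P g) : HasMoments P (fun ω => f ω - g ω) :=
  fun p => (hf p).sub (hg p)

/-- Hölder's inequality with both exponents `2 * p`. Asking for all orders at once is what makes the
class closed under products. -/
lemma mul (hf : HasMoments P f) (hg : HasMoments P g) : HasMoments P (fun ω => f ω * g ω) := by
  intro p
  have : ENNReal.HolderTriple ((2 * p : ℝ≥0) : ℝ≥0∞) ((2 * p : ℝ≥0) : ℝ≥0∞) p := ⟨by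
    rw [ENNReal.coe_mul, ENNReal.mul_inv (by simp) (by simp), ← add_mul, ENNReal.coe_ofNat,
      ENNReal.inv_two_add_inv_two, one_mul]⟩
  exact (hg (2 * p)).mul (hf (2 * p))

lemma const [IsProbabilityMeasure P] (c : ℂ) : HasMoments P (fun _ => c) := fun _ => memLp_const c

lemma const_mul (c : ℂ) (hf : HasMoments P f) : HasMoments P (fun ω => c * f ω) :=
  fun p => (hf p).const_mul c

lemma conj (hf : HasMoments P f) : HasMoments P (fun ω => star (f ω)) := fun p => (hf p).star

lemma sum {ι : Type*} {s : Finset ι} {f : ι → Ω → ℂ} (h : ∀ i ∈ s, HasMoments P (f i)) :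
    HasMoments P (fun ω => ∑ i ∈ s, f i ω) := fun p => memLp_finsetSum s fun i hi => h i hi p

lemma pow [IsProbabilityMeasure P] (hf : HasMoments P f) (n : ℕ) :
    HasMoments P (fun ω => f ω ^ n) := by
  induction n with
  | zero => simpa using const 1
  | succ n ih => simpa only [pow_succ] using ih.mul hf

lemma prod [IsProbabilityMeasure P] {ι : Type*} {s : Finset ι} {f : ι → Ω → ℂ}
    (h : ∀ i ∈ s, HasMoments P (f i)) : HasMoments P (fun ω => ∏ i ∈ s, f i ω) := by
  classical
  induction s using Finset.induction_on with
  | empty => simpa using const 1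
  | insert i s hi ih =>
    simp only [Finset.prod_insert hi]
    exact (h i (by simp)).mul (ih fun j hj => h j (by simp [hj]))

lemma integrable (hf : HasMoments P f) : Integrable f P := by
  simpa [memLp_one_iff_integrable] using hf 1

lemma memLp_two (hf : HasMoments P f) : MemLp f 2 P := by simpa using hf 2

end HasMoments

end Moments

/-- An independent family of circularly symmetric complex Gaussians of variances `v`. -/
structure CircularFamily {Ω J : Type*} [MeasurableSpace Ω] (P : Measure Ω) (v : J → ℝ≥0)
    (z : J → Ω → ℂ) : Prop where
  law : ∀ j, HasLaw (z j) (complexGaussian (v j)) P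
  indep : iIndepFun z P

/-- The linear form with coefficients `x` in the family `z`. -/
def linForm {Ω J : Type*} [Fintype J] (z : J → Ω → ℂ) (x : J → ℂ) (ω : Ω) : ℂ :=
  ∑ j, x j * z j ω

/-- The covariance `E{ξ ξ'ᴴ}` of the linear forms with coefficients `x` and `y`. -/
def formCov {J : Type*} [Fintype J] (v : J → ℝ≥0) (x y : J → ℂ) : ℂ :=
  ∑ j, (v j : ℂ) * (x j * star (y j))

/-- Monomials are coded by exponent vectors such as `Pi.single a 1 + Pi.single b 1`, which remain
correct when indices coincide. -/
lemma prod_pow_single {J R : Type*} [Fintype J] [DecidableEq J] [CommMonoid R] (w : J → R) (a : J) :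
    ∏ c, w c ^ (Pi.single a 1 : J → ℕ) c = w a := by
  rw [Finset.prod_eq_single a (fun b _ hb => by simp [hb]) (by simp)]
  simp

/-! ### Mixed moments of independent circular Gaussians -/

namespace CircularFamily

variable {Ω J : Type*} [MeasurableSpace Ω] {P : Measure Ω} {v : J → ℝ≥0} {z : J → Ω → ℂ}

lemma precomp (h : CircularFamily P v z) {I : Type*} {e : I → J} (he : Function.Injective e) :
    CircularFamily P (v ∘ e) (fun i => z (e i)) :=
  ⟨fun i => h.law (e i), h.indep.precomp he⟩

lemma hasMoments (h : CircularFamily P v z) (j : J) : HasMoments P (z j) := fun p => by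
  have h1 := (memLp_id_complexGaussian (v j) p)
  rw [← (h.law j).map_eq, memLp_map_measure_iff (by fun_prop) (h.law j).aemeasurable] at h1
  exact h1

variable [IsProbabilityMeasure P] [Fintype J]

lemma hasMean_monomial (h : CircularFamily P v z) {p q : J → ℕ} (hp : ∀ j, p j ≤ 2)
    (hq : ∀ j, q j ≤ 2) :
    HasMean P (fun ω => ∏ j, (z j ω ^ p j * star (z j ω) ^ q j))
      (∏ j, if p j = q j then ((p j).factorial : ℂ) * (v j : ℂ) ^ p j else 0) := by
  refine ⟨(HasMoments.prod fun j _ =>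
    ((h.hasMoments j).pow _).mul ((h.hasMoments j).conj.pow _)).integrable, ?_⟩
  rw [h.indep.integral_fun_prod_comp (f := fun j w => w ^ p j * star w ^ q j)
    (fun j => (h.law j).aemeasurable) (fun j => by fun_prop)]
  refine Finset.prod_congr rfl fun j _ => ?_
  rw [← (hasMean_complexGaussian (v j) (hp j) (hq j)).2, ← (h.law j).map_eq,
    integral_map (h.law j).aemeasurable (by fun_prop)]

/-- If the total degrees in `z` and its conjugate differ, some single variable has unequal
exponents, and its factor vanishes by circular symmetry. -/
lemma hasMean_monomial_of_ne (h : CircularFamily P v z) {p q : J → ℕ} (hp : ∑ j, p j ≤ 2)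
    (hq : ∑ j, q j ≤ 2) (hpq : ∑ j, p j ≠ ∑ j, q j) :
    HasMean P (fun ω => ∏ j, (z j ω ^ p j * star (z j ω) ^ q j)) 0 := by
  refine (h.hasMean_monomial
    (fun j => (Finset.single_le_sum (fun _ _ => Nat.zero_le _) (Finset.mem_univ j)).trans hp)
    (fun j => (Finset.single_le_sum (fun _ _ => Nat.zero_le _)
      (Finset.mem_univ j)).trans hq)).of_eq (fun _ => rfl) ?_
  obtain ⟨a, ha⟩ : ∃ a, p a ≠ q a := by
    by_contra! hc
    exact hpq (Finset.sum_congr rfl fun j _ => hc j)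
  exact (Finset.prod_eq_zero (Finset.mem_univ a) (if_neg ha)).symm

variable [DecidableEq J]

/-- A nonzero mean requires the multisets `{j, k}` and `{i, l}` to agree, which leaves the two
pairings. When all four indices coincide both indicators equal one, which accounts for the factor
`2!` in `E|z|⁴ = 2 v²`. -/
lemma hasMean_monomial_two_two (h : CircularFamily P v z) (i j k l : J) :
    HasMean P (fun ω => star (z i ω) * z j ω * z k ω * star (z l ω))
      (v i * v l * ((if i = j ∧ k = l then 1 else 0) + (if i = k ∧ j = l then 1 else 0))) := by
  have hs (a b c : J) : (Pi.single a 1 + Pi.single b 1 : J → ℕ) c ≤ 2 := by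
    simp only [Pi.add_apply, Pi.single_apply]; split_ifs <;> omega
  have key := h.hasMean_monomial (hs j k) (hs i l)
  refine key.of_eq (fun ω => ?_) ?_
  · simp only [Pi.add_apply, pow_add, Finset.prod_mul_distrib, prod_pow_single]
    ring
  · have zero (a : J) (ha : (Pi.single j 1 + Pi.single k 1 : J → ℕ) a ≠
        (Pi.single i 1 + Pi.single l 1 : J → ℕ) a) :
            (∏ c, if (Pi.single j 1 + Pi.single k 1 : J → ℕ) c =
        (Pi.single i 1 + Pi.single l 1 : J → ℕ) c then
        (((Pi.single j 1 + Pi.single k 1 : J → ℕ) c).factorial : ℂ) *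
          (v c : ℂ) ^ (Pi.single j 1 + Pi.single k 1 : J → ℕ) c else 0) = 0 :=
      Finset.prod_eq_zero (Finset.mem_univ a) (if_neg ha)
    have val (a b : J) : (∏ c, (((Pi.single a 1 + Pi.single b 1 : J → ℕ) c).factorial : ℂ) *
          (v c : ℂ) ^ (Pi.single a 1 + Pi.single b 1 : J → ℕ) c) =
          v a * v b * (1 + if a = b then 1 else 0) := by
      -- The only factorial different from one occurs for `a = b`; it is `2! = 1 + 1`, attached to
      -- `c = a`.
      have : ∀ c, (((Pi.single a 1 + Pi.single b 1 : J → ℕ) c).factorial : ℂ) =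
          if c = a then (1 + if a = b then 1 else 0) else 1 := by
        intro c
        simp only [Pi.add_apply, Pi.single_apply]
        split_ifs <;> (simp_all; try norm_num)
      simp only [this, Finset.prod_mul_distrib, Finset.prod_ite_eq', Finset.mem_univ, if_true]
      simp only [Pi.add_apply, pow_add, Finset.prod_mul_distrib, prod_pow_single]
      ring
    by_cases hij : i = j
    · subst hij
      by_cases hkl : k = l
      · subst hkl
        simp only [if_true, val]
        by_cases hik : i = k <;> simp [hik]
      · rw [zero k (by simp [Pi.single_apply, hkl])]
        simp only [true_and, hkl, if_false, zero_add]
        rw [if_neg (by rintro ⟨rfl, rfl⟩; exact hkl rfl), mul_zero]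
    · by_cases hik : i = k
      · subst hik
        by_cases hjl : j = l
        · subst hjl
          rw [add_comm (Pi.single j 1 : J → ℕ)]
          simp only [if_true, val, hij]
          simp
        · rw [zero j (by simp [hjl, Ne.symm hij, eq_comm])]
          simp [hij, hjl]
      · rw [zero i (by rw [Pi.add_apply, Pi.add_apply, Pi.single_eq_of_ne hij,
          Pi.single_eq_of_ne hik, Pi.single_eq_same]; omega)]
        simp [hij, hik]

lemma hasMean_one (h : CircularFamily P v z) (i : J) : HasMean P (fun ω => z i ω) 0 :=
  (h.hasMean_monomial_of_ne (p := Pi.single i 1) (q := 0) (by simp) (by simp) (by simp)).of_eq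
    (fun ω => by simp [Pi.single_apply, pow_ite]) rfl

lemma hasMean_two (h : CircularFamily P v z) (i j : J) :
    HasMean P (fun ω => z i ω * z j ω) 0 :=
  (h.hasMean_monomial_of_ne (p := Pi.single i 1 + Pi.single j 1) (q := 0)
    (by simp [Finset.sum_add_distrib]) (by simp) (by simp [Finset.sum_add_distrib])).of_eq
    (fun ω => by simp only [Pi.add_apply, Pi.zero_apply, pow_zero, mul_one, pow_add,
      Finset.prod_mul_distrib, prod_pow_single]) rfl

lemma hasMean_three (h : CircularFamily P v z) (i j k : J) :
    HasMean P (fun ω => star (z i ω) * z j ω * z k ω) 0 :=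
  (h.hasMean_monomial_of_ne (p := Pi.single j 1 + Pi.single k 1) (q := Pi.single i 1)
    (by simp [Finset.sum_add_distrib]) (by simp) (by simp [Finset.sum_add_distrib])).of_eq
    (fun ω => by simp only [Pi.add_apply, pow_add, Finset.prod_mul_distrib, prod_pow_single]; ring)
        rfl

lemma hasMean_one_one (h : CircularFamily P v z) (i j : J) :
    HasMean P (fun ω => star (z i ω) * z j ω) (v i * if i = j then 1 else 0) := by
  refine (h.hasMean_monomial (p := Pi.single j 1) (q := Pi.single i 1) (fun c => ?_)
    (fun c => ?_)).of_eq
    (fun ω => by simp only [Finset.prod_mul_distrib, prod_pow_single]; ring) ?_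
  · simp only [Pi.single_apply]; split_ifs <;> omega
  · simp only [Pi.single_apply]; split_ifs <;> omega
  · by_cases hij : i = j
    · subst hij
      have : ∀ c, (((Pi.single i 1 : J → ℕ) c).factorial : ℂ) = 1 := by
        intro c; simp only [Pi.single_apply]; split_ifs <;> simp
      simp only [this, if_true, one_mul, prod_pow_single, mul_one]
    · rw [Finset.prod_eq_zero (Finset.mem_univ i)]
      · simp [hij]
      · simp [hij]

end CircularFamily

/-! ### Wick's formula for affine forms -/

section Wick

variable {Ω J : Type*} [MeasurableSpace Ω] {P : Measure Ω} {v : J → ℝ≥0} {z : J → Ω → ℂ}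
  [IsProbabilityMeasure P] [Fintype J]

lemma star_formCov (x y : J → ℂ) : star (formCov v x y) = formCov v y x := by
  simp [formCov, star_sum, mul_comm]

namespace CircularFamily

lemma hasMean_linForm (h : CircularFamily P v z) (x : J → ℂ) : HasMean P (linForm z x) 0 := by
  classical
  exact (HasMean.sum (s := Finset.univ) fun j _ => (h.hasMean_one j).const_mul (x j)).of_eq
    (fun ω => rfl) (by simp)

lemma hasMean_linForm_two (h : CircularFamily P v z) (x y : J → ℂ) :
    HasMean P (fun ω => linForm z x ω * linForm z y ω) 0 := by
  classical
  refine (HasMean.sum (s := Finset.univ) fun i _ => HasMean.sum (s := Finset.univ) fun j _ =>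
    (h.hasMean_two i j).const_mul (x i * y j)).of_eq (fun ω => ?_) (by simp)
  simp only [linForm, Finset.sum_mul_sum]
  exact Finset.sum_congr rfl fun i _ => Finset.sum_congr rfl fun j _ => by ring

lemma hasMean_linForm_one_one (h : CircularFamily P v z) (x y : J → ℂ) :
    HasMean P (fun ω => star (linForm z x ω) * linForm z y ω) (formCov v y x) := by
  classical
  refine (HasMean.sum (s := Finset.univ) fun i _ => HasMean.sum (s := Finset.univ) fun j _ =>
    (h.hasMean_one_one i j).const_mul (star (x i) * y j)).of_eq (fun ω => ?_) ?_
  · simp only [linForm, star_sum, Finset.sum_mul_sum, star_mul']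
    exact Finset.sum_congr rfl fun i _ => Finset.sum_congr rfl fun j _ => by ring
  · simp only [formCov, mul_ite, mul_one, mul_zero, Finset.sum_ite_eq, Finset.mem_univ, if_true]
    exact Finset.sum_congr rfl fun i _ => by ring

lemma hasMean_linForm_three (h : CircularFamily P v z) (x y w : J → ℂ) :
    HasMean P (fun ω => star (linForm z x ω) * linForm z y ω * linForm z w ω) 0 := by
  classical
  refine (HasMean.sum (s := Finset.univ) fun i _ => HasMean.sum (s := Finset.univ) fun j _ =>
    HasMean.sum (s := Finset.univ) fun k _ =>
    (h.hasMean_three i j k).const_mul (star (x i) * y j * w k)).of_eq (fun ω => ?_) (by simp)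
  simp only [linForm, star_sum, star_mul']
  rw [mul_assoc, Finset.sum_mul_sum, Finset.sum_mul]
  refine Finset.sum_congr rfl fun i _ => ?_
  rw [Finset.mul_sum]
  refine Finset.sum_congr rfl fun j _ => ?_
  rw [Finset.mul_sum]
  exact Finset.sum_congr rfl fun k _ => by ring

lemma hasMean_linForm_two_two (h : CircularFamily P v z) (x₁ x₂ x₃ x₄ : J → ℂ) :
    HasMean P (fun ω => star (linForm z x₁ ω) * linForm z x₂ ω * linForm z x₃ ω *
      star (linForm z x₄ ω))
      (formCov v x₂ x₁ * formCov v x₃ x₄ + formCov v x₃ x₁ * formCov v x₂ x₄) := by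
  classical
  refine (HasMean.sum (s := Finset.univ) fun i _ => HasMean.sum (s := Finset.univ) fun l _ =>
    HasMean.sum (s := Finset.univ) fun j _ => HasMean.sum (s := Finset.univ) fun k _ =>
    (h.hasMean_monomial_two_two i j k l).const_mul
      (star (x₁ i) * star (x₄ l) * (x₂ j * x₃ k))).of_eq (fun ω => ?_) ?_
  · simp only [linForm, star_sum, star_mul']
    have reorder (a b c d : ℂ) : a * b * c * d = a * d * (b * c) := by ring
    rw [reorder, Finset.sum_mul_sum, Finset.sum_mul_sum, Finset.sum_mul]
    refine Finset.sum_congr rfl fun i _ => ?_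
    rw [Finset.sum_mul]
    refine Finset.sum_congr rfl fun l _ => ?_
    rw [Finset.mul_sum]
    refine Finset.sum_congr rfl fun j _ => ?_
    rw [Finset.mul_sum]
    exact Finset.sum_congr rfl fun k _ => by ring
  · simp only [formCov, Finset.sum_mul_sum, ← Finset.sum_add_distrib]
    refine Finset.sum_congr rfl fun i _ => Finset.sum_congr rfl fun l _ => ?_
    simp only [mul_add, Finset.sum_add_distrib, ite_and, mul_ite, mul_one, mul_zero,
      Finset.sum_ite_eq, Finset.sum_ite_eq', Finset.sum_ite_irrel, Finset.sum_const_zero,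
      Finset.mem_univ, if_true]
    ring

/-- Wick's formula for affine forms `c + ξ` in a circularly symmetric Gaussian family. -/
lemma hasMean_affine_two_two (h : CircularFamily P v z) (c₁ c₂ c₃ c₄ : ℂ) (x₁ x₂ x₃ x₄ : J → ℂ) :
    HasMean P (fun ω => star (c₁ + linForm z x₁ ω) * (c₂ + linForm z x₂ ω) *
      ((c₃ + linForm z x₃ ω) * star (c₄ + linForm z x₄ ω)))
      ((star c₁ * c₂ + formCov v x₂ x₁) * (c₃ * star c₄ + formCov v x₃ x₄) +
        formCov v x₃ x₁ * (c₂ * star c₄ + formCov v x₂ x₄) +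
        star c₁ * c₃ * formCov v x₂ x₄) := by
  have o1 := h.hasMean_linForm
  have o2 := h.hasMean_linForm_two
  have o11 := h.hasMean_linForm_one_one
  have o3 := h.hasMean_linForm_three
  -- Expansion by the number of linear factors: `s0` to `s3` collect the terms with zero to three of
  -- them. Odd terms vanish, and among the pairs only those joining a conjugated to an unconjugated
  -- form survive.
  have s0 := HasMean.const (P := P) (star c₁ * c₂ * c₃ * star c₄)
  have s1 := ((o1 x₁).conj.const_mul (c₂ * c₃ * star c₄)).add
    ((o1 x₂).const_mul (star c₁ * c₃ * star c₄)) |>.add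
    ((o1 x₃).const_mul (star c₁ * c₂ * star c₄)) |>.add
    ((o1 x₄).conj.const_mul (star c₁ * c₂ * c₃))
  have s2 := ((o11 x₁ x₂).const_mul (c₃ * star c₄)).add ((o11 x₁ x₃).const_mul (c₂ * star c₄))
    |>.add ((o2 x₁ x₄).conj.const_mul (c₂ * c₃)) |>.add ((o2 x₂ x₃).const_mul (star c₁ * star c₄))
    |>.add ((o11 x₄ x₂).const_mul (star c₁ * c₃)) |>.add ((o11 x₄ x₃).const_mul (star c₁ * c₂))
  have s3 := ((o3 x₁ x₂ x₃).const_mul (star c₄)).add ((o3 x₂ x₁ x₄).conj.const_mul c₃)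
    |>.add ((o3 x₃ x₁ x₄).conj.const_mul c₂) |>.add ((o3 x₄ x₂ x₃).const_mul (star c₁))
  refine ((((s0.add s1).add s2).add s3).add (h.hasMean_linForm_two_two x₁ x₂ x₃ x₄)).of_eq
    (fun ω => ?_) ?_
  · simp only [star_add, star_mul', star_star]; ring
  · simp only [star_zero]; ring

lemma hasMean_affine_one_one (h : CircularFamily P v z) (c₁ c₂ : ℂ) (x₁ x₂ : J → ℂ) :
    HasMean P (fun ω => star (c₁ + linForm z x₁ ω) * (c₂ + linForm z x₂ ω))
      (star c₁ * c₂ + formCov v x₂ x₁) := by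
  refine (((HasMean.const (star c₁ * c₂)).add ((h.hasMean_linForm x₁).conj.mul_const c₂)).add
    (((h.hasMean_linForm x₂).const_mul (star c₁)).add
      (h.hasMean_linForm_one_one x₁ x₂))).of_eq (fun ω => ?_) ?_
  · simp only [star_add]; ring
  · simp only [star_zero]; ring

lemma hasMean_affine (h : CircularFamily P v z) (c : ℂ) (x : J → ℂ) :
    HasMean P (fun ω => c + linForm z x ω) c :=
  ((HasMean.const c).add (h.hasMean_linForm x)).of_eq (fun _ => rfl) (by simp)

end CircularFamily

end Wick

/-! ### Averaging over independent blocks -/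

section Decoupling

variable {Ω : Type*} [MeasurableSpace Ω] {P : Measure Ω}

/-- Fubini's theorem for a function of two independent random variables. -/
lemma HasMean.of_indepFun [IsProbabilityMeasure P] {𝓧 𝓨 : Type*} [MeasurableSpace 𝓧]
    [MeasurableSpace 𝓨] {X : Ω → 𝓧}
    {Y : Ω → 𝓨} (hXY : IndepFun X Y P) (hX : AEMeasurable X P) (hY : AEMeasurable Y P)
    {F : 𝓧 → 𝓨 → ℂ} (hF : Measurable (Function.uncurry F))
    (hint : Integrable (fun ω => F (X ω) (Y ω)) P) {G : 𝓧 → ℂ}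
    (hG : ∀ x, ∫ ω, F x (Y ω) ∂P = G x) {m : ℂ} (hm : HasMean P (fun ω => G (X ω)) m) :
    HasMean P (fun ω => F (X ω) (Y ω)) m := by
  refine ⟨hint, ?_⟩
  have hlaw := (indepFun_iff_map_prod_eq_prod_map_map hX hY).1 hXY
  have : IsProbabilityMeasure (P.map X) := Measure.isProbabilityMeasure_map hX
  have : IsProbabilityMeasure (P.map Y) := Measure.isProbabilityMeasure_map hY
  have e1 : ∫ ω, F (X ω) (Y ω) ∂P =
      ∫ p, Function.uncurry F p ∂((P.map X).prod (P.map Y)) := by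
    rw [← hlaw, integral_map (hX.prodMk hY) hF.aestronglyMeasurable]; rfl
  have hint' : Integrable (Function.uncurry F) ((P.map X).prod (P.map Y)) := by
    rw [← hlaw, integrable_map_measure hF.aestronglyMeasurable (hX.prodMk hY)]; exact hint
  have hG' : (fun x => ∫ y, F x y ∂(P.map Y)) = G := funext fun x => by
    rw [integral_map hY (f := F x) (hF.comp measurable_prodMk_left).aestronglyMeasurable, hG]
  -- `G` comes without a measurability hypothesis; it inherits measurability as a parameter integral
  -- of `F`.
  have hGm : StronglyMeasurable G := by
    rw [← hG']
    exact hF.stronglyMeasurable.integral_prod_right (ν := P.map Y)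
  rw [e1, integral_prod _ hint', ← hm.2, ← integral_map hX hGm.aestronglyMeasurable]
  exact congrArg (fun g => ∫ x, g x ∂(P.map X)) hG'

/-- The index maps need not be injective: each block factors through the restriction of the family
to a finite image, and the two images are disjoint. -/
lemma indepFun_subfamilies {J I I' : Type*} [Fintype I] [Fintype I'] {z : J → Ω → ℂ}
    (h : iIndepFun z P) (hz : ∀ j, AEMeasurable (z j) P) {e : I → J} {e' : I' → J}
    (hee : ∀ i i', e i ≠ e' i') :
    IndepFun (fun ω i => z (e i) ω) (fun ω i => z (e' i) ω) P := by
  classical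
  have hd : Disjoint (Finset.univ.image e) (Finset.univ.image e') := by
    rw [Finset.disjoint_left]
    intro j hj hj'
    obtain ⟨i, -, rfl⟩ := Finset.mem_image.1 hj
    obtain ⟨i', -, hi'⟩ := Finset.mem_image.1 hj'
    exact hee i i' hi'.symm
  exact (h.indepFun_finset₀ _ _ hd hz).comp
    (φ := fun g i => g ⟨e i, Finset.mem_image_of_mem e (Finset.mem_univ i)⟩)
    (ψ := fun g i => g ⟨e' i, Finset.mem_image_of_mem e' (Finset.mem_univ i)⟩)
    (by fun_prop) (by fun_prop)

end Decoupling

/-! ### Sesquilinearity of the covariance of linear forms -/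

section FormCov

variable {J : Type*} [Fintype J] {v : J → ℝ≥0}

lemma formCov_add_left (x x' y : J → ℂ) :
    formCov v (x + x') y = formCov v x y + formCov v x' y := by
  simp only [formCov, ← Finset.sum_add_distrib, Pi.add_apply]
  exact Finset.sum_congr rfl fun j _ => by ring

lemma formCov_add_right (x y y' : J → ℂ) :
    formCov v x (y + y') = formCov v x y + formCov v x y' := by
  rw [← star_formCov, formCov_add_left, star_add, star_formCov, star_formCov]

lemma formCov_smul_left (c : ℂ) (x y : J → ℂ) : formCov v (c • x) y = c * formCov v x y := by
  simp only [formCov, Finset.mul_sum, Pi.smul_apply, smul_eq_mul]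
  exact Finset.sum_congr rfl fun j _ => by ring

lemma formCov_smul_right (c : ℂ) (x y : J → ℂ) :
    formCov v x (c • y) = star c * formCov v x y := by
  rw [← star_formCov, formCov_smul_left, star_mul', star_formCov]

lemma formCov_sum_left {ι : Type*} (s : Finset ι) (x : ι → J → ℂ) (y : J → ℂ) :
    formCov v (∑ i ∈ s, x i) y = ∑ i ∈ s, formCov v (x i) y := by
  simp only [formCov, Finset.sum_apply, Finset.sum_mul, Finset.mul_sum]
  exact Finset.sum_comm

lemma formCov_sum_right {ι : Type*} (s : Finset ι) (x : J → ℂ) (y : ι → J → ℂ) :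
    formCov v x (∑ i ∈ s, y i) = ∑ i ∈ s, formCov v x (y i) := by
  rw [← star_formCov, formCov_sum_left, star_sum]
  exact Finset.sum_congr rfl fun i _ => star_formCov _ _

end FormCov

/-! ### Moments of estimates by a rank-one plus scalar matrix -/

section LinearEstimate

variable {M : ℕ}

/-- The matrix `r a aᴴ + t I`. -/
def rankOneAdd (a : Fin M → ℂ) (r t : ℂ) : Matrix (Fin M) (Fin M) ℂ :=
  r • Matrix.vecMulVec a (star a) + t • 1

lemma rankOneAdd_apply (a : Fin M → ℂ) (r t : ℂ) (m m' : Fin M) :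
    rankOneAdd a r t m m' = r * (a m * star (a m')) + if m = m' then t else 0 := by
  simp [rankOneAdd, Matrix.vecMulVec_apply, Matrix.one_apply]

/-- Unimodular entries give `aᴴ a = M`, so `(a aᴴ)² = M a aᴴ`. Covariances, their inverses and the
LMMSE matrix are all of this shape, so matrix algebra reduces to algebra of the pairs `(r, t)`. -/
lemma rankOneAdd_mul {a : Fin M → ℂ} (ha : ∀ m, a m * star (a m) = 1) (r t r' t' : ℂ) :
    rankOneAdd a r t * rankOneAdd a r' t' =
      rankOneAdd a (M * r * r' + r * t' + t * r') (t * t') := by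
  have h : Matrix.vecMulVec a (star a) * Matrix.vecMulVec a (star a) =
      (M : ℂ) • Matrix.vecMulVec a (star a) := by
    ext m m'
    simp only [Matrix.mul_apply, Matrix.vecMulVec_apply, Pi.star_apply, Matrix.smul_apply,
      smul_eq_mul]
    have : ∀ j, a m * star (a j) * (a j * star (a m')) = a m * star (a m') := fun j => by
      linear_combination (a m * star (a m')) * ha j
    simp only [this, Finset.sum_const, Finset.card_univ, Fintype.card_fin, nsmul_eq_mul]
  simp only [rankOneAdd, add_mul, mul_add, Matrix.smul_mul, Matrix.mul_smul, h, mul_one, one_mul,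
    smul_smul, add_smul]
  module

variable {J : Type*} [Fintype J] {v : J → ℝ≥0}

/-- Coefficients of the image under `r a aᴴ + t I` of a vector of linear forms. -/
def estCoef (a : Fin M → ℂ) (r t : ℂ) (y : Fin M → J → ℂ) (m : Fin M) : J → ℂ :=
  ∑ m', rankOneAdd a r t m m' • y m'

/-- With a scalar cross-covariance only the diagonal entry of the estimation matrix matters, and by
unimodularity it is `r + t`. This is the origin of `e1`. -/
lemma formCov_estCoef_right {a : Fin M → ℂ} (ha : ∀ m, a m * star (a m) = 1) (r t : ℝ)
    {y : Fin M → J → ℂ} {x : J → ℂ} {ρ : ℂ} {m : Fin M}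
    (h : ∀ m', formCov v x (y m') = if m = m' then ρ else 0) :
    formCov v x (estCoef a r t y m) = (r + t) * ρ := by
  rw [estCoef, formCov_sum_right]
  simp only [formCov_smul_right, h, mul_ite, mul_zero, Finset.sum_ite_eq, Finset.mem_univ, if_true,
    rankOneAdd_apply, ha]
  simp

/-- The covariance of the estimate is `κ A Aᴴ`, and `A` is Hermitian because `r` and `t` are real,
so `A Aᴴ = A²`. Its diagonal entry is the origin of `e3`. -/
lemma formCov_estCoef {a : Fin M → ℂ} (ha : ∀ m, a m * star (a m) = 1) (r t : ℝ)
    {y : Fin M → J → ℂ} {κ : ℂ}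
    (h : ∀ m m', formCov v (y m) (y m') = if m = m' then κ else 0) (m m' : Fin M) :
    formCov v (estCoef a r t y m) (estCoef a r t y m') =
      κ * rankOneAdd a (M * r ^ 2 + 2 * r * t) (t ^ 2) m m' := by
  have hstar (m m' : Fin M) : star (rankOneAdd a (r : ℂ) t m m') = rankOneAdd a r t m' m := by
    rw [rankOneAdd_apply, rankOneAdd_apply]
    by_cases hmm : m = m'
    · simp [hmm, mul_comm]
    · simp [hmm, Ne.symm hmm, mul_comm]
  have hsq := congrFun (congrFun (rankOneAdd_mul ha (r : ℂ) t r t) m) m'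
  rw [Matrix.mul_apply] at hsq
  have e : rankOneAdd a ((M : ℂ) * r ^ 2 + 2 * r * t) (t ^ 2) m m' =
      rankOneAdd a ((M : ℂ) * r * r + r * t + t * r) (t * t) m m' := by
    congr 1 <;> ring
  rw [e, ← hsq, estCoef, estCoef, formCov_sum_left, Finset.mul_sum]
  refine Finset.sum_congr rfl fun p _ => ?_
  rw [formCov_smul_left, formCov_sum_right]
  simp only [formCov_smul_right, h, mul_ite, mul_zero, Finset.sum_ite_eq, Finset.mem_univ, if_true,
    hstar]
  ring

variable {Ω : Type*} [MeasurableSpace Ω] {P : Measure Ω} [IsProbabilityMeasure P]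
  {z : J → Ω → ℂ}

lemma hasMean_inner (h : CircularFamily P v z) {a : Fin M → ℂ} (ha : ∀ m, a m * star (a m) = 1)
    (r t : ℝ) {y w : Fin M → J → ℂ} {ρ : ℂ} (ν x : ℂ)
    (hwy : ∀ m m', formCov v (w m) (y m') = if m = m' then ρ else 0) :
    HasMean P (fun ω => ∑ m, star (ν * a m + linForm z (estCoef a r t y m) ω) *
      (x * a m + linForm z (w m) ω)) (M * (star ν * x + (r + t) * ρ)) := by
  refine (HasMean.sum fun m _ => h.hasMean_affine_one_one (ν * a m) (x * a m) _ _).of_eq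
    (fun ω => rfl) ?_
  have (m : Fin M) : star (ν * a m) * (x * a m) + formCov v (w m) (estCoef a r t y m) =
      star ν * x + (r + t) * ρ := by
    rw [formCov_estCoef_right ha r t (hwy m), star_mul']
    linear_combination star ν * x * ha m
  simp only [this, Finset.sum_const, Finset.card_univ, Fintype.card_fin, nsmul_eq_mul]

/-- Beyond the squared mean, three pairings remain. The noise in the estimate meets the mean `x a`
of the channel, with gain `M r + t` because `a` is an eigenvector of the estimation matrix; it meets
the fluctuation of the channel, through the trace of `A Aᴴ`; and the fluctuation of the channel
meets the mean `ν a` of the estimate. The correlation `ρ` enters only through the mean. -/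
lemma hasMean_inner_sq (h : CircularFamily P v z) {a : Fin M → ℂ}
    (ha : ∀ m, a m * star (a m) = 1) (r t : ℝ) {y w : Fin M → J → ℂ} {ρ κ κ' : ℂ} (ν x : ℂ)
    (hwy : ∀ m m', formCov v (w m) (y m') = if m = m' then ρ else 0)
    (hy : ∀ m m', formCov v (y m) (y m') = if m = m' then κ else 0)
    (hw : ∀ m m', formCov v (w m) (w m') = if m = m' then κ' else 0) :
    HasMean P (fun ω =>
        (∑ m, star (ν * a m + linForm z (estCoef a r t y m) ω) *
          (x * a m + linForm z (w m) ω)) *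
        star (∑ m, star (ν * a m + linForm z (estCoef a r t y m) ω) *
          (x * a m + linForm z (w m) ω)))
      (M * (star ν * x + (r + t) * ρ) * star (M * (star ν * x + (r + t) * ρ)) +
        M * κ * ((M * r + t) ^ 2 * (x * star x) + (M * r ^ 2 + 2 * r * t + t ^ 2) * κ') +
        M * κ' * (ν * star ν)) := by
  refine (HasMean.sum (s := Finset.univ) fun m _ => HasMean.sum (s := Finset.univ) fun m' _ =>
    h.hasMean_affine_two_two (ν * a m) (x * a m) (ν * a m') (x * a m') (estCoef a r t y m) (w m)
      (estCoef a r t y m') (w m')).of_eq (fun ω => ?_) ?_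
  · rw [star_sum, Finset.sum_mul_sum]
    refine Finset.sum_congr rfl fun m _ => Finset.sum_congr rfl fun m' _ => ?_
    rw [star_mul', star_star]
  · have hyw (m m') : formCov v (y m) (w m') = if m = m' then star ρ else 0 := by
      rw [← star_formCov, hwy]
      by_cases hmm : m = m'
      · simp [hmm]
      · simp [hmm, Ne.symm hmm]
    have hyw' (m : Fin M) : formCov v (estCoef a r t y m) (w m) = (r + t) * star ρ := by
      rw [← star_formCov, formCov_estCoef_right ha r t (hwy m)]; simp
    have key (m m' : Fin M) :
        (star (ν * a m) * (x * a m) + formCov v (w m) (estCoef a r t y m)) *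
            (ν * a m' * star (x * a m') + formCov v (estCoef a r t y m') (w m')) +
          formCov v (estCoef a r t y m') (estCoef a r t y m) *
            (x * a m * star (x * a m') + formCov v (w m) (w m')) +
          star (ν * a m) * (ν * a m') * formCov v (w m) (w m') =
        ((star ν * x + (r + t) * ρ) * star (star ν * x + (r + t) * ρ) +
            κ * (M * r ^ 2 + 2 * r * t) * (x * star x)) +
          if m = m' then κ * t ^ 2 * (x * star x) +
            κ * κ' * (M * r ^ 2 + 2 * r * t + t ^ 2) + κ' * (ν * star ν) else 0 := by
      have hr : star ((r : ℂ) + t) = r + t := by simp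
      have h1 : star (ν * a m) * (x * a m) = star ν * x := by
        rw [star_mul']; linear_combination star ν * x * ha m
      have h2 : ν * a m' * star (x * a m') = ν * star x := by
        rw [star_mul']; linear_combination ν * star x * ha m'
      have h3 : a m' * star (a m) * (x * a m * star (x * a m')) = x * star x := by
        rw [star_mul']
        linear_combination x * star x * (a m' * star (a m') * ha m + ha m')
      rw [formCov_estCoef_right ha r t (hwy m), hyw', formCov_estCoef ha r t hy, hw,
        rankOneAdd_apply, h1, h2, star_add, star_mul' (star ν), star_star, star_mul' _ ρ, hr]
      by_cases hmm : m = m'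
      · subst hmm
        have h4 : x * a m * star (x * a m) = x * star x := by
          rw [star_mul']; linear_combination x * star x * ha m
        have h5 : star (ν * a m) * (ν * a m) = ν * star ν := by
          rw [star_mul']; linear_combination ν * star ν * ha m
        simp only [if_true]
        rw [h4, h5]
        linear_combination κ * (M * r ^ 2 + 2 * r * t) * (x * star x + κ') * ha m
      · simp only [hmm, Ne.symm hmm, if_false]
        linear_combination κ * (M * r ^ 2 + 2 * r * t) * h3
    simp only [key, Finset.sum_add_distrib, Finset.sum_ite_eq, Finset.mem_univ, if_true,
      Finset.sum_const, Finset.card_univ, Fintype.card_fin, nsmul_eq_mul]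
    simp only [star_mul', star_natCast]
    ring

lemma hasMean_estimate_sq (h : CircularFamily P v z) {a : Fin M → ℂ}
    (ha : ∀ m, a m * star (a m) = 1) (r t : ℝ) {y : Fin M → J → ℂ} {κ : ℂ} (ν : ℂ)
    (hy : ∀ m m', formCov v (y m) (y m') = if m = m' then κ else 0) :
    HasMean P (fun ω => ∑ m, star (ν * a m + linForm z (estCoef a r t y m) ω) *
        (ν * a m + linForm z (estCoef a r t y m) ω))
      (M * (ν * star ν + (M * r ^ 2 + 2 * r * t + t ^ 2) * κ)) := by
  refine (HasMean.sum fun m _ => h.hasMean_affine_one_one (ν * a m) (ν * a m) _ _).of_eq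
    (fun ω => rfl) ?_
  have (m : Fin M) : star (ν * a m) * (ν * a m) +
      formCov v (estCoef a r t y m) (estCoef a r t y m) =
      ν * star ν + (M * r ^ 2 + 2 * r * t + t ^ 2) * κ := by
    rw [formCov_estCoef ha r t hy, star_mul', rankOneAdd_apply, ha]
    simp only [if_true]
    linear_combination star ν * ν * ha m
  simp only [this, Finset.sum_const, Finset.card_univ, Fintype.card_fin, nsmul_eq_mul]

end LinearEstimate

/-! ### The system as a Gaussian model that is affine given the user-RIS fading -/

noncomputable section

/-- Indices of the random quantities that, given the user-RIS channels, determine the channels to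
the base station and the pilot observations. -/
abbrev ChanIdx (M N K τ : ℕ) : Type := (Fin M × Fin N) ⊕ (Fin K × Fin M) ⊕ (Fin M × Fin τ)

namespace RISSystem

variable {M N K τ : ℕ}

/-- The sources form three disjoint blocks, averaged out in turn: `dataSource` for the data phase,
then `chanSource`, in which channels and observations are affine, then `userSource`, on which their
coefficients depend. -/
def chanSource : ChanIdx M N K τ → RISSource M N K τ :=
  Sum.elim (fun p => .risBS p.1 p.2) (Sum.elim (fun p => .direct p.1 p.2)
    (fun p => .pilotNoise p.1 p.2))

def userSource (p : Fin K × Fin N) : RISSource M N K τ := .userRIS p.1 p.2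

def dataSource : Fin K ⊕ Fin M → RISSource M N K τ :=
  Sum.elim (fun k => .symbol k) (fun m => .dataNoise m)

lemma chanSource_injective : Function.Injective
    (chanSource (M := M) (N := N) (K := K) (τ := τ)) := by
  rintro (⟨a, b⟩ | ⟨a, b⟩ | ⟨a, b⟩) (⟨c, d⟩ | ⟨c, d⟩ | ⟨c, d⟩) h <;> simp_all [chanSource]

lemma userSource_injective : Function.Injective
    (userSource (M := M) (N := N) (K := K) (τ := τ)) := by
  rintro ⟨a, b⟩ ⟨c, d⟩ h; simp_all [userSource]

lemma dataSource_injective : Function.Injective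
    (dataSource (M := M) (N := N) (K := K) (τ := τ)) := by
  rintro (a | a) (b | b) h <;> simp_all [dataSource]

lemma userSource_ne_chanSource (p : Fin K × Fin N) (j : ChanIdx M N K τ) :
    userSource p ≠ chanSource j := by
  rcases j with (⟨a, b⟩ | ⟨a, b⟩ | ⟨a, b⟩) <;> simp [userSource, chanSource]

lemma sumElim_user_chan_ne_dataSource (p : (Fin K × Fin N) ⊕ ChanIdx M N K τ) (j : Fin K ⊕ Fin M) :
    Sum.elim userSource chanSource p ≠ dataSource j := by
  rcases p with (⟨a, b⟩ | ⟨a, b⟩ | ⟨a, b⟩ | ⟨a, b⟩) <;> rcases j with j | j <;>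
    simp [userSource, chanSource, dataSource]

variable (sys : RISSystem M N K τ)

/-! ### Deterministic facts -/

/-- Product of the path-loss amplitudes of the two hops. -/
def amp (k : Fin K) : ℝ :=
  Real.sqrt (sys.β / (sys.δ + 1)) * Real.sqrt (sys.α k / (sys.ε k + 1))

/-- Phase factor of element `n` of the RIS. -/
def rot (n : Fin N) : ℂ := Complex.exp (Complex.I * (sys.θ n : ℂ))

/-- The entries of `a_Nᴴ Φ`. -/
def cascade (n : Fin N) : ℂ := star (sys.aN n) * sys.rot n

lemma exp_mul_star (x : ℝ) :
    Complex.exp (Complex.I * (x : ℂ)) * star (Complex.exp (Complex.I * (x : ℂ))) = 1 := by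
  rw [Complex.star_def, ← Complex.exp_conj, ← Complex.exp_add]
  simp

lemma aM_mul_star (m : Fin M) : sys.aM m * star (sys.aM m) = 1 := exp_mul_star _

lemma hBar_mul_star (k : Fin K) (n : Fin N) : sys.hBar k n * star (sys.hBar k n) = 1 :=
  exp_mul_star _

lemma aN_mul_star (n : Fin N) : sys.aN n * star (sys.aN n) = 1 := exp_mul_star _

lemma rot_mul_star (n : Fin N) : sys.rot n * star (sys.rot n) = 1 := exp_mul_star _

lemma cascade_mul_star (n : Fin N) : sys.cascade n * star (sys.cascade n) = 1 := by
  rw [cascade, star_mul', star_star]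
  linear_combination sys.rot n * star (sys.rot n) * sys.aN_mul_star n + sys.rot_mul_star n

lemma f_eq_sum (k : Fin K) : sys.f k = ∑ n, sys.cascade n * sys.hBar k n := by
  simp only [f, dotProduct, Phi, Matrix.mulVec_diagonal, Pi.star_apply, cascade, rot, mul_assoc]

lemma f_eq_sum_exp (k : Fin K) :
    sys.f k = ∑ n, Complex.exp (Complex.I * ((sys.zeta k n + sys.θ n : ℝ) : ℂ)) := by
  rw [f_eq_sum]
  refine Finset.sum_congr rfl fun n _ => ?_
  simp only [cascade, rot, aN, hBar, risResponse, Complex.star_def]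
  rw [← Complex.exp_conj, ← Complex.exp_add, ← Complex.exp_add]
  congr 1
  simp only [map_mul, Complex.conj_I, Complex.conj_ofReal, zeta, risPhase]
  push_cast
  ring

lemma amp_sq (k : Fin K) : sys.amp k ^ 2 = sys.c k := by
  have := sys.α_nonneg k; have := sys.ε_nonneg k; have := sys.β_nonneg; have := sys.δ_nonneg
  rw [amp, mul_pow, Real.sq_sqrt (by positivity), Real.sq_sqrt (by positivity), c, div_mul_div_comm]

lemma c_nonneg (k : Fin K) : 0 ≤ sys.c k := by rw [← amp_sq]; positivity

/-- For `τ = 0` the Gram matrix of the pilots would vanish, contradicting orthonormality once a user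
exists. Positivity of `s`, and with it invertibility of the observation covariance, rests on this.
-/
lemma tau_pos (sys : RISSystem M N K τ) (k : Fin K) : 0 < τ := by
  rcases Nat.eq_zero_or_pos τ with h | h
  · subst h
    have := congrFun (congrFun sys.pilots_orthonormal k) k
    simp [Matrix.mul_apply] at this
  · exact h

lemma s_pos (k : Fin K) : 0 < sys.s := by
  have h1 := sys.tau_pos k; have h2 := sys.p_pos; have h3 := sys.σ_pos
  unfold s; positivity

lemma a1_nonneg (k : Fin K) : 0 ≤ sys.a1 k := by
  have := sys.c_nonneg k; have := sys.δ_nonneg; unfold a1; positivity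

lemma a2_nonneg (k : Fin K) : 0 ≤ sys.a2 k := by
  have := sys.c_nonneg k; have := sys.ε_nonneg k; have := sys.γ_nonneg k; unfold a2; positivity

/-! ### Channels as affine forms -/

/-- Normalised channel from user `k` to the RIS, as a function of its scattered part. -/
def ray (k : Fin K) (u : Fin K × Fin N → ℂ) (n : Fin N) : ℂ :=
  (Real.sqrt (sys.ε k) : ℂ) * sys.hBar k n + u (k, n)

/-- Normalised cascaded channel of user `k`, with its scattered part scaled by `e`. -/
def los (k : Fin K) (e : ℂ) (u : Fin K × Fin N → ℂ) : ℂ :=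
  (Real.sqrt (sys.ε k) : ℂ) * sys.f k + e * ∑ n, sys.cascade n * u (k, n)

/-- Coefficients of `q_k` in the RIS-BS and direct fading, given the user-RIS fading. -/
def chanCoef (k : Fin K) (u : Fin K × Fin N → ℂ) (m : Fin M) : ChanIdx M N K τ → ℂ :=
  Sum.elim (fun p => if p.1 = m then (sys.amp k : ℂ) * sys.rot p.2 * sys.ray k u p.2 else 0)
    (Sum.elim (fun p => if p = (k, m) then (Real.sqrt (sys.γ k) : ℂ) else 0) (fun _ => 0))

/-- Coefficients of the noise in the observation for user `k`. -/
def noiseCoef (k : Fin K) (m : Fin M) : ChanIdx M N K τ → ℂ :=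
  Sum.elim (fun _ => 0) (Sum.elim (fun _ => 0)
    (fun p => if p.1 = m then ((1 / Real.sqrt (τ * sys.p) : ℝ) : ℂ) * sys.S p.2 k else 0))

/-- Variance of an entry of `q_k`, given the user-RIS fading. -/
def condVar (k : Fin K) (u : Fin K × Fin N → ℂ) : ℂ :=
  sys.c k * ∑ n, sys.ray k u n * star (sys.ray k u n) + sys.γ k

/-- Covariance of the entries of `q_i` and `q_k`, given the user-RIS fading. -/
def condCov (k i : Fin K) (u : Fin K × Fin N → ℂ) : ℂ :=
  sys.amp k * sys.amp i * ∑ n, star (sys.ray k u n) * sys.ray i u n + if i = k then (sys.γ k : ℂ)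
      else 0

/-- Amplitude of the component of `q_k` along `a_M`; its square is `c k * δ`. -/
def losAmp (k : Fin K) : ℂ := sys.amp k * Real.sqrt sys.δ

variable {Ω : Type*} (Z : RISSource M N K τ → Ω → ℂ)

/-- The line-of-sight part of `H₂` has rank one, so it sends the whole user-RIS channel to a scalar
times `a_M`. What is left is linear in the RIS-BS and direct fading. -/
lemma q_eq (k : Fin K) (ω : Ω) (m : Fin M) :
    sys.q Z k ω m =
      (sys.losAmp k * sys.los k 1 fun p => Z (userSource p) ω) * sys.aM m +
        linForm (fun j => Z (chanSource j)) (sys.chanCoef k (fun p => Z (userSource p) ω) m) ω := by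
  have h1 : (sys.Phi *ᵥ sys.h Z k ω) = fun n => (Real.sqrt (sys.α k / (sys.ε k + 1)) : ℂ) *
      (sys.rot n * sys.ray k (fun p => Z (userSource p) ω) n) := by
    ext n
    simp only [Phi, Matrix.mulVec_diagonal, h, Pi.smul_apply, Pi.add_apply, smul_eq_mul, rot, ray,
      userSource]
    ring
  have h2 : sys.los k 1 (fun p => Z (userSource p) ω) =
      ∑ n, sys.cascade n * sys.ray k (fun p => Z (userSource p) ω) n := by
    simp only [los, ray, f_eq_sum, mul_add, Finset.sum_add_distrib, one_mul, Finset.mul_sum]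
    congr 1
    exact Finset.sum_congr rfl fun n _ => by ring
  rw [q, h1, h2]
  simp only [Pi.add_apply, Matrix.mulVec, dotProduct, H2, H2Bar, Matrix.smul_apply,
    Matrix.add_apply,
    Matrix.of_apply, Matrix.vecMulVec_apply, smul_eq_mul, d, Pi.smul_apply, linForm,
    Fintype.sum_sum_type, chanCoef, Sum.elim_inl, Sum.elim_inr, Fintype.sum_prod_type, ite_mul,
    zero_mul, Finset.sum_const_zero, add_zero, Finset.sum_ite_irrel,
    Finset.sum_ite_eq', Finset.mem_univ, if_true, chanSource, losAmp, amp, cascade, Pi.star_apply]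
  rw [← add_assoc]
  congr 1
  rw [Finset.mul_sum, Finset.sum_mul, ← Finset.sum_add_distrib]
  refine Finset.sum_congr rfl fun n _ => ?_
  push_cast
  ring

/-- Orthonormality of the pilots removes the other users, so the observation is `q_k` plus projected
noise. -/
lemma obs_eq (k : Fin K) (ω : Ω) (m : Fin M) :
    sys.obs Z k ω m =
      (sys.losAmp k * sys.los k 1 fun p => Z (userSource p) ω) * sys.aM m +
        linForm (fun j => Z (chanSource j))
          (sys.chanCoef k (fun p => Z (userSource p) ω) m + sys.noiseCoef k m) ω := by
  have hτ := sys.tau_pos k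
  have hp := sys.p_pos
  have hr : (Real.sqrt (τ * sys.p) : ℂ) ≠ 0 := by
    rw [Complex.ofReal_ne_zero]; positivity
  have hS : (sys.Q Z ω * sys.Sᴴ) *ᵥ (fun t => sys.S t k) = sys.q Z k ω := by
    rw [← Matrix.mulVec_mulVec]
    have : sys.Sᴴ *ᵥ (fun t => sys.S t k) = Pi.single k 1 := by
      ext i
      have := congrFun (congrFun sys.pilots_orthonormal i) k
      simpa [Matrix.mul_apply, Matrix.mulVec, dotProduct, Matrix.one_apply, Pi.single_apply] using
        this
    rw [this]
    ext m
    simp [Q]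
  have hlin : linForm (fun j => Z (chanSource j))
      (sys.chanCoef k (fun p => Z (userSource p) ω) m + sys.noiseCoef k m) ω =
      linForm (fun j => Z (chanSource j)) (sys.chanCoef k (fun p => Z (userSource p) ω) m) ω +
      ∑ t, ((1 / Real.sqrt (τ * sys.p) : ℝ) : ℂ) * sys.S t k * Z (.pilotNoise m t) ω := by
    simp only [linForm, Pi.add_apply, add_mul, Finset.sum_add_distrib]
    congr 1
    simp [noiseCoef, Fintype.sum_prod_type, chanSource, ite_mul, Finset.sum_ite_irrel]
  rw [hlin, ← add_assoc, ← q_eq, obs, pilotSignal, Matrix.add_mulVec, Matrix.smul_mulVec, hS]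
  simp only [Pi.smul_apply, Pi.add_apply, smul_eq_mul, Matrix.mulVec, dotProduct, Matrix.of_apply,
    mul_add, Finset.mul_sum]
  congr 1
  · push_cast; field_simp
  · exact Finset.sum_congr rfl fun t _ => by ring

/-! ### Conditional covariances -/

/-- Different antennas involve disjoint rows of the RIS-BS fading and disjoint direct entries, hence
a scalar matrix. Within a row the RIS phases cancel, being unimodular and common to all users. -/
lemma formCov_chanCoef (k i : Fin K) (u : Fin K × Fin N → ℂ) (m m' : Fin M) :
    formCov (fun j => sys.sourceVar (chanSource j)) (sys.chanCoef i u m) (sys.chanCoef k u m') =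
      if m = m' then sys.condCov k i u else 0 := by
  have hγ : (Real.sqrt (sys.γ k) : ℂ) * Real.sqrt (sys.γ k) = sys.γ k := by
    rw [← Complex.ofReal_mul, Real.mul_self_sqrt (sys.γ_nonneg k)]
  simp only [formCov, Fintype.sum_sum_type, chanCoef, Sum.elim_inl, Sum.elim_inr,
    Fintype.sum_prod_type, chanSource, sourceVar, NNReal.coe_one, Complex.ofReal_one, one_mul,
    star_zero, mul_zero, Finset.sum_const_zero, add_zero, ite_mul, zero_mul, apply_ite star,
        mul_ite,
    Finset.sum_ite_irrel, Finset.sum_ite_eq', Finset.mem_univ, if_true]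
  by_cases hm : m = m'
  · subst hm
    simp only [if_true, condCov, Finset.mul_sum]
    congr 1
    · refine Finset.sum_congr rfl fun n _ => ?_
      simp only [star_mul', Complex.star_def, Complex.conj_ofReal]
      have := sys.rot_mul_star n
      rw [Complex.star_def] at this
      linear_combination sys.amp i * sys.amp k * sys.ray i u n * (starRingEnd ℂ) (sys.ray k u n) *
        this
    · by_cases hik : i = k
      · subst hik; simp [hγ]
      · simp [hik, Ne.symm hik]
  · simp [hm, Ne.symm hm]

lemma formCov_noiseCoef (k : Fin K) (m m' : Fin M) :
    formCov (fun j => sys.sourceVar (chanSource (N := N) j)) (sys.noiseCoef k m)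
        (sys.noiseCoef k m') =
      if m = m' then (sys.s : ℂ) else 0 := by
  have hτ := sys.tau_pos k
  have hp := sys.p_pos
  have hS := congrFun (congrFun sys.pilots_orthonormal k) k
  simp only [Matrix.mul_apply, Matrix.conjTranspose_apply, Matrix.one_apply_eq] at hS
  have hr : (Real.sqrt (τ * sys.p) : ℂ) * Real.sqrt (τ * sys.p) = τ * sys.p := by
    rw [← Complex.ofReal_mul, Real.mul_self_sqrt (by positivity)]; simp
  simp only [formCov, Fintype.sum_sum_type, noiseCoef, Sum.elim_inl, Sum.elim_inr,
    Fintype.sum_prod_type, chanSource, sourceVar,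
    star_zero, mul_zero, Finset.sum_const_zero, zero_add, ite_mul, zero_mul, apply_ite star,
        mul_ite,
    Finset.sum_ite_irrel, Finset.sum_ite_eq', Finset.mem_univ, if_true]
  by_cases hm : m = m'
  · subst hm
    simp only [if_true, s]
    rw [← mul_one ((sys.σ ^ 2 / (τ * sys.p) : ℝ) : ℂ), ← hS, Finset.mul_sum]
    refine Finset.sum_congr rfl fun t _ => ?_
    rw [Real.coe_toNNReal _ (by positivity)]
    simp only [star_mul', Complex.star_def, Complex.conj_ofReal]
    push_cast
    rw [← hr]
    ring
  · simp [hm, Ne.symm hm]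

lemma formCov_chanCoef_noiseCoef (k i : Fin K) (u : Fin K × Fin N → ℂ) (m m' : Fin M) :
    formCov (fun j => sys.sourceVar (chanSource j)) (sys.chanCoef i u m) (sys.noiseCoef k m') =
        0 := by
  simp [formCov, Fintype.sum_sum_type, chanCoef, noiseCoef]

lemma condCov_self (k : Fin K) (u : Fin K × Fin N → ℂ) : sys.condCov k k u = sys.condVar k u := by
  have : (sys.amp k : ℂ) * sys.amp k = sys.c k := by
    rw [← sys.amp_sq k]; push_cast; ring
  simp only [condCov, condVar, if_true, this]
  congr 2
  exact Finset.sum_congr rfl fun n _ => mul_comm _ _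

lemma formCov_obsCoef_right (k i : Fin K) (u : Fin K × Fin N → ℂ) (m m' : Fin M) :
    formCov (fun j => sys.sourceVar (chanSource j)) (sys.chanCoef i u m)
      (sys.chanCoef k u m' + sys.noiseCoef k m') = if m = m' then sys.condCov k i u else 0 := by
  rw [formCov_add_right, formCov_chanCoef, formCov_chanCoef_noiseCoef, add_zero]

lemma formCov_obsCoef (k : Fin K) (u : Fin K × Fin N → ℂ) (m m' : Fin M) :
    formCov (fun j => sys.sourceVar (chanSource j)) (sys.chanCoef k u m + sys.noiseCoef k m)
      (sys.chanCoef k u m' + sys.noiseCoef k m') =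
      if m = m' then sys.condVar k u + sys.s else 0 := by
  rw [formCov_add_left, formCov_obsCoef_right, formCov_add_right, formCov_noiseCoef,
    ← star_formCov, formCov_chanCoef_noiseCoef, condCov_self, star_zero, zero_add]
  split_ifs <;> simp

end RISSystem

end

/-! ### Moments over the user-RIS fading -/

noncomputable section

namespace CircularFamily

variable {Ω J : Type*} [MeasurableSpace Ω] {P : Measure Ω} {v : J → ℝ≥0} {z : J → Ω → ℂ}
  [IsProbabilityMeasure P] [Fintype J]

/-- Correlation of two sums of products of affine forms. -/
lemma hasMean_sum_mul_star_sum (h : CircularFamily P v z) {ι ι' : Type*} [Fintype ι] [Fintype ι']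
    (c d : ι → ℂ) (x y : ι → J → ℂ) (c' d' : ι' → ℂ) (x' y' : ι' → J → ℂ) :
    HasMean P (fun ω => (∑ i, star (c i + linForm z (x i) ω) * (d i + linForm z (y i) ω)) *
        star (∑ i, star (c' i + linForm z (x' i) ω) * (d' i + linForm z (y' i) ω)))
      ((∑ i, (star (c i) * d i + formCov v (y i) (x i))) *
          star (∑ i, (star (c' i) * d' i + formCov v (y' i) (x' i))) +
        ∑ i, ∑ i', (formCov v (x' i') (x i) * (d i * star (d' i') + formCov v (y i) (y' i')) +
          star (c i) * c' i' * formCov v (y i) (y' i'))) := by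
  refine (HasMean.sum (s := Finset.univ) fun i _ => HasMean.sum (s := Finset.univ) fun i' _ =>
    h.hasMean_affine_two_two (c i) (d i) (c' i') (d' i') (x i) (y i) (x' i') (y' i')).of_eq
    (fun ω => ?_) ?_
  · rw [star_sum, Finset.sum_mul_sum]
    refine Finset.sum_congr rfl fun m _ => Finset.sum_congr rfl fun m' _ => ?_
    rw [star_mul', star_star]
  · rw [star_sum, Finset.sum_mul_sum, ← Finset.sum_add_distrib]
    refine Finset.sum_congr rfl fun i _ => ?_
    rw [← Finset.sum_add_distrib]
    refine Finset.sum_congr rfl fun i' _ => ?_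
    rw [star_add, star_mul', star_star, star_formCov]
    ring

lemma hasMean_sum_mul (h : CircularFamily P v z) {ι : Type*} [Fintype ι]
    (c d : ι → ℂ) (x y : ι → J → ℂ) :
    HasMean P (fun ω => ∑ i, star (c i + linForm z (x i) ω) * (d i + linForm z (y i) ω))
      (∑ i, (star (c i) * d i + formCov v (y i) (x i))) :=
  HasMean.sum fun i _ => h.hasMean_affine_one_one (c i) (d i) (x i) (y i)

end CircularFamily

namespace RISSystem

variable {M N K τ : ℕ} (sys : RISSystem M N K τ)

/-- Coefficients of `a_Nᴴ Φ h̃_k`. -/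
def cascadeCoef (k : Fin K) (p : Fin K × Fin N) : ℂ := if p.1 = k then sys.cascade p.2 else 0

lemma formCov_cascadeCoef (k i : Fin K) :
    formCov (fun _ => 1) (sys.cascadeCoef k) (sys.cascadeCoef i) = if k = i then (N : ℂ)
        else 0 := by
  simp only [formCov, cascadeCoef, Fintype.sum_prod_type, NNReal.coe_one, Complex.ofReal_one,
    one_mul, ite_mul, zero_mul, Finset.sum_ite_irrel, Finset.sum_const_zero, Finset.sum_ite_eq',
    Finset.mem_univ, if_true, apply_ite star, star_zero, mul_ite, mul_zero, cascade_mul_star]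
  by_cases h : i = k
  · simp [h]
  · simp [h, Ne.symm h]

lemma formCov_single_right {J : Type*} [Fintype J] [DecidableEq J] (x : J → ℂ) (j : J) :
    formCov (fun _ => 1) x (Pi.single j 1) = x j := by
  rw [formCov, Finset.sum_eq_single j (fun b _ hb => by simp [hb]) (by simp)]
  simp

lemma formCov_single_left {J : Type*} [Fintype J] [DecidableEq J] (x : J → ℂ) (j : J) :
    formCov (fun _ => 1) (Pi.single j 1) x = star (x j) := by
  rw [← star_formCov, formCov_single_right]

lemma linForm_single {Ω J : Type*} [Fintype J] [DecidableEq J] (z : J → Ω → ℂ) (j : J) (ω : Ω) :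
    linForm z (Pi.single j 1) ω = z j ω := by
  rw [linForm, Finset.sum_eq_single j (fun b _ hb => by simp [hb]) (by simp)]
  simp

section Outer

variable {Ω : Type*} {u : Fin K × Fin N → Ω → ℂ}

lemma ray_eq (k : Fin K) (n : Fin N) (ω : Ω) : sys.ray k (fun p => u p ω) n =
    (Real.sqrt (sys.ε k) : ℂ) * sys.hBar k n + linForm u (Pi.single (k, n) 1) ω := by
  rw [ray, linForm_single]

lemma los_eq (k : Fin K) (e : ℂ) (ω : Ω) : sys.los k e (fun p => u p ω) =
    (Real.sqrt (sys.ε k) : ℂ) * sys.f k + linForm u (e • sys.cascadeCoef k) ω := by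
  simp only [los, linForm, Finset.mul_sum, Pi.smul_apply, smul_eq_mul, cascadeCoef,
    Fintype.sum_prod_type, mul_ite, ite_mul, mul_zero, zero_mul, Finset.sum_ite_irrel,
    Finset.sum_const_zero, Finset.sum_ite_eq', Finset.mem_univ, if_true, mul_assoc]

/-- Product of two scaled cascaded channels. -/
def losProd (k : Fin K) (e : ℝ) (i : Fin K) (e' : ℝ) (u : Fin K × Fin N → ℂ) : ℂ :=
  star (sys.los k e u) * sys.los i e' u

/-- Inner product of two user-RIS channels. -/
def rayProd (k i : Fin K) (u : Fin K × Fin N → ℂ) : ℂ :=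
  ∑ n, star (sys.ray k u n) * sys.ray i u n

def losMean (k : Fin K) : ℂ := (Real.sqrt (sys.ε k) : ℂ) * sys.f k

def losProdMean (k : Fin K) (e : ℝ) (i : Fin K) (e' : ℝ) : ℂ :=
  star (sys.losMean k) * sys.losMean i + if i = k then (e * e' * N : ℂ) else 0

def hBarProd (k i : Fin K) : ℂ := ∑ n, star (sys.hBar k n) * sys.hBar i n

def rayProdMean (k i : Fin K) : ℂ :=
  (Real.sqrt (sys.ε k) : ℂ) * Real.sqrt (sys.ε i) * sys.hBarProd k i + if i = k then (N : ℂ) else 0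

lemma sum_cascade_hBar (k : Fin K) :
    ∑ n, star (sys.cascade n) * star (sys.hBar k n) = star (sys.f k) := by
  rw [f_eq_sum, star_sum]
  exact Finset.sum_congr rfl fun n _ => (star_mul' _ _).symm

variable [MeasurableSpace Ω] {P : Measure Ω} [IsProbabilityMeasure P]

lemma hasMean_losProd (hu : CircularFamily P (fun _ => 1) u) (k : Fin K) (e : ℝ) (i : Fin K)
    (e' : ℝ) :
    HasMean P (fun ω => sys.losProd k e i e' (fun p => u p ω)) (sys.losProdMean k e i e') := by
  simp only [losProd, los_eq]
  refine (hu.hasMean_affine_one_one _ _ _ _).of_eq (fun ω => rfl) ?_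
  rw [formCov_smul_left, formCov_smul_right, formCov_cascadeCoef, losProdMean, losMean, losMean]
  by_cases hik : i = k
  · subst hik; simp; ring
  · simp [hik]

lemma hasMean_rayProd (hu : CircularFamily P (fun _ => 1) u) (k i : Fin K) :
    HasMean P (fun ω => sys.rayProd k i (fun p => u p ω)) (sys.rayProdMean k i) := by
  simp only [rayProd, ray_eq]
  refine (hu.hasMean_sum_mul _ _ _ _).of_eq (fun ω => rfl) ?_
  simp only [formCov_single_right, rayProdMean, hBarProd, Finset.sum_add_distrib, Finset.mul_sum]
  congr 1
  · refine Finset.sum_congr rfl fun n _ => ?_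
    simp; ring
  · by_cases h : i = k
    · subst h; simp
    · simp [h, Ne.symm h]

/-- This moment and the two that follow are instances of `hasMean_sum_mul_star_sum`: a `losProd` is
a sum with one term, indexed by `Unit`, and a `rayProd` is a sum over the RIS elements. -/
lemma hasMean_losProd_losProd (hu : CircularFamily P (fun _ => 1) u) (k : Fin K) (e : ℝ) (i : Fin K)
    (e' : ℝ) :
    HasMean P (fun ω => sys.losProd k e i e' (fun p => u p ω) *
        star (sys.losProd k e i e' (fun p => u p ω)))
      (sys.losProdMean k e i e' * star (sys.losProdMean k e i e') +
        e ^ 2 * N * (sys.losMean i * star (sys.losMean i) + e' ^ 2 * N) +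
        sys.losMean k * star (sys.losMean k) * (e' ^ 2 * N)) := by
  have h := hu.hasMean_sum_mul_star_sum (ι := Unit) (ι' := Unit) (fun _ => sys.losMean k)
    (fun _ => sys.losMean i) (fun _ => (e : ℂ) • sys.cascadeCoef k)
    (fun _ => (e' : ℂ) • sys.cascadeCoef i) (fun _ => sys.losMean k)
    (fun _ => sys.losMean i) (fun _ => (e : ℂ) • sys.cascadeCoef k)
    (fun _ => (e' : ℂ) • sys.cascadeCoef i)
  simp only [Finset.univ_unique, Finset.sum_singleton] at h
  simp only [losProd, los_eq]
  have hm : star (sys.losMean k) * sys.losMean i + formCov (fun _ => 1)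
      ((e' : ℂ) • sys.cascadeCoef i) ((e : ℂ) • sys.cascadeCoef k) = sys.losProdMean k e i e' := by
    rw [formCov_smul_left, formCov_smul_right, formCov_cascadeCoef, losProdMean]
    by_cases hik : i = k
    · subst hik; simp; ring
    · simp [hik]
  refine h.of_eq (fun ω => rfl) ?_
  rw [hm]
  simp only [formCov_smul_left, formCov_smul_right, formCov_cascadeCoef, if_true,
    Complex.star_def, Complex.conj_ofReal]
  ring

/-- Element `n` of the scattered channel correlates with its cascade through entry `n` of `a_Nᴴ Φ`.
Summed against the line-of-sight vectors, these entries rebuild `f`, which is why no further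
quantity appears. -/
lemma hasMean_losProd_rayProd (hu : CircularFamily P (fun _ => 1) u) (k : Fin K) (e : ℝ) (i : Fin K)
    (e' : ℝ) (k' i' : Fin K) :
    HasMean P (fun ω => sys.losProd k e i e' (fun p => u p ω) *
        star (sys.rayProd k' i' (fun p => u p ω)))
      (sys.losProdMean k e i e' * star (sys.rayProdMean k' i') +
        (if k' = k then e * (sys.losMean i * star (sys.losMean i') +
          if i = i' then (e' * N : ℂ) else 0) else 0) +
        if i = i' then star (sys.losMean k) * sys.losMean k' * e' else 0) := by
  have h := hu.hasMean_sum_mul_star_sum (ι := Unit) (ι' := Fin N) (fun _ => sys.losMean k)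
    (fun _ => sys.losMean i) (fun _ => (e : ℂ) • sys.cascadeCoef k)
    (fun _ => (e' : ℂ) • sys.cascadeCoef i) (fun n => Real.sqrt (sys.ε k') * sys.hBar k' n)
    (fun n => Real.sqrt (sys.ε i') * sys.hBar i' n) (fun n => Pi.single (k', n) 1)
    (fun n => Pi.single (i', n) 1)
  -- The means in Wick's formula are identified with `losProdMean` and `rayProdMean` by uniqueness
  -- of the expectation instead of recomputing the sums.
  have hm1 := (hu.hasMean_sum_mul (ι := Unit) (fun _ => sys.losMean k)
    (fun _ => sys.losMean i) (fun _ => (e : ℂ) • sys.cascadeCoef k)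
    (fun _ => (e' : ℂ) • sys.cascadeCoef i)).2.symm.trans
    (Eq.trans (by simp [losProd, los_eq, losMean]) (sys.hasMean_losProd hu k e i e').2)
  have hm2 := (hu.hasMean_sum_mul (fun n => Real.sqrt (sys.ε k') * sys.hBar k' n)
    (fun n => Real.sqrt (sys.ε i') * sys.hBar i' n) (fun n => Pi.single (k', n) 1)
    (fun n => Pi.single (i', n) 1)).2.symm.trans
    (Eq.trans (by simp [rayProd, ray_eq]) (sys.hasMean_rayProd hu k' i').2)
  rw [hm1, hm2] at h
  refine h.of_eq (fun ω => by simp [losProd, rayProd, los_eq, ray_eq, losMean]) ?_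
  rw [add_assoc]
  congr 1
  simp only [Finset.univ_unique, Finset.sum_singleton, Finset.sum_add_distrib, formCov_smul_left,
    formCov_smul_right, formCov_single_left, formCov_single_right, cascadeCoef,
    Complex.star_def, Complex.conj_ofReal]
  congr 1
  · by_cases hk : k' = k
    · subst hk
      have : ∀ n, star (sys.cascade n) * sys.cascade n = 1 := fun n => by
        rw [mul_comm, cascade_mul_star]
      rw [if_pos rfl, losMean, losMean]
      have hf := sys.sum_cascade_hBar i'
      simp only [Complex.star_def, if_true] at hf this ⊢
      rw [map_mul, Complex.conj_ofReal, ← hf]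
      by_cases hi : i = i'
      · subst hi
        simp only [if_true, mul_add, Finset.sum_add_distrib, Finset.mul_sum, map_mul,
          Complex.conj_ofReal]
        congr 1
        · exact Finset.sum_congr rfl fun n _ => by ring
        · rw [Finset.sum_congr rfl fun n _ => show (e : ℂ) * (starRingEnd ℂ) (sys.cascade n) *
            (e' * sys.cascade n) = e * e' by linear_combination (e * e' : ℂ) * this n]
          simp; ring
      · simp only [hi, Ne.symm hi, if_false, mul_zero, add_zero, Finset.mul_sum, map_mul,
          Complex.conj_ofReal]
        exact Finset.sum_congr rfl fun n _ => by ring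
    · simp [hk]
  · by_cases hi : i = i'
    · subst hi
      simp only [if_true, losMean, f_eq_sum, Finset.mul_sum, Finset.sum_mul]
      exact Finset.sum_congr rfl fun n _ => by ring
    · simp [hi, Ne.symm hi]

lemma hasMean_rayProd_rayProd (hu : CircularFamily P (fun _ => 1) u) (k i k' i' : Fin K) :
    HasMean P (fun ω => sys.rayProd k i (fun p => u p ω) *
        star (sys.rayProd k' i' (fun p => u p ω)))
      (sys.rayProdMean k i * star (sys.rayProdMean k' i') +
        (if k' = k then (Real.sqrt (sys.ε i) * Real.sqrt (sys.ε i') * sys.hBarProd i' i +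
          if i = i' then (N : ℂ) else 0) else 0) +
        if i = i' then Real.sqrt (sys.ε k) * Real.sqrt (sys.ε k') * sys.hBarProd k k' else 0) := by
  have h := hu.hasMean_sum_mul_star_sum
    (fun n => Real.sqrt (sys.ε k) * sys.hBar k n)
    (fun n => Real.sqrt (sys.ε i) * sys.hBar i n) (fun n => Pi.single (k, n) 1)
    (fun n => Pi.single (i, n) 1) (fun n => Real.sqrt (sys.ε k') * sys.hBar k' n)
    (fun n => Real.sqrt (sys.ε i') * sys.hBar i' n) (fun n => Pi.single (k', n) 1)
    (fun n => Pi.single (i', n) 1)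
  have hm (k i : Fin K) := (hu.hasMean_sum_mul (fun n => Real.sqrt (sys.ε k) * sys.hBar k n)
    (fun n => Real.sqrt (sys.ε i) * sys.hBar i n) (fun n => Pi.single (k, n) 1)
    (fun n => Pi.single (i, n) 1)).2.symm.trans
    (Eq.trans (by simp [rayProd, ray_eq]) (sys.hasMean_rayProd hu k i).2)
  rw [hm, hm] at h
  refine h.of_eq (fun ω => by simp [rayProd, ray_eq]) ?_
  rw [add_assoc]
  congr 1
  simp only [Finset.sum_add_distrib, formCov_single_right, Pi.single_apply, Prod.mk.injEq]
  congr 1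
  · by_cases hk : k' = k
    · subst hk
      by_cases hi : i = i'
      · subst hi
        simp [hBarProd, mul_add, Finset.sum_add_distrib, Finset.mul_sum]
        exact Finset.sum_congr rfl fun n _ => by ring
      · simp [hi, Ne.symm hi, hBarProd, Finset.mul_sum]
        exact Finset.sum_congr rfl fun n _ => by ring
    · simp [hk, Ne.symm hk]
  · by_cases hi : i = i'
    · subst hi
      simp [hBarProd, Finset.mul_sum]
      exact Finset.sum_congr rfl fun n _ => by ring
    · simp [hi, Ne.symm hi]

end Outer

end RISSystem

end

/-! ### Second-order statistics and the LMMSE estimate -/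

noncomputable section

namespace RISSystem

variable {M N K τ : ℕ} (sys : RISSystem M N K τ)

/-! ### Measurability and moments of the coefficients -/

lemma measurable_ray (k : Fin K) (n : Fin N) : Measurable fun u => sys.ray k u n := by
  unfold ray; fun_prop

lemma measurable_los (k : Fin K) (e : ℂ) : Measurable fun u => sys.los k e u := by
  unfold los; fun_prop

lemma measurable_chanCoef (k : Fin K) (m : Fin M) (j : ChanIdx M N K τ) :
    Measurable fun u => sys.chanCoef k u m j := by
  have := sys.measurable_ray k
  rcases j with ⟨a, b⟩ | j | j
  · simp only [chanCoef, Sum.elim_inl]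
    split_ifs
    · fun_prop
    · fun_prop
  · exact measurable_const
  · exact measurable_const

/-- Coefficients of the observation of user `k`, given the user-RIS fading. -/
def obsCoef (k : Fin K) (u : Fin K × Fin N → ℂ) (m : Fin M) : ChanIdx M N K τ → ℂ :=
  sys.chanCoef k u m + sys.noiseCoef k m

/-- Coefficients of the channel estimate of user `k`, given the user-RIS fading. -/
def hatCoef (k : Fin K) (u : Fin K × Fin N → ℂ) (m : Fin M) : ChanIdx M N K τ → ℂ :=
  estCoef sys.aM (sys.a3 k : ℂ) (sys.a4 k : ℂ) (sys.obsCoef k u) m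

lemma hatCoef_apply (k : Fin K) (u : Fin K × Fin N → ℂ) (m : Fin M) (j : ChanIdx M N K τ) :
    sys.hatCoef k u m j = ∑ m', rankOneAdd sys.aM (sys.a3 k) (sys.a4 k) m m' *
      (sys.chanCoef k u m' j + sys.noiseCoef k m' j) := by
  simp only [hatCoef, estCoef, obsCoef, Finset.sum_apply, Pi.smul_apply, Pi.add_apply, smul_eq_mul]

lemma measurable_obsCoef (k : Fin K) (m : Fin M) (j : ChanIdx M N K τ) :
    Measurable fun u => sys.obsCoef k u m j :=
  (sys.measurable_chanCoef k m j).add measurable_const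

lemma measurable_hatCoef (k : Fin K) (m : Fin M) (j : ChanIdx M N K τ) :
    Measurable fun u => sys.hatCoef k u m j := by
  have := sys.measurable_chanCoef k
  simp only [hatCoef_apply]
  fun_prop

/-- An affine function of the RIS-BS and direct fading whose coefficients depend on the user-RIS
fading. -/
def condAffine {U J : Type*} [Fintype J] (c : U → ℂ) (x : U → J → ℂ) (u : U) (y : J → ℂ) : ℂ :=
  c u + ∑ j, x u j * y j

lemma measurable_condAffine {U J : Type*} [MeasurableSpace U] [Fintype J] {c : U → ℂ}
    {x : U → J → ℂ} (hc : Measurable c) (hx : ∀ j, Measurable fun u => x u j) :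
    Measurable fun p : U × (J → ℂ) => condAffine c x p.1 p.2 := by
  unfold condAffine
  fun_prop

/-- The entries of `q_k`, of its observation, and of its estimate. -/
def qFun (k : Fin K) (m : Fin M) : (Fin K × Fin N → ℂ) → (ChanIdx M N K τ → ℂ) → ℂ :=
  condAffine (fun u => (sys.losAmp k * sys.los k 1 u) * sys.aM m) (fun u => sys.chanCoef k u m)

def obsFun (k : Fin K) (m : Fin M) : (Fin K × Fin N → ℂ) → (ChanIdx M N K τ → ℂ) → ℂ :=
  condAffine (fun u => (sys.losAmp k * sys.los k 1 u) * sys.aM m) (fun u => sys.obsCoef k u m)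

/-- The estimator keeps the mean and multiplies deviations along `a_M` by the eigenvalue `e2`. Hence
only the scattered part of the cascaded channel is rescaled, which is the role of the second
argument of `los`. -/
def hatFun (k : Fin K) (m : Fin M) : (Fin K × Fin N → ℂ) → (ChanIdx M N K τ → ℂ) → ℂ :=
  condAffine (fun u => (sys.losAmp k * sys.los k (sys.e2 k) u) * sys.aM m)
    (fun u => sys.hatCoef k u m)

lemma measurable_qFun (k : Fin K) (m : Fin M) :
    Measurable fun p : (Fin K × Fin N → ℂ) × (ChanIdx M N K τ → ℂ) => sys.qFun k m p.1 p.2 :=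
  measurable_condAffine (((sys.measurable_los k 1).const_mul _).mul_const _)
    (sys.measurable_chanCoef k m)

lemma measurable_obsFun (k : Fin K) (m : Fin M) :
    Measurable fun p : (Fin K × Fin N → ℂ) × (ChanIdx M N K τ → ℂ) => sys.obsFun k m p.1 p.2 :=
  measurable_condAffine (((sys.measurable_los k 1).const_mul _).mul_const _)
    (sys.measurable_obsCoef k m)

lemma measurable_hatFun (k : Fin K) (m : Fin M) :
    Measurable fun p : (Fin K × Fin N → ℂ) × (ChanIdx M N K τ → ℂ) => sys.hatFun k m p.1 p.2 :=
  measurable_condAffine (((sys.measurable_los k _).const_mul _).mul_const _)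
    (sys.measurable_hatCoef k m)

namespace IsModel

variable {sys} {Ω : Type*} [MeasurableSpace Ω] {P : Measure Ω} {Z : RISSource M N K τ → Ω → ℂ}

lemma family (hZ : sys.IsModel P Z) : CircularFamily P sys.sourceVar Z := ⟨hZ.hasLaw, hZ.indep⟩

lemma aemeasurable (hZ : sys.IsModel P Z) (a : RISSource M N K τ) : AEMeasurable (Z a) P :=
  (hZ.hasLaw a).aemeasurable

lemma user (hZ : sys.IsModel P Z) :
    CircularFamily P (fun _ => 1) (fun p : Fin K × Fin N => Z (userSource p)) :=
  hZ.family.precomp userSource_injective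

lemma chan (hZ : sys.IsModel P Z) : CircularFamily P
    (fun j : ChanIdx M N K τ => sys.sourceVar (chanSource j)) (fun j => Z (chanSource j)) :=
  hZ.family.precomp chanSource_injective

lemma data (hZ : sys.IsModel P Z) : CircularFamily P
    (fun j : Fin K ⊕ Fin M => sys.sourceVar (dataSource j)) (fun j => Z (dataSource j)) :=
  hZ.family.precomp dataSource_injective

lemma hasMoments_condAffine (hZ : sys.IsModel P Z) {c : (Fin K × Fin N → ℂ) → ℂ}
    {x : (Fin K × Fin N → ℂ) → ChanIdx M N K τ → ℂ}
    (hc : HasMoments P fun ω => c (fun p => Z (userSource p) ω))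
    (hx : ∀ j, HasMoments P fun ω => x (fun p => Z (userSource p) ω) j) :
    HasMoments P fun ω => condAffine c x (fun p => Z (userSource p) ω)
      (fun j => Z (chanSource j) ω) :=
  hc.add (HasMoments.sum fun j _ => (hx j).mul (hZ.chan.hasMoments j))

variable [IsProbabilityMeasure P]

lemma hasMoments_ray (hZ : sys.IsModel P Z) (k : Fin K) (n : Fin N) :
    HasMoments P fun ω => sys.ray k (fun p => Z (userSource p) ω) n :=
  (HasMoments.const _).add (hZ.user.hasMoments (k, n))

lemma hasMoments_los (hZ : sys.IsModel P Z) (k : Fin K) (e : ℂ) :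
    HasMoments P fun ω => sys.los k e (fun p => Z (userSource p) ω) :=
  (HasMoments.const _).add ((HasMoments.sum fun n _ =>
    (hZ.user.hasMoments (k, n)).const_mul _).const_mul e)

lemma hasMoments_chanCoef (hZ : sys.IsModel P Z) (k : Fin K) (m : Fin M) (j : ChanIdx M N K τ) :
    HasMoments P fun ω => sys.chanCoef k (fun p => Z (userSource p) ω) m j := by
  rcases j with ⟨a, b⟩ | j | j
  · simp only [chanCoef, Sum.elim_inl]
    split_ifs
    · exact (hZ.hasMoments_ray k b).const_mul _
    · exact HasMoments.const 0
  · exact HasMoments.const _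
  · exact HasMoments.const _

lemma hasMoments_obsCoef (hZ : sys.IsModel P Z) (k : Fin K) (m : Fin M) (j : ChanIdx M N K τ) :
    HasMoments P fun ω => sys.obsCoef k (fun p => Z (userSource p) ω) m j :=
  (hZ.hasMoments_chanCoef k m j).add (HasMoments.const _)

lemma hasMoments_hatCoef (hZ : sys.IsModel P Z) (k : Fin K) (m : Fin M) (j : ChanIdx M N K τ) :
    HasMoments P fun ω => sys.hatCoef k (fun p => Z (userSource p) ω) m j := by
  simp only [hatCoef_apply]
  exact HasMoments.sum fun m' _ =>
    ((hZ.hasMoments_chanCoef k m' j).add (HasMoments.const _)).const_mul _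

lemma hasMoments_qFun (hZ : sys.IsModel P Z) (k : Fin K) (m : Fin M) :
    HasMoments P fun ω => sys.qFun k m (fun p => Z (userSource p) ω)
      (fun j => Z (chanSource j) ω) :=
  hZ.hasMoments_condAffine (((hZ.hasMoments_los k 1).const_mul _).mul (HasMoments.const _))
    (hZ.hasMoments_chanCoef k m)

lemma hasMoments_obsFun (hZ : sys.IsModel P Z) (k : Fin K) (m : Fin M) :
    HasMoments P fun ω => sys.obsFun k m (fun p => Z (userSource p) ω)
      (fun j => Z (chanSource j) ω) :=
  hZ.hasMoments_condAffine (((hZ.hasMoments_los k 1).const_mul _).mul (HasMoments.const _))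
    (hZ.hasMoments_obsCoef k m)

lemma hasMoments_hatFun (hZ : sys.IsModel P Z) (k : Fin K) (m : Fin M) :
    HasMoments P fun ω => sys.hatFun k m (fun p => Z (userSource p) ω)
      (fun j => Z (chanSource j) ω) :=
  hZ.hasMoments_condAffine (((hZ.hasMoments_los k _).const_mul _).mul (HasMoments.const _))
    (hZ.hasMoments_hatCoef k m)

/-- Averaging first over the RIS-BS and direct fading and the noise, then over the user-RIS
fading. -/
lemma hasMean_tower (hZ : sys.IsModel P Z)
    {F : (Fin K × Fin N → ℂ) → (ChanIdx M N K τ → ℂ) → ℂ}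
    (hF : Measurable fun p : (Fin K × Fin N → ℂ) × (ChanIdx M N K τ → ℂ) => F p.1 p.2)
    (hint : HasMoments P fun ω => F (fun p => Z (userSource p) ω) (fun j => Z (chanSource j) ω))
    {G : (Fin K × Fin N → ℂ) → ℂ}
    (hG : ∀ u, HasMean P (fun ω => F u (fun j => Z (chanSource j) ω)) (G u)) {m : ℂ}
    (hm : HasMean P (fun ω => G (fun p => Z (userSource p) ω)) m) :
    HasMean P (fun ω => F (fun p => Z (userSource p) ω) (fun j => Z (chanSource j) ω)) m :=
  HasMean.of_indepFun (indepFun_subfamilies hZ.indep hZ.aemeasurable userSource_ne_chanSource)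
    (aemeasurable_pi_lambda _ fun _ => hZ.aemeasurable _)
    (aemeasurable_pi_lambda _ fun _ => hZ.aemeasurable _) hF hint.integrable
    (fun u => (hG u).2) hm

/-! ### Second-order statistics and the LMMSE estimate -/

lemma hasMean_los (hZ : sys.IsModel P Z) (k : Fin K) (e : ℂ) :
    HasMean P (fun ω => sys.los k e (fun p => Z (userSource p) ω)) (sys.losMean k) := by
  simp only [sys.los_eq (u := fun p => Z (userSource p))]
  exact hZ.user.hasMean_affine _ _

lemma hasMean_condVar (hZ : sys.IsModel P Z) (k : Fin K) :
    HasMean P (fun ω => sys.condVar k (fun p => Z (userSource p) ω)) (sys.a2 k) := by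
  refine (((sys.hasMean_rayProd hZ.user k k).const_mul (sys.c k)).add
    (HasMean.const (sys.γ k : ℂ))).of_eq (fun ω => ?_) ?_
  · simp only [condVar, rayProd, mul_comm]
  · have h1 : (Real.sqrt (sys.ε k) : ℂ) * Real.sqrt (sys.ε k) = sys.ε k := by
      rw [← Complex.ofReal_mul, Real.mul_self_sqrt (sys.ε_nonneg k)]
    have h2 : sys.hBarProd k k = N := by
      simp only [hBarProd, mul_comm (star _), hBar_mul_star]; simp
    rw [rayProdMean, h1, h2, a2, if_pos rfl]
    push_cast; ring

lemma meanVec_q (hZ : sys.IsModel P Z) (k : Fin K) :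
    meanVec P (sys.q Z k) = (sys.losAmp k * sys.losMean k) • sys.aM := by
  ext m
  have := hZ.hasMean_tower (sys.measurable_qFun k m) (hZ.hasMoments_qFun k m)
    (fun u => hZ.chan.hasMean_affine _ _) (((hZ.hasMean_los k 1).const_mul _).mul_const _)
  rw [meanVec, Pi.smul_apply, smul_eq_mul, ← this.2]
  exact integral_congr_ae (ae_of_all _ fun ω => sys.q_eq Z k ω m)

lemma meanVec_obs (hZ : sys.IsModel P Z) (k : Fin K) :
    meanVec P (sys.obs Z k) = (sys.losAmp k * sys.losMean k) • sys.aM := by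
  ext m
  have := hZ.hasMean_tower (sys.measurable_obsFun k m) (hZ.hasMoments_obsFun k m)
    (fun u => hZ.chan.hasMean_affine _ _) (((hZ.hasMean_los k 1).const_mul _).mul_const _)
  rw [meanVec, Pi.smul_apply, smul_eq_mul, ← this.2]
  exact integral_congr_ae (ae_of_all _ fun ω => sys.obs_eq Z k ω m)

lemma hasMean_los_centered (hZ : sys.IsModel P Z) (k : Fin K) :
    HasMean P (fun ω => star (sys.los k 1 (fun p => Z (userSource p) ω) - sys.losMean k) *
      (sys.los k 1 (fun p => Z (userSource p) ω) - sys.losMean k)) N := by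
  simp only [sys.los_eq (u := fun p => Z (userSource p)), losMean, add_sub_cancel_left]
  refine (hZ.user.hasMean_linForm_one_one _ _).of_eq (fun ω => rfl) ?_
  rw [one_smul, formCov_cascadeCoef, if_pos rfl]

/-- Law of total covariance: the fluctuation of the conditional mean along `a_M` gives the rank-one
part `a1`, and the mean of the conditional covariance gives the scalar part. The parameter `t` is
`0` for the channel against its observation and `s` for the observation against itself. -/
lemma hasMean_centered_mul_star (hZ : sys.IsModel P Z) (k : Fin K)
    {x : (Fin K × Fin N → ℂ) → ChanIdx M N K τ → ℂ} {t : ℂ} {m m' : Fin M}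
    (hx : ∀ j, Measurable fun u => x u j)
    (hx' : ∀ j, HasMoments P fun ω => x (fun p => Z (userSource p) ω) j)
    (hc : ∀ u, formCov (fun j => sys.sourceVar (chanSource j)) (x u) (sys.obsCoef k u m') =
      if m = m' then sys.condVar k u + t else 0) :
    HasMean P (fun ω =>
      (condAffine (fun u => (sys.losAmp k * sys.los k 1 u) * sys.aM m) x
        (fun p => Z (userSource p) ω) (fun j => Z (chanSource j) ω) -
          (sys.losAmp k * sys.losMean k) * sys.aM m) *
      star (sys.obsFun k m' (fun p => Z (userSource p) ω) (fun j => Z (chanSource j) ω) -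
          (sys.losAmp k * sys.losMean k) * sys.aM m'))
      (rankOneAdd sys.aM (sys.a1 k : ℂ) (sys.a2 k + t) m m') := by
  have hmeas := measurable_condAffine
    (((sys.measurable_los k 1).const_mul (sys.losAmp k)).mul_const (sys.aM m)) hx
  have hmom := hZ.hasMoments_condAffine
    (c := fun u => (sys.losAmp k * sys.los k 1 u) * sys.aM m)
        (((hZ.hasMoments_los k 1).const_mul (sys.losAmp k)).mul
    (HasMoments.const (sys.aM m))) hx'
  refine hZ.hasMean_tower (F := fun u y =>
      (condAffine (fun u => (sys.losAmp k * sys.los k 1 u) * sys.aM m) x u y -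
          (sys.losAmp k * sys.losMean k) * sys.aM m) *
      star (sys.obsFun k m' u y - (sys.losAmp k * sys.losMean k) * sys.aM m'))
    (G := fun u => sys.losAmp k * star (sys.losAmp k) * (sys.aM m * star (sys.aM m')) *
      (star (sys.los k 1 u - sys.losMean k) * (sys.los k 1 u - sys.losMean k)) +
      if m = m' then sys.condVar k u + t else 0) ?_ ?_ (fun u => ?_) ?_
  · exact (hmeas.sub measurable_const).mul (continuous_star.measurable.comp
      ((sys.measurable_obsFun k m').sub measurable_const))
  · exact (hmom.sub (HasMoments.const _)).mul
      ((hZ.hasMoments_obsFun k m').sub (HasMoments.const _)).conj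
  · refine (hZ.chan.hasMean_affine_one_one
      (sys.losAmp k * (sys.los k 1 u - sys.losMean k) * sys.aM m')
      (sys.losAmp k * (sys.los k 1 u - sys.losMean k) * sys.aM m)
      (sys.obsCoef k u m') (x u)).of_eq (fun ω => ?_) ?_
    · simp only [condAffine, obsFun, linForm, star_sub, star_add, star_mul']
      ring
    · rw [hc]
      simp only [star_mul']
      ring
  · rw [rankOneAdd_apply]
    have ha : sys.losAmp k * star (sys.losAmp k) * N = sys.a1 k := by
      have h1 : (sys.amp k : ℂ) * sys.amp k = sys.c k := by
        rw [← sys.amp_sq k]; push_cast; ring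
      have h2 : (Real.sqrt sys.δ : ℂ) * Real.sqrt sys.δ = sys.δ := by
        rw [← Complex.ofReal_mul, Real.mul_self_sqrt sys.δ_nonneg]
      simp only [losAmp, star_mul', Complex.star_def, Complex.conj_ofReal, a1]
      push_cast
      linear_combination (N : ℂ) * Real.sqrt sys.δ * Real.sqrt sys.δ * h1 + N * sys.c k * h2
    refine (((hZ.hasMean_los_centered k).const_mul _).add
      (m' := if m = m' then sys.a2 k + t else 0) ?_).of_eq (fun ω => rfl) ?_
    · split_ifs
      · exact (hZ.hasMean_condVar k).add (HasMean.const t)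
      · exact HasMean.const 0
    · rw [← ha]; ring

lemma crossCov_q_obs (hZ : sys.IsModel P Z) (k : Fin K) :
    crossCov P (sys.q Z k) (sys.obs Z k) = rankOneAdd sys.aM (sys.a1 k : ℂ) (sys.a2 k) := by
  ext m m'
  have := hZ.hasMean_centered_mul_star k (x := fun u => sys.chanCoef k u m) (t := 0) (m := m)
    (m' := m') (sys.measurable_chanCoef k m) (hZ.hasMoments_chanCoef k m)
    (fun u => by rw [obsCoef, formCov_obsCoef_right, condCov_self, add_zero])
  rw [add_zero] at this
  rw [← this.2, crossCov, Matrix.of_apply, hZ.meanVec_q, hZ.meanVec_obs]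
  refine integral_congr_ae (ae_of_all _ fun ω => ?_)
  simp only [q_eq, obs_eq]
  rfl

lemma crossCov_obs (hZ : sys.IsModel P Z) (k : Fin K) :
    crossCov P (sys.obs Z k) (sys.obs Z k) =
      rankOneAdd sys.aM (sys.a1 k : ℂ) (sys.a2 k + sys.s) := by
  ext m m'
  have := hZ.hasMean_centered_mul_star k (x := fun u => sys.obsCoef k u m) (t := sys.s) (m := m)
    (m' := m') (sys.measurable_obsCoef k m) (hZ.hasMoments_obsCoef k m)
    (fun u => by rw [obsCoef, obsCoef, formCov_obsCoef])
  rw [← this.2, crossCov, Matrix.of_apply, hZ.meanVec_obs]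
  refine integral_congr_ae (ae_of_all _ fun ω => ?_)
  simp only [obs_eq]
  rfl

end IsModel

/-- Sherman–Morrison formula; both denominators are positive because `s > 0`. -/
lemma rankOneAdd_inverse (k : Fin K) :
    rankOneAdd sys.aM (sys.a1 k : ℂ) (sys.a2 k + sys.s) *
      rankOneAdd sys.aM (-sys.a1 k / ((sys.a2 k + sys.s) * (sys.a2 k + sys.s + M * sys.a1 k)))
        (1 / (sys.a2 k + sys.s)) = 1 := by
  have h1 := sys.a1_nonneg k; have h2 := sys.a2_nonneg k; have h3 := sys.s_pos k
  have n1 : (sys.a2 k + sys.s : ℂ) ≠ 0 := by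
    have : sys.a2 k + sys.s ≠ 0 := by positivity
    exact_mod_cast this
  have n2 : (sys.a2 k + sys.s + M * sys.a1 k : ℂ) ≠ 0 := by
    have : sys.a2 k + sys.s + M * sys.a1 k ≠ 0 := by positivity
    exact_mod_cast this
  rw [rankOneAdd_mul sys.aM_mul_star]
  have e1 : (M : ℂ) * sys.a1 k *
      (-sys.a1 k / ((sys.a2 k + sys.s) * (sys.a2 k + sys.s + M * sys.a1 k))) +
      sys.a1 k * (1 / (sys.a2 k + sys.s)) + (sys.a2 k + sys.s) *
        (-sys.a1 k / ((sys.a2 k + sys.s) * (sys.a2 k + sys.s + M * sys.a1 k))) = 0 := by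
    field_simp; ring
  rw [e1, mul_one_div_cancel n1, rankOneAdd, zero_smul, zero_add, one_smul]

/-- The normal equation `A Cov{y, y} = Cov{q, y}`, which determines `a3` and `a4`. -/
lemma rankOneAdd_lmmse (k : Fin K) :
    rankOneAdd sys.aM (sys.a3 k : ℂ) (sys.a4 k) *
      rankOneAdd sys.aM (sys.a1 k : ℂ) (sys.a2 k + sys.s) =
      rankOneAdd sys.aM (sys.a1 k : ℂ) (sys.a2 k) := by
  have h1 := sys.a1_nonneg k; have h2 := sys.a2_nonneg k; have h3 := sys.s_pos k
  have n1 : (sys.a2 k + sys.s : ℂ) ≠ 0 := by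
    have : sys.a2 k + sys.s ≠ 0 := by positivity
    exact_mod_cast this
  have n2 : (sys.a2 k + sys.s + M * sys.a1 k : ℂ) ≠ 0 := by
    have : sys.a2 k + sys.s + M * sys.a1 k ≠ 0 := by positivity
    exact_mod_cast this
  rw [rankOneAdd_mul sys.aM_mul_star, a3, a4]
  push_cast
  congr 1
  · field_simp; ring
  · field_simp

lemma IsModel.qHat_eq {Ω : Type*} [MeasurableSpace Ω] {P : Measure Ω} [IsProbabilityMeasure P]
    {Z : RISSource M N K τ → Ω → ℂ} (hZ : sys.IsModel P Z) (k : Fin K) (ω : Ω) (m : Fin M) :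
    sys.qHat Z P k ω m = sys.hatFun k m (fun p => Z (userSource p) ω)
      (fun j => Z (chanSource j) ω) := by
  have hinv : IsUnit (rankOneAdd sys.aM (sys.a1 k : ℂ) (sys.a2 k + sys.s)).det :=
    Matrix.isUnit_det_of_right_inverse (sys.rankOneAdd_inverse k)
  have hA : rankOneAdd sys.aM (sys.a1 k : ℂ) (sys.a2 k) *
      (rankOneAdd sys.aM (sys.a1 k : ℂ) (sys.a2 k + sys.s))⁻¹ =
      rankOneAdd sys.aM (sys.a3 k : ℂ) (sys.a4 k) := by
    rw [← sys.rankOneAdd_lmmse k, Matrix.mul_assoc, Matrix.mul_nonsing_inv _ hinv, Matrix.mul_one]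
  rw [qHat, lmmse, hZ.crossCov_q_obs, hZ.crossCov_obs, hZ.meanVec_q, hZ.meanVec_obs, hA]
  set u : Fin K × Fin N → ℂ := fun p => Z (userSource p) ω with hu
  have hlos : sys.los k (sys.e2 k) u =
      sys.losMean k + sys.e2 k * (sys.los k 1 u - sys.losMean k) := by
    simp only [los, losMean]; ring
  -- `a_M` is an eigenvector of the LMMSE matrix, with eigenvalue `M a3 + a4 = e2`.
  have hAa : ∑ m', rankOneAdd sys.aM (sys.a3 k : ℂ) (sys.a4 k) m m' * sys.aM m' =
      sys.e2 k * sys.aM m := by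
    have (m' : Fin M) : rankOneAdd sys.aM (sys.a3 k : ℂ) (sys.a4 k) m m' * sys.aM m' =
        sys.a3 k * sys.aM m + if m = m' then sys.a4 k * sys.aM m' else 0 := by
      rw [rankOneAdd_apply]
      split_ifs
      · linear_combination (sys.a3 k : ℂ) * sys.aM m * sys.aM_mul_star m'
      · linear_combination (sys.a3 k : ℂ) * sys.aM m * sys.aM_mul_star m'
    simp only [this, Finset.sum_add_distrib, Finset.sum_ite_eq, Finset.mem_univ, if_true,
      Finset.sum_const, Finset.card_univ, Fintype.card_fin, nsmul_eq_mul, e2]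
    push_cast; ring
  have hlin : ∑ j, sys.hatCoef k u m j * Z (chanSource j) ω =
      ∑ m', rankOneAdd sys.aM (sys.a3 k : ℂ) (sys.a4 k) m m' *
        linForm (fun j => Z (chanSource j)) (sys.obsCoef k u m') ω := by
    simp only [hatCoef_apply, linForm, Finset.sum_mul, Finset.mul_sum, obsCoef, Pi.add_apply]
    rw [Finset.sum_comm]
    exact Finset.sum_congr rfl fun _ _ => Finset.sum_congr rfl fun _ _ => by ring
  rw [hatFun, condAffine, hlin, hlos]
  simp only [Pi.add_apply, Pi.smul_apply, smul_eq_mul, Matrix.mulVec, dotProduct, Pi.sub_apply,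
    obs_eq]
  have (m' : Fin M) : rankOneAdd sys.aM (sys.a3 k : ℂ) (sys.a4 k) m m' *
      (sys.losAmp k * sys.los k 1 u * sys.aM m' + linForm (fun j => Z (chanSource j))
        (sys.chanCoef k u m' + sys.noiseCoef k m') ω - sys.losAmp k * sys.losMean k * sys.aM m') =
      sys.losAmp k * (sys.los k 1 u - sys.losMean k) *
        (rankOneAdd sys.aM (sys.a3 k : ℂ) (sys.a4 k) m m' * sys.aM m') +
      rankOneAdd sys.aM (sys.a3 k : ℂ) (sys.a4 k) m m' *
        linForm (fun j => Z (chanSource j)) (sys.obsCoef k u m') ω := by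
    rw [obsCoef]; ring
  simp only [← hu, this, Finset.sum_add_distrib, ← Finset.mul_sum, hAa]
  ring

end RISSystem

end

/-! ### Second moments of the MRC gains -/

noncomputable section

namespace RISSystem

variable {M N K τ : ℕ} (sys : RISSystem M N K τ)

lemma star_rayProd (k i : Fin K) (u : Fin K × Fin N → ℂ) :
    star (sys.rayProd k i u) = sys.rayProd i k u := by
  rw [rayProd, rayProd, star_sum]
  exact Finset.sum_congr rfl fun n _ => by rw [star_mul', star_star, mul_comm]

/-- Power of the line-of-sight part of the normalised cascaded channel. -/
def losPow (k : Fin K) : ℝ := sys.ε k * ‖sys.f k‖ ^ 2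

lemma mul_star_eq_norm_sq (w : ℂ) : w * star w = ((‖w‖ ^ 2 : ℝ) : ℂ) := by
  rw [Complex.star_def, Complex.mul_conj, Complex.normSq_eq_norm_sq]

lemma sqrt_mul_sqrt {x : ℝ} (hx : 0 ≤ x) : (Real.sqrt x : ℂ) * Real.sqrt x = x := by
  rw [← Complex.ofReal_mul, Real.mul_self_sqrt hx]

lemma losMean_mul_star (k : Fin K) : sys.losMean k * star (sys.losMean k) = sys.losPow k := by
  rw [losMean, losPow, star_mul', Complex.ofReal_mul, ← mul_star_eq_norm_sq,
    ← sqrt_mul_sqrt (sys.ε_nonneg k), Complex.star_def, Complex.conj_ofReal]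
  ring

lemma amp_mul_amp (k : Fin K) : (sys.amp k : ℂ) * sys.amp k = sys.c k := by
  rw [← sys.amp_sq k]; push_cast; ring

lemma hBarProd_self (k : Fin K) : sys.hBarProd k k = N := by
  simp only [hBarProd, mul_comm (star _), hBar_mul_star]; simp

lemma rayProdMean_self (k : Fin K) : sys.rayProdMean k k = N * (sys.ε k + 1) := by
  rw [rayProdMean, sqrt_mul_sqrt (sys.ε_nonneg k), hBarProd_self, if_pos rfl]; ring

lemma losProdMean_self (k : Fin K) (e : ℝ) :
    sys.losProdMean k e k e = sys.losPow k + e ^ 2 * N := by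
  rw [losProdMean, if_pos rfl, mul_comm (star _), losMean_mul_star]; ring

/-- The mean of `q̂_kᴴ q_i`, divided by `M`. -/
def gainMean (k i : Fin K) : ℂ :=
  sys.amp k * sys.amp i * (sys.δ * sys.losProdMean k (sys.e2 k) i 1 +
    sys.e1 k * sys.rayProdMean k i) + if i = k then (sys.e1 k * sys.γ k : ℂ) else 0

/-- The second moment of `q̂_kᴴ q_i`. -/
def gainSqMean (k i : Fin K) : ℂ :=
  M ^ 2 * (sys.gainMean k i * star (sys.gainMean k i) + sys.c k * sys.c i *
    (sys.δ ^ 2 * (sys.e2 k ^ 2 * N * (sys.losPow i + N) + sys.losPow k * N) +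
      2 * sys.δ * sys.e1 k * (sys.e2 k * (sys.losPow i + N) + sys.losPow k) +
      sys.e1 k ^ 2 * (N * (sys.ε i + 1 + sys.ε k)))) +
  M * ((sys.a2 k + sys.s) * (sys.e2 k ^ 2 * (sys.c i * sys.δ * (sys.losPow i + N)) +
      sys.e3 k * sys.a2 i) +
    sys.c k * sys.δ * (sys.a2 i * (sys.losPow k + sys.e2 k ^ 2 * N)) +
    if i = k then (sys.c k : ℂ) * sys.c i * (sys.e2 k ^ 2 * sys.δ * (2 * sys.losPow i + N) +
        sys.e3 k * (N * (2 * sys.ε k + 1)) +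
        sys.δ * (2 * sys.e2 k * sys.losPow k + sys.e2 k ^ 2 * N)) else 0)

section Outer

variable {Ω : Type*} [MeasurableSpace Ω] {P : Measure Ω} {u : Fin K × Fin N → Ω → ℂ}
  [IsProbabilityMeasure P]

/-- The conditional mean of `q̂_kᴴ q_i` given the user-RIS fading, divided by `M`. -/
def condGain (k i : Fin K) (u : Fin K × Fin N → ℂ) : ℂ :=
  sys.amp k * sys.amp i * (sys.δ * sys.losProd k (sys.e2 k) i 1 u + sys.e1 k * sys.rayProd k i u) +
    if i = k then (sys.e1 k * sys.γ k : ℂ) else 0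

lemma condVar_eq (k : Fin K) (u : Fin K × Fin N → ℂ) :
    sys.condVar k u = sys.c k * sys.rayProd k k u + sys.γ k := by
  simp only [condVar, rayProd, mul_comm]

lemma hasMean_condGain (hu : CircularFamily P (fun _ => 1) u) (k i : Fin K) :
    HasMean P (fun ω => sys.condGain k i (fun p => u p ω)) (sys.gainMean k i) :=
  ((((sys.hasMean_losProd hu k (sys.e2 k) i 1).const_mul _).add
    ((sys.hasMean_rayProd hu k i).const_mul _)).const_mul _).add (HasMean.const _)

/-- `condGain` is an affine combination of one `losProd` and one `rayProd`, so its squared modulus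
only needs the three fourth-order moments over `u` and the two means. -/
lemma hasMean_condGain_sq (hu : CircularFamily P (fun _ => 1) u) (k i : Fin K) :
    HasMean P (fun ω => sys.condGain k i (fun p => u p ω) *
        star (sys.condGain k i (fun p => u p ω)))
      (sys.gainMean k i * star (sys.gainMean k i) + sys.c k * sys.c i *
    (sys.δ ^ 2 * (sys.e2 k ^ 2 * N * (sys.losPow i + N) + sys.losPow k * N) +
      2 * sys.δ * sys.e1 k * (sys.e2 k * (sys.losPow i + N) + sys.losPow k) +
      sys.e1 k ^ 2 * (N * (sys.ε i + 1 + sys.ε k)))) := by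
  have hL := sys.hasMean_losProd hu k (sys.e2 k) i 1
  have hR := sys.hasMean_rayProd hu k i
  have hLL := sys.hasMean_losProd_losProd hu k (sys.e2 k) i 1
  have hLR := sys.hasMean_losProd_rayProd hu k (sys.e2 k) i 1 k i
  have hRR := sys.hasMean_rayProd_rayProd hu k i k i
  simp only [if_true, losMean_mul_star, mul_comm (star (sys.losMean k)),
    hBarProd_self, sqrt_mul_sqrt (sys.ε_nonneg _)] at hLL hLR hRR
  -- The direct-channel term is treated as an unspecified real constant, so the cases `i = k` and `i
  -- ≠ k` need no separate treatment.
  obtain ⟨g, hg, hgs⟩ : ∃ g : ℂ, (if i = k then (sys.e1 k * sys.γ k : ℂ) else 0) = g ∧ star g = g :=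
    ⟨_, rfl, by split_ifs <;> simp⟩
  simp only [condGain, gainMean, hg]
  set a : ℂ := sys.amp k * sys.amp i with ha
  have has : star a = a := by simp [a]
  have ha2 : a ^ 2 = sys.c k * sys.c i := by
    rw [ha, ← amp_mul_amp, ← amp_mul_amp]; ring
  have hδ : star (sys.δ : ℂ) = sys.δ := by simp
  have he : star (sys.e1 k : ℂ) = sys.e1 k := by simp
  refine (((((hLL.const_mul (a ^ 2 * sys.δ ^ 2)).add
    ((hLR.add hLR.conj).const_mul (a ^ 2 * sys.δ * sys.e1 k))).add
    (hRR.const_mul (a ^ 2 * sys.e1 k ^ 2))).add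
    ((hL.add hL.conj).const_mul (a * sys.δ * g))).add
    (((hR.add hR.conj).const_mul (a * sys.e1 k * g)).add (HasMean.const (g ^ 2)))).of_eq
    (fun ω => ?_) ?_
  · simp only [star_add, star_mul', has, hδ, he, hgs, star_star]
    ring
  · have h1 : star (sys.e2 k : ℂ) = sys.e2 k := by simp
    have h2 : ∀ j, star (sys.losPow j : ℂ) = sys.losPow j := by simp
    have h3 : star (N : ℂ) = N := by simp
    simp only [star_add, star_mul', has, hδ, he, hgs, h1, h2, h3, star_star, star_one, ← ha2,
      Complex.ofReal_one]
    ring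

/-- For `i ≠ k` the factors depend on independent fading and the means multiply. The extra term for
`i = k` is their covariance; here and in `hasMean_condVar_condVar` it makes the second moment of a
user's own gain differ in form from that of an interferer. -/
lemma hasMean_condVar_losProd (hu : CircularFamily P (fun _ => 1) u) (k i : Fin K) (e : ℝ) :
    HasMean P (fun ω => sys.condVar i (fun p => u p ω) * sys.losProd k e k e (fun p => u p ω))
      (sys.a2 i * (sys.losPow k + e ^ 2 * N) +
        if i = k then (sys.c i : ℂ) * (2 * e * sys.losPow k + e ^ 2 * N) else 0) := by
  have hL := sys.hasMean_losProd hu k e k e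
  have hLR := sys.hasMean_losProd_rayProd hu k e k e i i
  simp only [star_rayProd] at hLR
  refine ((hLR.const_mul (sys.c i : ℂ)).add (hL.const_mul (sys.γ i))).of_eq (fun ω => ?_) ?_
  · rw [condVar_eq]; ring
  · rw [losProdMean_self, rayProdMean_self, a2]
    by_cases h : i = k
    · subst h
      simp only [if_true, mul_comm (star (sys.losMean i)), losMean_mul_star]
      simp
      ring
    · simp only [h, Ne.symm h, if_false]
      simp
      ring

lemma hasMean_condVar_condVar (hu : CircularFamily P (fun _ => 1) u) (k i : Fin K) :
    HasMean P (fun ω => sys.condVar k (fun p => u p ω) * sys.condVar i (fun p => u p ω))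
      (sys.a2 k * sys.a2 i +
        if i = k then (sys.c k : ℂ) * sys.c i * (N * (2 * sys.ε k + 1)) else 0) := by
  have hRR := sys.hasMean_rayProd_rayProd hu k k i i
  simp only [star_rayProd] at hRR
  refine (((hRR.const_mul (sys.c k * sys.c i : ℂ)).add
    ((sys.hasMean_rayProd hu k k).const_mul (sys.c k * sys.γ i))).add
    (((sys.hasMean_rayProd hu i i).const_mul (sys.c i * sys.γ k)).add
      (HasMean.const (sys.γ k * sys.γ i)))).of_eq (fun ω => ?_) ?_
  · rw [condVar_eq, condVar_eq]; ring
  · rw [rayProdMean_self, rayProdMean_self, a2, a2]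
    by_cases h : i = k
    · subst h
      simp only [if_true, hBarProd_self, sqrt_mul_sqrt (sys.ε_nonneg _)]
      simp
      ring
    · simp only [h, Ne.symm h, if_false]
      simp
      ring

end Outer

lemma condGain_eq (k i : Fin K) (u : Fin K × Fin N → ℂ) :
    star (sys.losAmp k * sys.los k (sys.e2 k) u) * (sys.losAmp i * sys.los i 1 u) +
      (sys.a3 k + sys.a4 k) * sys.condCov k i u = sys.condGain k i u := by
  have h := sqrt_mul_sqrt sys.δ_nonneg
  simp only [condGain, losAmp, condCov, losProd, rayProd, star_mul', Complex.star_def,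
    Complex.conj_ofReal, e1, Complex.ofReal_one, Complex.ofReal_add]
  rw [← h]
  split_ifs <;> ring

lemma los_mul_star (k : Fin K) (e : ℝ) (u : Fin K × Fin N → ℂ) :
    (sys.losAmp k * sys.los k e u) * star (sys.losAmp k * sys.los k e u) =
      sys.c k * sys.δ * sys.losProd k e k e u := by
  have h := sqrt_mul_sqrt sys.δ_nonneg
  have h' := sys.amp_mul_amp k
  simp only [losAmp, losProd, star_mul', Complex.star_def, Complex.conj_ofReal]
  rw [← h, ← h']
  ring

namespace IsModel

variable {sys} {Ω : Type*} [MeasurableSpace Ω] {P : Measure Ω} {Z : RISSource M N K τ → Ω → ℂ}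
  [IsProbabilityMeasure P]

lemma gain_eq (hZ : sys.IsModel P Z) (k i : Fin K) (ω : Ω) :
    sys.gain Z P k i ω = ∑ m, star (sys.hatFun k m (fun p => Z (userSource p) ω)
      (fun j => Z (chanSource j) ω)) * sys.qFun i m (fun p => Z (userSource p) ω)
      (fun j => Z (chanSource j) ω) := by
  simp only [gain, dotProduct, Pi.star_apply, hZ.qHat_eq, q_eq]
  rfl

lemma hasMoments_gain (hZ : sys.IsModel P Z) (k i : Fin K) : HasMoments P (sys.gain Z P k i) := by
  rw [funext (hZ.gain_eq k i)]
  exact HasMoments.sum fun m _ => (hZ.hasMoments_hatFun k m).conj.mul (hZ.hasMoments_qFun i m)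

lemma measurable_gainFun (k i : Fin K) :
    Measurable fun p : (Fin K × Fin N → ℂ) × (ChanIdx M N K τ → ℂ) =>
      ∑ m, star (sys.hatFun k m p.1 p.2) * sys.qFun i m p.1 p.2 :=
  Finset.measurable_sum _ fun m _ =>
    (continuous_star.measurable.comp (sys.measurable_hatFun k m)).mul (sys.measurable_qFun i m)

lemma hasMean_gain (hZ : sys.IsModel P Z) (k i : Fin K) :
    HasMean P (sys.gain Z P k i) (M * sys.gainMean k i) := by
  rw [funext (hZ.gain_eq k i)]
  refine hZ.hasMean_tower (F := fun u y => ∑ m, star (sys.hatFun k m u y) * sys.qFun i m u y)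
    (G := fun u => M * sys.condGain k i u)
    (measurable_gainFun k i) ?_ (fun u => ?_) ((sys.hasMean_condGain hZ.user k i).const_mul _)
  · have := hZ.hasMoments_gain k i
    rwa [funext (hZ.gain_eq k i)] at this
  · exact (hasMean_inner hZ.chan sys.aM_mul_star (sys.a3 k) (sys.a4 k)
      (sys.losAmp k * sys.los k (sys.e2 k) u) (sys.losAmp i * sys.los i 1 u)
      (sys.formCov_obsCoef_right k i u)).of_eq (fun ω => rfl) (by rw [condGain_eq])

lemma hasMean_gain_sq (hZ : sys.IsModel P Z) (k i : Fin K) :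
    HasMean P (fun ω => sys.gain Z P k i ω * star (sys.gain Z P k i ω)) (sys.gainSqMean k i) := by
  rw [funext (hZ.gain_eq k i)]
  refine hZ.hasMean_tower (F := fun u y =>
    (∑ m, star (sys.hatFun k m u y) * sys.qFun i m u y) *
      star (∑ m, star (sys.hatFun k m u y) * sys.qFun i m u y))
    -- The `M ^ 2` part is the squared conditional mean. The `M` part is the conditional variance:
    -- estimate noise against the channel mean, against the channel fluctuation, and channel
    -- fluctuation against the mean of the estimate.
    (G := fun u => M ^ 2 * (sys.condGain k i u * star (sys.condGain k i u)) +
      M * (sys.e2 k ^ 2 * (sys.c i * sys.δ) *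
          (sys.condVar k u * sys.losProd i 1 i 1 u + sys.s * sys.losProd i 1 i 1 u) +
        sys.e3 k * (sys.condVar k u * sys.condVar i u + sys.s * sys.condVar i u) +
        sys.c k * sys.δ * (sys.condVar i u * sys.losProd k (sys.e2 k) k (sys.e2 k) u)))
    ?_ ?_ (fun u => ?_) ?_
  · exact (measurable_gainFun k i).mul (continuous_star.measurable.comp (measurable_gainFun k i))
  · have := hZ.hasMoments_gain k i
    rw [funext (hZ.gain_eq k i)] at this
    exact this.mul this.conj
  · refine (hasMean_inner_sq hZ.chan sys.aM_mul_star (sys.a3 k) (sys.a4 k)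
      (sys.losAmp k * sys.los k (sys.e2 k) u) (sys.losAmp i * sys.los i 1 u)
      (sys.formCov_obsCoef_right k i u) (sys.formCov_obsCoef k u)
      (fun m m' => by rw [formCov_chanCoef, condCov_self])).of_eq (fun ω => rfl) ?_
    have h1 := sys.los_mul_star i 1 u
    rw [Complex.ofReal_one] at h1
    rw [condGain_eq, los_mul_star, h1, star_mul', star_natCast, e3, e2]
    push_cast
    ring
  · have v1 := sys.hasMean_condVar_losProd hZ.user i k 1
    have v2 := sys.hasMean_condVar_losProd hZ.user k i (sys.e2 k)
    have v3 := sys.hasMean_condVar_condVar hZ.user k i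
    have v4 := sys.hasMean_losProd hZ.user i 1 i 1
    have v5 := hZ.hasMean_condVar i
    refine (((sys.hasMean_condGain_sq hZ.user k i).const_mul (M ^ 2 : ℂ)).add
      (((((v1.add (v4.const_mul (sys.s : ℂ))).const_mul
        (sys.e2 k ^ 2 * (sys.c i * sys.δ) : ℂ)).add
        ((v3.add (v5.const_mul (sys.s : ℂ))).const_mul (sys.e3 k : ℂ))).add
        (v2.const_mul (sys.c k * sys.δ : ℂ))).const_mul (M : ℂ))).of_eq (fun ω => rfl) ?_
    rw [gainSqMean, losProdMean_self]
    by_cases h : i = k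
    · subst h
      simp only [if_true, Complex.ofReal_one]
      ring
    · simp only [h, Ne.symm h, if_false, Complex.ofReal_one]
      ring

lemma hasMean_qHat_sq (hZ : sys.IsModel P Z) (k : Fin K) :
    HasMean P (fun ω => ∑ m, star (sys.qHat Z P k ω m) * sys.qHat Z P k ω m)
      (M * (sys.c k * sys.δ * (sys.losPow k + sys.e2 k ^ 2 * N) +
        sys.e3 k * (sys.a2 k + sys.s))) := by
  simp only [hZ.qHat_eq]
  refine hZ.hasMean_tower (F := fun u y => ∑ m, star (sys.hatFun k m u y) * sys.hatFun k m u y)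
    (G := fun u => M * (sys.c k * sys.δ * sys.losProd k (sys.e2 k) k (sys.e2 k) u +
      sys.e3 k * (sys.condVar k u + sys.s))) ?_ ?_ (fun u => ?_) ?_
  · exact Finset.measurable_sum _ fun m _ =>
      (continuous_star.measurable.comp (sys.measurable_hatFun k m)).mul (sys.measurable_hatFun k m)
  · exact HasMoments.sum fun m _ => (hZ.hasMoments_hatFun k m).conj.mul (hZ.hasMoments_hatFun k m)
  · refine (hasMean_estimate_sq hZ.chan sys.aM_mul_star (sys.a3 k) (sys.a4 k)
      (sys.losAmp k * sys.los k (sys.e2 k) u) (sys.formCov_obsCoef k u)).of_eq (fun ω => rfl) ?_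
    rw [los_mul_star, e3]
    push_cast
    ring
  · rw [← losProdMean_self]
    exact (((sys.hasMean_losProd hZ.user k (sys.e2 k) k (sys.e2 k)).const_mul _).add
      (((hZ.hasMean_condVar k).add (HasMean.const _)).const_mul _)).const_mul _

end IsModel

end RISSystem

end

/-! ### Identification with the closed forms -/

noncomputable section

namespace RISSystem

variable {M N K τ : ℕ} (sys : RISSystem M N K τ)

lemma gainMean_self (k : Fin K) : M * sys.gainMean k k = sys.noiseTerm k := by
  rw [gainMean, losProdMean, rayProdMean_self, if_pos rfl, if_pos rfl, amp_mul_amp,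
    mul_comm (star _), losMean_mul_star, noiseTerm, losPow]
  push_cast
  ring

/-- Orthogonality principle: the LMMSE error is uncorrelated with the estimate, so `E‖q̂_k‖²` equals
`E{q̂_kᴴ q_k}`, already identified with `noiseTerm` in `gainMean_self`. -/
lemma noiseTerm_eq (k : Fin K) :
    M * (sys.c k * sys.δ * (sys.losPow k + sys.e2 k ^ 2 * N) + sys.e3 k * (sys.a2 k + sys.s)) =
      sys.noiseTerm k := by
  have h1 := sys.a1_nonneg k; have h2 := sys.a2_nonneg k; have h3 := sys.s_pos k
  have n1 : sys.a2 k + sys.s ≠ 0 := by positivity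
  have n2 : sys.a2 k + sys.s + M * sys.a1 k ≠ 0 := by positivity
  -- The trace of `A Cov{y, y} Aᴴ = Cov{q, y} Aᴴ`, divided by `M`.
  have key : sys.a1 k * sys.e2 k ^ 2 + sys.e3 k * (sys.a2 k + sys.s) =
      sys.a1 k * sys.e2 k + sys.a2 k * sys.e1 k := by
    rw [e1, e2, e3, a3, a4]
    field_simp
    ring
  rw [noiseTerm, losPow]
  have e1' : (N * sys.c k * (sys.ε k + 1) + sys.γ k) = sys.a2 k := rfl
  have e2' : N * sys.c k * sys.δ = sys.a1 k := rfl
  rw [e1', e2']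
  have e3' : sys.c k * sys.δ * (sys.ε k * ‖sys.f k‖ ^ 2 + sys.e2 k ^ 2 * N) =
    sys.c k * sys.δ * sys.ε k * ‖sys.f k‖ ^ 2 + sys.a1 k * sys.e2 k ^ 2 := by rw [a1]; ring
  rw [e3']
  linear_combination (M : ℝ) * key

lemma gainSqMean_self (k : Fin K) :
    sys.gainSqMean k k = ((sys.leakTerm k + sys.noiseTerm k ^ 2 : ℝ) : ℂ) := by
  have h := sys.gainMean_self k
  have h' : M * star (sys.gainMean k k) = sys.noiseTerm k := by
    have := congrArg star h
    simpa using this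
  have hsq : (M : ℂ) ^ 2 * (sys.gainMean k k * star (sys.gainMean k k)) = sys.noiseTerm k ^ 2 := by
    linear_combination star (sys.gainMean k k) * M * h + sys.noiseTerm k * h'
  rw [gainSqMean, if_pos rfl, mul_add, hsq, leakTerm, losPow, a2]
  push_cast
  ring

/-- For distinct users only line-of-sight components contribute to the mean gain: through the
cascade (`f`) and through the overlap of the vectors `h̄`. The real part is the cross term of these
two contributions. -/
lemma gainMean_of_ne {k i : Fin K} (hik : i ≠ k) :
    sys.gainMean k i * star (sys.gainMean k i) =
      ((sys.c k * sys.c i * (sys.δ ^ 2 * sys.losPow k * sys.losPow i +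
        sys.e1 k * sys.ε k * sys.ε i * (‖star (sys.hBar k) ⬝ᵥ sys.hBar i‖ ^ 2 * sys.e1 k +
          2 * sys.δ * (star (sys.f k) * sys.f i * (star (sys.hBar i) ⬝ᵥ sys.hBar k)).re)) : ℝ) :
              ℂ) := by
  have hH : star (sys.hBar k) ⬝ᵥ sys.hBar i = sys.hBarProd k i := by
    simp [dotProduct, hBarProd]
  have hH' : star (sys.hBar i) ⬝ᵥ sys.hBar k = star (sys.hBarProd k i) := by
    simp only [dotProduct, hBarProd, star_sum, star_mul', star_star, Pi.star_apply, mul_comm]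
  rw [hH, hH']
  have hre (w : ℂ) : (2 : ℂ) * (w.re : ℂ) = w + star w := by
    rw [Complex.star_def, Complex.add_conj]; push_cast; ring
  have hk := sqrt_mul_sqrt (sys.ε_nonneg k)
  have hi := sqrt_mul_sqrt (sys.ε_nonneg i)
  have hn := mul_star_eq_norm_sq (sys.hBarProd k i)
  push_cast at hn ⊢
  rw [← hn, ← losMean_mul_star, ← losMean_mul_star, mul_right_comm (2 : ℂ), hre]
  simp only [gainMean, losProdMean, rayProdMean, if_neg hik, add_zero, losMean, ← hk, ← hi,
    ← amp_mul_amp, star_add, star_mul', Complex.star_def, Complex.conj_ofReal, Complex.conj_conj]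
  ring

lemma gainSqMean_of_ne {k i : Fin K} (hik : i ≠ k) :
    sys.gainSqMean k i = ((sys.interferenceTerm k i : ℝ) : ℂ) := by
  rw [gainSqMean, if_neg hik, gainMean_of_ne sys hik, interferenceTerm, losPow, losPow, a2, a2]
  push_cast
  ring

namespace IsModel

variable {sys} {Ω : Type*} [MeasurableSpace Ω] {P : Measure Ω} {Z : RISSource M N K τ → Ω → ℂ}
  [IsProbabilityMeasure P]

lemma integral_gain_self (hZ : sys.IsModel P Z) (k : Fin K) :
    ∫ ω, sys.gain Z P k k ω ∂P = sys.noiseTerm k := by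
  rw [(hZ.hasMean_gain k k).2, gainMean_self]

lemma integral_gain_self_sq (hZ : sys.IsModel P Z) (k : Fin K) :
    ∫ ω, ‖sys.gain Z P k k ω‖ ^ 2 ∂P = sys.leakTerm k + sys.noiseTerm k ^ 2 := by
  have := (hZ.hasMean_gain_sq k k).norm_sq
  rw [gainSqMean_self] at this
  exact_mod_cast this

lemma integral_gain_sq_of_ne (hZ : sys.IsModel P Z) {k i : Fin K} (hik : i ≠ k) :
    ∫ ω, ‖sys.gain Z P k i ω‖ ^ 2 ∂P = sys.interferenceTerm k i := by
  have := (hZ.hasMean_gain_sq k i).norm_sq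
  rw [gainSqMean_of_ne sys hik] at this
  exact_mod_cast this

lemma hasMoments_qHat (hZ : sys.IsModel P Z) (k : Fin K) (m : Fin M) :
    HasMoments P fun ω => sys.qHat Z P k ω m := by
  simp only [hZ.qHat_eq]
  exact hZ.hasMoments_hatFun k m

lemma integrable_norm_qHat_sq (hZ : sys.IsModel P Z) (k : Fin K) :
    Integrable (fun ω => ∑ m, ‖sys.qHat Z P k ω m‖ ^ 2) P :=
  integrable_finsetSum _ fun m _ => (memLp_two_iff_integrable_sq_norm
    (hZ.hasMoments_qHat k m).memLp_two.1).1 (hZ.hasMoments_qHat k m).memLp_two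

lemma integral_norm_qHat_sq (hZ : sys.IsModel P Z) (k : Fin K) :
    ∫ ω, ∑ m, ‖sys.qHat Z P k ω m‖ ^ 2 ∂P = sys.noiseTerm k := by
  have h := (hZ.hasMean_qHat_sq k).2
  have h2 : ∫ ω, ((∑ m, ‖sys.qHat Z P k ω m‖ ^ 2 : ℝ) : ℂ) ∂P = sys.noiseTerm k := by
    rw [← sys.noiseTerm_eq k]
    push_cast
    rw [← h]
    congr 1; ext ω
    exact Finset.sum_congr rfl fun m _ => by
      rw [mul_comm, mul_star_eq_norm_sq]; push_cast; rfl
  rw [integral_complex_ofReal] at h2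
  exact_mod_cast h2

lemma uatfSINR_eq (hZ : sys.IsModel P Z) (k : Fin K) :
    sys.uatfSINR Z P k = sys.closedSINR k := by
  rw [uatfSINR, closedSINR, hZ.integral_gain_self, hZ.integral_gain_self_sq,
    hZ.integral_norm_qHat_sq, Finset.sum_congr rfl fun i hi =>
      hZ.integral_gain_sq_of_ne (Finset.ne_of_mem_erase hi)]
  simp [signalTerm]

lemma isUnit_det_crossCov_obs (hZ : sys.IsModel P Z) (k : Fin K) :
    IsUnit (crossCov P (sys.obs Z k) (sys.obs Z k)).det := by
  rw [hZ.crossCov_obs]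
  exact Matrix.isUnit_det_of_right_inverse (sys.rankOneAdd_inverse k)

lemma memLp_q (hZ : sys.IsModel P Z) (k : Fin K) (m : Fin M) :
    MemLp (fun ω => sys.q Z k ω m) 2 P := by
  simp only [q_eq]
  exact (hZ.hasMoments_qFun k m).memLp_two

lemma memLp_obs (hZ : sys.IsModel P Z) (k : Fin K) (m : Fin M) :
    MemLp (fun ω => sys.obs Z k ω m) 2 P := by
  simp only [obs_eq]
  exact (hZ.hasMoments_obsFun k m).memLp_two

end IsModel

end RISSystem

end

/-! ### Mutual information with a Gaussian input -/

section Information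

/-- Gibbs' variational bound for a tilt `φ` of unit mass. -/
lemma ofReal_integral_le_klDiv {α : Type*} [MeasurableSpace α] {μ ν : Measure α}
    [IsProbabilityMeasure μ] [IsProbabilityMeasure ν] {φ : α → ℝ} (hφ : Integrable φ μ)
    (hexp : Integrable (fun x => Real.exp (φ x)) ν) (hone : ∫ x, Real.exp (φ x) ∂ν = 1) :
    ENNReal.ofReal (∫ x, φ x ∂μ) ≤ InformationTheory.klDiv μ ν := by
  by_cases h : μ ≪ ν ∧ Integrable (llr μ ν) μ
  · obtain ⟨hac, hint⟩ := h
    have : IsProbabilityMeasure (ν.tilted φ) := isProbabilityMeasure_tilted hexp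
    have hac' : μ ≪ ν.tilted φ := hac.trans (absolutelyContinuous_tilted hexp)
    -- Nonnegativity of the divergence of `μ` from `ν.tilted φ`. Unit mass makes the log-normaliser
    -- zero, so this says that the integral of `φ` is at most that of `llr μ ν`.
    have h1 := InformationTheory.integral_llr_add_sub_measure_univ_nonneg hac'
      (integrable_llr_tilted_right hac hφ hint hexp)
    rw [integral_llr_tilted_right hac hφ hexp hint, hone, Real.log_one] at h1
    rw [InformationTheory.klDiv_of_ac_of_integrable hac hint]
    refine ENNReal.ofReal_le_ofReal ?_
    simp only [probReal_univ] at h1 ⊢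
    linarith
  · rw [InformationTheory.klDiv_eq_top_iff.2 fun hac hint => h ⟨hac, hint⟩]
    exact le_top

/-- The law of variance `1/2` has density proportional to `exp(-x²)`; the weight turns it into the
density of mean `a` and variance `η / 2`. -/
lemma lintegral_gaussianReal_tilt {η : ℝ} (hη : 0 < η) (a : ℝ) :
    ∫⁻ x, ENNReal.ofReal (Real.exp (x ^ 2 - (x - a) ^ 2 / η) / Real.sqrt η)
      ∂(gaussianReal 0 (1 / 2)) = 1 := by
  have hv : (1 / 2 : ℝ≥0) ≠ 0 := by norm_num
  have hη' : (Real.toNNReal (η / 2)) ≠ 0 := by simpa using hη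
  rw [gaussianReal_of_var_ne_zero 0 hv, lintegral_withDensity_eq_lintegral_mul _ (by fun_prop)
    (by fun_prop), ← lintegral_gaussianPDF_eq_one a hη']
  refine lintegral_congr fun x => ?_
  simp only [Pi.mul_apply, gaussianPDF]
  rw [← ENNReal.ofReal_mul (gaussianPDFReal_nonneg _ _ _)]
  congr 1
  have hpi := Real.pi_pos
  rw [gaussianPDFReal, gaussianPDFReal, Real.coe_toNNReal _ (by positivity)]
  have e1 : (2 * Real.pi * ((1 / 2 : ℝ≥0) : ℝ)) = Real.pi := by push_cast; ring
  have e2 : 2 * Real.pi * (η / 2) = Real.pi * η := by ring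
  rw [e1, e2, Real.sqrt_mul hpi.le, mul_inv, mul_assoc, mul_assoc, mul_div_assoc', ← Real.exp_add,
    div_eq_inv_mul]
  congr 3
  push_cast
  field_simp
  ring

/-- The integrand is the likelihood ratio of a circular Gaussian with mean `w` and variance `η` to
`CN(0, 1)`; it splits into real and imaginary parts. -/
lemma lintegral_complexGaussian_tilt {η : ℝ} (hη : 0 < η) (w : ℂ) :
    ∫⁻ z, ENNReal.ofReal (Real.exp (‖z‖ ^ 2 - ‖z - w‖ ^ 2 / η - Real.log η))
      ∂(complexGaussian 1) = 1 := by
  rw [complexGaussian, lintegral_map (by fun_prop) (by fun_prop)]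
  have h (p : ℝ × ℝ) : ENNReal.ofReal (Real.exp (‖(p.1 : ℂ) + (p.2 : ℂ) * Complex.I‖ ^ 2 -
      ‖(p.1 : ℂ) + (p.2 : ℂ) * Complex.I - w‖ ^ 2 / η - Real.log η)) =
      ENNReal.ofReal (Real.exp (p.1 ^ 2 - (p.1 - w.re) ^ 2 / η) / Real.sqrt η) *
        ENNReal.ofReal (Real.exp (p.2 ^ 2 - (p.2 - w.im) ^ 2 / η) / Real.sqrt η) := by
    rw [← ENNReal.ofReal_mul (by positivity), div_mul_div_comm, Real.mul_self_sqrt hη.le,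
      ← Real.exp_add, Real.exp_sub, Real.exp_log hη, ← Complex.normSq_eq_norm_sq,
      ← Complex.normSq_eq_norm_sq, Complex.normSq_apply, Complex.normSq_apply]
    congr 3
    simp
    ring
  simp only [h]
  have hm (a : ℝ) : AEMeasurable (fun x : ℝ => ENNReal.ofReal
      (Real.exp (x ^ 2 - (x - a) ^ 2 / η) / Real.sqrt η)) (gaussianReal 0 (1 / 2)) := by
    fun_prop
  rw [lintegral_prod_mul (hm w.re) (hm w.im), lintegral_gaussianReal_tilt hη,
    lintegral_gaussianReal_tilt hη, one_mul]

variable {Ω : Type*} [MeasurableSpace Ω] {P : Measure Ω} [IsProbabilityMeasure P]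

/-- The mutual information between a Gaussian symbol and an arbitrary observation is at least that
of the Gaussian channel with the same second moments. -/
lemma log_le_mutualInformation {X r : Ω → ℂ} (hX : HasLaw X (complexGaussian 1) P)
    (hr : MemLp r 2 P) {ρ : ℂ} (hρ : HasMean P (fun ω => r ω * star (X ω)) ρ) {T : ℝ}
    (hT : ∫ ω, ‖r ω‖ ^ 2 ∂P = T) (hlt : ‖ρ‖ ^ 2 < T) :
    ENNReal.ofReal (Real.log (T / (T - ‖ρ‖ ^ 2))) ≤ mutualInformation P X r := by
  have hT0 : 0 < T := lt_of_le_of_lt (by positivity) hlt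
  have hrm := hr.1.aemeasurable
  have hXm := hX.aemeasurable
  set η : ℝ := 1 - ‖ρ‖ ^ 2 / T with hη
  have hη0 : 0 < η := by rw [hη, sub_pos, div_lt_one hT0]; exact hlt
  set θ : ℂ := star ρ / T with hθ
  have hX2 : MemLp X 2 P := by
    have h1 := memLp_id_complexGaussian 1 2
    rw [← hX.map_eq, memLp_map_measure_iff (by fun_prop) hXm] at h1
    exact h1
  -- Log-likelihood ratio of the posterior `CN(θ r, η)` to the prior `CN(0, 1)`, exact if `X` and
  -- `r` were jointly Gaussian.
  let φ : ℂ × ℂ → ℝ := fun z => ‖z.1‖ ^ 2 - ‖z.1 - θ * z.2‖ ^ 2 / η - Real.log η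
  have hφm : Measurable φ := by fun_prop
  have : IsProbabilityMeasure (P.map X) := Measure.isProbabilityMeasure_map hXm
  have : IsProbabilityMeasure (P.map r) := Measure.isProbabilityMeasure_map hrm
  have : IsProbabilityMeasure (P.map fun ω => (X ω, r ω)) :=
    Measure.isProbabilityMeasure_map (hXm.prodMk hrm)
  -- The tilt already has unit mass in `x` for every fixed `y`, so nothing about the law of `r` is
  -- used.
  have hlin : ∫⁻ z, ENNReal.ofReal (Real.exp (φ z)) ∂((P.map X).prod (P.map r)) = 1 := by
    rw [lintegral_prod_symm _ (by fun_prop)]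
    have (y : ℂ) : ∫⁻ x, ENNReal.ofReal (Real.exp (φ (x, y))) ∂(P.map X) = 1 := by
      rw [hX.map_eq]; exact lintegral_complexGaussian_tilt hη0 (θ * y)
    simp [this]
  have hexp : Integrable (fun z => Real.exp (φ z)) ((P.map X).prod (P.map r)) := by
    refine ⟨by fun_prop, ?_⟩
    rw [hasFiniteIntegral_iff_ofReal (ae_of_all _ fun z => (Real.exp_pos _).le), hlin]
    exact ENNReal.one_lt_top
  have hone : ∫ z, Real.exp (φ z) ∂((P.map X).prod (P.map r)) = 1 := by
    rw [integral_eq_lintegral_of_nonneg_ae (ae_of_all _ fun z => (Real.exp_pos _).le)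
      (by fun_prop), hlin, ENNReal.toReal_one]
  have hXi : Integrable (fun ω => ‖X ω‖ ^ 2) P := (memLp_two_iff_integrable_sq_norm hX2.1).1 hX2
  have hri : Integrable (fun ω => ‖r ω‖ ^ 2) P := (memLp_two_iff_integrable_sq_norm hr.1).1 hr
  have hX1 : ∫ ω, ‖X ω‖ ^ 2 ∂P = 1 := by
    have h1 := (hasMean_complexGaussian 1 (p := 1) (q := 1) (by norm_num) (by norm_num)).2
    rw [← hX.map_eq, integral_map hXm (by fun_prop)] at h1
    have h2 : ∫ ω, ((‖X ω‖ ^ 2 : ℝ) : ℂ) ∂P = 1 := by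
      simpa [Complex.mul_conj, Complex.normSq_eq_norm_sq] using h1
    rw [integral_complex_ofReal] at h2
    exact_mod_cast h2
  have hexpand (ω : Ω) : φ (X ω, r ω) = ‖X ω‖ ^ 2 - (‖X ω‖ ^ 2 -
      2 * (θ * (r ω * star (X ω))).re + ‖θ‖ ^ 2 * ‖r ω‖ ^ 2) / η - Real.log η := by
    simp only [φ]
    congr 3
    rw [← Complex.normSq_eq_norm_sq, ← Complex.normSq_eq_norm_sq, ← Complex.normSq_eq_norm_sq,
      ← Complex.normSq_eq_norm_sq, ← Complex.normSq.map_mul, Complex.normSq_sub, Complex.star_def,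
      ← Complex.conj_re (X ω * _), (starRingEnd ℂ).map_mul, Complex.conj_conj,
      mul_comm ((starRingEnd ℂ) (X ω)), mul_assoc, Complex.normSq.map_mul]
    ring
  have hre : Integrable (fun ω => (θ * (r ω * star (X ω))).re) P := (hρ.1.const_mul θ).re
  have hre' : ∫ ω, (θ * (r ω * star (X ω))).re ∂P = ‖ρ‖ ^ 2 / T := by
    have h1 : ∫ ω, (θ * (r ω * star (X ω))).re ∂P = (∫ ω, θ * (r ω * star (X ω)) ∂P).re :=
      integral_re (hρ.1.const_mul θ)
    rw [h1, integral_const_mul, hρ.2, hθ, div_mul_eq_mul_div, Complex.div_ofReal_re]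
    congr 1
    rw [mul_comm, Complex.star_def, Complex.mul_conj, Complex.ofReal_re, Complex.normSq_eq_norm_sq]
  have hnθ : ‖θ‖ ^ 2 * T = ‖ρ‖ ^ 2 / T := by
    rw [hθ, norm_div, norm_star, Complex.norm_real, Real.norm_of_nonneg hT0.le]
    field_simp
  have hlin2 : Integrable (fun ω => ‖X ω‖ ^ 2 - 2 * (θ * (r ω * star (X ω))).re) P :=
    hXi.sub (hre.const_mul 2)
  have hquad : Integrable (fun ω => ‖X ω‖ ^ 2 - 2 * (θ * (r ω * star (X ω))).re +
      ‖θ‖ ^ 2 * ‖r ω‖ ^ 2) P := hlin2.add (hri.const_mul _)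
  have hφi : Integrable φ (P.map fun ω => (X ω, r ω)) := by
    rw [integrable_map_measure hφm.aestronglyMeasurable (hXm.prodMk hrm)]
    exact Integrable.congr (hXi.sub (hquad.div_const η) |>.sub (integrable_const (Real.log η)))
      (ae_of_all _ fun ω => (hexpand ω).symm)
  have hval : ∫ z, φ z ∂(P.map fun ω => (X ω, r ω)) = Real.log (T / (T - ‖ρ‖ ^ 2)) := by
    have hdiff : Integrable (fun ω => ‖X ω‖ ^ 2 - (‖X ω‖ ^ 2 -
        2 * (θ * (r ω * star (X ω))).re + ‖θ‖ ^ 2 * ‖r ω‖ ^ 2) / η) P :=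
      hXi.sub (hquad.div_const η)
    rw [integral_map (hXm.prodMk hrm) hφm.aestronglyMeasurable,
      integral_congr_ae (ae_of_all _ hexpand), integral_sub hdiff (integrable_const _),
      integral_sub hXi (hquad.div_const η), integral_div, integral_add hlin2 (hri.const_mul _),
      integral_sub hXi (hre.const_mul 2), integral_const_mul, integral_const_mul, hX1, hT, hre',
      hnθ]
    -- Since `E|X - θ r|² = η` and `E|X|² = 1`, the quadratic terms cancel and `-log η` remains.
    have : (1 - 2 * (‖ρ‖ ^ 2 / T) + ‖ρ‖ ^ 2 / T) = η := by rw [hη]; ring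
    rw [this, div_self hη0.ne', sub_self, zero_sub, integral_const, probReal_univ, one_smul,
      ← Real.log_inv]
    congr 1
    rw [hη, one_sub_div hT0.ne', inv_div]
  rw [← hval]
  exact ofReal_integral_le_klDiv hφi hexp hone

/-- Data processing: forgetting `W` pushes the joint law and the product of the marginals forward
under the same map. -/
lemma mutualInformation_fst_le {α β γ : Type*} [MeasurableSpace α] [MeasurableSpace β]
    [MeasurableSpace γ] {X : Ω → α} {Y : Ω → β} {W : Ω → γ} (hX : AEMeasurable X P)
    (hY : AEMeasurable Y P) (hW : AEMeasurable W P) :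
    mutualInformation P X Y ≤ mutualInformation P X (fun ω => (Y ω, W ω)) := by
  have : IsProbabilityMeasure (P.map X) := Measure.isProbabilityMeasure_map hX
  have : IsProbabilityMeasure (P.map fun ω => (Y ω, W ω)) :=
    Measure.isProbabilityMeasure_map (hY.prodMk hW)
  have : IsProbabilityMeasure (P.map fun ω => (X ω, (Y ω, W ω))) :=
    Measure.isProbabilityMeasure_map (hX.prodMk (hY.prodMk hW))
  have hg : Measurable (Prod.map id Prod.fst : α × (β × γ) → α × β) := by fun_prop
  have h1 : P.map (fun ω => (X ω, Y ω)) =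
      (P.map fun ω => (X ω, (Y ω, W ω))).map (Prod.map id Prod.fst) := by
    rw [AEMeasurable.map_map_of_aemeasurable hg.aemeasurable (hX.prodMk (hY.prodMk hW))]; rfl
  have h2 : (P.map X).prod (P.map Y) =
      ((P.map X).prod (P.map fun ω => (Y ω, W ω))).map (Prod.map id Prod.fst) := by
    rw [← Measure.map_prod_map _ _ measurable_id measurable_fst, Measure.map_id,
      AEMeasurable.map_map_of_aemeasurable measurable_fst.aemeasurable (hY.prodMk hW)]; rfl
  rw [mutualInformation, mutualInformation, h1, h2]
  exact InformationTheory.klDiv_map_le _ _ hg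

end Information

/-! ### The data phase and the ergodic rate -/

noncomputable section

namespace RISSystem

variable {M N K τ : ℕ} (sys : RISSystem M N K τ)

/-- Coefficients of the MRC output in the symbols and the noise of the data phase, given the
quantities that determine the channels and their estimates. -/
def mrcCoef (k : Fin K) (w : (Fin K × Fin N) ⊕ ChanIdx M N K τ → ℂ) : Fin K ⊕ Fin M → ℂ :=
  Sum.elim
    (fun i => Real.sqrt sys.p * ∑ m, star (sys.hatFun k m (fun a => w (.inl a)) fun b => w (.inr b))
        *
      sys.qFun i m (fun a => w (.inl a)) fun b => w (.inr b))
    (fun m => star (sys.hatFun k m (fun a => w (.inl a)) fun b => w (.inr b)))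

lemma measurable_mrcCoef (k : Fin K) (j : Fin K ⊕ Fin M) :
    Measurable fun w : (Fin K × Fin N) ⊕ ChanIdx M N K τ → ℂ => sys.mrcCoef k w j := by
  have hw : Measurable fun w : (Fin K × Fin N) ⊕ ChanIdx M N K τ → ℂ =>
      ((fun a => w (.inl a), fun b => w (.inr b)) : (Fin K × Fin N → ℂ)
          × (ChanIdx M N K τ → ℂ)) := by
    fun_prop
  rcases j with i | m
  · have h := (IsModel.measurable_gainFun (sys := sys) k i).comp hw
    simp only [mrcCoef, Sum.elim_inl]
    exact h.const_mul (Real.sqrt sys.p : ℂ)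
  · have h := (sys.measurable_hatFun k m).comp hw
    simp only [mrcCoef, Sum.elim_inr]
    exact continuous_star.measurable.comp h

lemma preLog_nonneg : 0 ≤ sys.preLog :=
  div_nonneg (sub_nonneg.2 (by exact_mod_cast sys.τ_le_τc)) (Nat.cast_nonneg _)

/-- The denominator of the SINR: the power of the interference, the leakage and the noise. -/
def disturbance (k : Fin K) : ℝ :=
  sys.p * sys.leakTerm k + sys.p * ∑ i ∈ Finset.univ.erase k, sys.interferenceTerm k i +
    sys.σ ^ 2 * sys.noiseTerm k

namespace IsModel

variable {sys} {Ω : Type*} [MeasurableSpace Ω] {P : Measure Ω} {Z : RISSource M N K τ → Ω → ℂ}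
  [IsProbabilityMeasure P]

lemma mrcCoef_inl (hZ : sys.IsModel P Z) (k i : Fin K) (ω : Ω) :
    sys.mrcCoef k (fun a => Z (Sum.elim userSource chanSource a) ω) (.inl i) =
      Real.sqrt sys.p * sys.gain Z P k i ω := by
  rw [hZ.gain_eq]; rfl

lemma mrcCoef_inr (hZ : sys.IsModel P Z) (k : Fin K) (m : Fin M) (ω : Ω) :
    sys.mrcCoef k (fun a => Z (Sum.elim userSource chanSource a) ω) (.inr m) =
      star (sys.qHat Z P k ω m) := by
  rw [hZ.qHat_eq]; rfl

lemma mrc_eq (hZ : sys.IsModel P Z) (k : Fin K) (ω : Ω) :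
    sys.mrc Z P k ω = linForm (fun j => Z (dataSource j))
      (sys.mrcCoef k fun a => Z (Sum.elim userSource chanSource a) ω) ω := by
  simp only [linForm, Fintype.sum_sum_type, hZ.mrcCoef_inl, hZ.mrcCoef_inr, dataSource,
    Sum.elim_inl, Sum.elim_inr]
  simp only [mrc, received, dotProduct_add, dotProduct_smul, dotProduct_sum, smul_eq_mul, gain,
    Finset.mul_sum]
  congr 1
  exact Finset.sum_congr rfl fun i _ => by ring

lemma hasMoments_mrcCoef (hZ : sys.IsModel P Z) (k : Fin K) (j : Fin K ⊕ Fin M) :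
    HasMoments P fun ω =>
      sys.mrcCoef k (fun a => Z (Sum.elim userSource chanSource a) ω) j := by
  rcases j with i | m
  · simp only [hZ.mrcCoef_inl]
    exact (hZ.hasMoments_gain k i).const_mul _
  · simp only [hZ.mrcCoef_inr]
    exact (hZ.hasMoments_qHat k m).conj

lemma hasMoments_mrc (hZ : sys.IsModel P Z) (k : Fin K) : HasMoments P (sys.mrc Z P k) := by
  rw [funext (hZ.mrc_eq k)]
  exact HasMoments.sum fun j _ => (hZ.hasMoments_mrcCoef k j).mul (hZ.data.hasMoments j)

/-- Averaging first over the data phase, then over the channels and the pilot phase. -/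
lemma hasMean_data (hZ : sys.IsModel P Z) {k : Fin K} {m : ℂ}
    {y : ((Fin K × Fin N) ⊕ ChanIdx M N K τ → ℂ) → Fin K ⊕ Fin M → ℂ}
    (hy : ∀ j, Measurable fun w => y w j)
    (hy' : ∀ j, HasMoments P fun ω => y (fun a => Z (Sum.elim userSource chanSource a) ω) j)
    (hm : HasMean P (fun ω => formCov (fun j => sys.sourceVar (dataSource j))
      (sys.mrcCoef k fun a => Z (Sum.elim userSource chanSource a) ω)
      (y fun a => Z (Sum.elim userSource chanSource a) ω)) m) :
    HasMean P (fun ω => star (linForm (fun j => Z (dataSource j))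
      (y fun a => Z (Sum.elim userSource chanSource a) ω) ω) * sys.mrc Z P k ω) m := by
  simp only [hZ.mrc_eq]
  have hc := sys.measurable_mrcCoef (N := N) (τ := τ) k
  refine HasMean.of_indepFun (F := fun w z => star (∑ j, y w j * z j) * ∑ j, sys.mrcCoef k w j *
    z j)
    (indepFun_subfamilies hZ.indep hZ.aemeasurable sumElim_user_chan_ne_dataSource)
    (aemeasurable_pi_lambda _ fun _ => hZ.aemeasurable _)
    (aemeasurable_pi_lambda _ fun _ => hZ.aemeasurable _) ?_ ?_
    (fun w => (hZ.data.hasMean_linForm_one_one (y w) (sys.mrcCoef k w)).2) hm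
  · refine Measurable.mul (continuous_star.measurable.comp ?_) ?_
    · exact Finset.measurable_sum _ fun j _ => ((hy j).comp measurable_fst).mul (by fun_prop)
    · exact Finset.measurable_sum _ fun j _ => ((hc j).comp measurable_fst).mul (by fun_prop)
  · exact HasMoments.integrable (HasMoments.mul
      (HasMoments.sum fun j _ => (hy' j).mul (hZ.data.hasMoments j)).conj
      (HasMoments.sum fun j _ => (hZ.hasMoments_mrcCoef k j).mul (hZ.data.hasMoments j)))

lemma hasMean_mrc_mul_star_symbol (hZ : sys.IsModel P Z) (k : Fin K) :
    HasMean P (fun ω => sys.mrc Z P k ω * star (Z (.symbol k) ω))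
      ((Real.sqrt sys.p * sys.noiseTerm k : ℝ) : ℂ) := by
  -- The symbol is itself a linear form in the data block, with constant coefficients.
  refine (hZ.hasMean_data (k := k) (y := fun _ => Pi.single (.inl k) 1) (fun _ => measurable_const)
    (fun _ => HasMoments.const _) (((hZ.hasMean_gain k k).const_mul (Real.sqrt sys.p : ℂ)).of_eq
      (fun ω => ?_) rfl)).of_eq (fun ω => ?_) ?_
  · rw [formCov, Finset.sum_eq_single (Sum.inl k) (fun j _ hj => by simp [hj]) (by simp),
      hZ.mrcCoef_inl]
    simp [dataSource, sourceVar]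
  · rw [linForm, Finset.sum_eq_single (Sum.inl k) (fun j _ hj => by simp [hj]) (by simp)]
    simp [dataSource, mul_comm]
  · rw [gainMean_self]; push_cast; rfl

/-- Symbols and data noise are uncorrelated given the channels, so powers add. The second moment of
the user's own gain splits into leakage and squared mean, and the latter is the signal part. -/
lemma hasMean_mrc_sq (hZ : sys.IsModel P Z) (k : Fin K) :
    HasMean P (fun ω => sys.mrc Z P k ω * star (sys.mrc Z P k ω))
      ((sys.disturbance k + sys.p * sys.noiseTerm k ^ 2 : ℝ) : ℂ) := by
  refine (hZ.hasMean_data (k := k) (y := sys.mrcCoef k) (sys.measurable_mrcCoef k)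
    (hZ.hasMoments_mrcCoef k)
    (((HasMean.sum (s := Finset.univ) fun i _ => hZ.hasMean_gain_sq k i).const_mul
      (sys.p : ℂ)).add ((hZ.hasMean_qHat_sq k).const_mul ((sys.σ ^ 2 : ℝ) : ℂ)) |>.of_eq
      (fun ω => ?_) rfl)).of_eq (fun ω => ?_) ?_
  · rw [formCov, Fintype.sum_sum_type]
    simp only [hZ.mrcCoef_inl, hZ.mrcCoef_inr, dataSource, Sum.elim_inl, Sum.elim_inr, sourceVar,
      star_star, Real.coe_toNNReal _ (sq_nonneg sys.σ), Finset.mul_sum]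
    congr 1
    refine Finset.sum_congr rfl fun i _ => ?_
    have := sqrt_mul_sqrt sys.p_pos.le
    rw [star_mul', Complex.star_def, Complex.conj_ofReal]
    push_cast
    linear_combination (sys.gain Z P k i ω * (starRingEnd ℂ) (sys.gain Z P k i ω)) * this
  · rw [hZ.mrc_eq, mul_comm]
  · have hn := congrArg (Complex.ofReal) (sys.noiseTerm_eq k)
    push_cast at hn
    rw [← Finset.add_sum_erase _ _ (Finset.mem_univ k), gainSqMean_self,
      Finset.sum_congr rfl fun i hi => gainSqMean_of_ne sys (Finset.ne_of_mem_erase hi),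
      disturbance]
    push_cast
    rw [hn]
    ring

lemma integral_norm_mrc_sq (hZ : sys.IsModel P Z) (k : Fin K) :
    ∫ ω, ‖sys.mrc Z P k ω‖ ^ 2 ∂P = sys.disturbance k + sys.p * sys.noiseTerm k ^ 2 := by
  exact_mod_cast (hZ.hasMean_mrc_sq k).norm_sq

lemma disturbance_nonneg (hZ : sys.IsModel P Z) (k : Fin K) : 0 ≤ sys.disturbance k := by
  have hp := sys.p_pos
  have h1 : 0 ≤ sys.leakTerm k := by
    -- The mean gain is real, so the leakage is at least the variance of the real part of the gain.
    have hv := ProbabilityTheory.variance_nonneg (fun ω => (sys.gain Z P k k ω).re) P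
    have hg := (hZ.hasMoments_gain k k).memLp_two
    have hgr : MemLp (fun ω => (sys.gain Z P k k ω).re) 2 P := hg.re
    have hre : ∫ ω, (sys.gain Z P k k ω).re ∂P = sys.noiseTerm k := by
      have := integral_re (𝕜 := ℂ) (hZ.hasMoments_gain k k).integrable
      rw [hZ.integral_gain_self] at this
      exact this
    rw [variance_eq_sub hgr, hre] at hv
    have hle : ∫ ω, (sys.gain Z P k k ω).re ^ 2 ∂P ≤ ∫ ω, ‖sys.gain Z P k k ω‖ ^ 2 ∂P :=
      integral_mono hgr.integrable_sq (hg.integrable_norm_pow two_ne_zero) fun ω =>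
        sq_le_sq.2 (by rw [abs_norm]; exact Complex.abs_re_le_norm _)
    rw [hZ.integral_gain_self_sq] at hle
    have hv' : 0 ≤ ∫ ω, (sys.gain Z P k k ω).re ^ 2 ∂P - sys.noiseTerm k ^ 2 := hv
    linarith
  have h2 : 0 ≤ ∑ i ∈ Finset.univ.erase k, sys.interferenceTerm k i :=
    Finset.sum_nonneg fun i hi => by
      rw [← hZ.integral_gain_sq_of_ne (Finset.ne_of_mem_erase hi)]
      exact integral_nonneg fun ω => sq_nonneg _
  have h3 : 0 ≤ sys.noiseTerm k := by
    rw [← hZ.integral_norm_qHat_sq k]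
    exact integral_nonneg fun ω => Finset.sum_nonneg fun m _ => sq_nonneg _
  unfold disturbance
  positivity

lemma log_closedSINR_le (hZ : sys.IsModel P Z) (k : Fin K) :
    ENNReal.ofReal (Real.log (1 + sys.closedSINR k)) ≤
      mutualInformation P (Z (.symbol k)) (sys.mrc Z P k) := by
  have hS : sys.closedSINR k = sys.p * sys.noiseTerm k ^ 2 / sys.disturbance k := rfl
  -- For zero disturbance the quotient `closedSINR` is `0` by convention and the bound is trivial.
  rcases (hZ.disturbance_nonneg k).eq_or_lt with h0 | hpos
  · rw [hS, ← h0]; simp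
  have hρ : ‖((Real.sqrt sys.p * sys.noiseTerm k : ℝ) : ℂ)‖ ^ 2 = sys.p * sys.noiseTerm k ^ 2 := by
    rw [Complex.norm_real, Real.norm_eq_abs, sq_abs, mul_pow, Real.sq_sqrt sys.p_pos.le]
  have := log_le_mutualInformation (hZ.hasLaw (.symbol k)) (hZ.hasMoments_mrc k).memLp_two
    (hZ.hasMean_mrc_mul_star_symbol k) (hZ.integral_norm_mrc_sq k) (by rw [hρ]; linarith)
  -- With `T` the disturbance plus the signal power `‖ρ‖²`, the ratio `T / (T - ‖ρ‖²)` is one plus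
  -- the SINR.
  rw [hρ, add_sub_cancel_right, add_div, div_self hpos.ne'] at this
  rwa [hS]

/-- The hypothesis on `Y` covers both receivers: it is an equality when `Y` is the MRC output, and
data processing when the estimates are adjoined. -/
lemma rate_le_ergodicRate (hZ : sys.IsModel P Z) (k : Fin K) {B : Type*} [MeasurableSpace B]
    {Y : Ω → B} (hY : mutualInformation P (Z (.symbol k)) (sys.mrc Z P k) ≤
      mutualInformation P (Z (.symbol k)) Y) :
    ENNReal.ofReal (sys.preLog * Real.logb 2 (1 + sys.closedSINR k)) ≤
      sys.ergodicRate Z P k Y := by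
  have h : 0 ≤ sys.preLog / Real.log 2 := div_nonneg sys.preLog_nonneg (Real.log_nonneg one_le_two)
  rw [Real.logb, mul_div_left_comm, mul_comm, ENNReal.ofReal_mul h, ergodicRate]
  gcongr
  exact (hZ.log_closedSINR_le k).trans hY

end IsModel

end RISSystem

end

theorem theorem2 {M N K τ : ℕ} (sys : RISSystem M N K τ)
    {Ω : Type*} [MeasurableSpace Ω] (P : Measure Ω) [IsProbabilityMeasure P]
    (Z : RISSource M N K τ → Ω → ℂ) (hZ : sys.IsModel P Z) (k : Fin K) :
    -- the LMMSE estimate is well defined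
    ((∀ m, MemLp (fun ω => sys.q Z k ω m) 2 P) ∧
      (∀ m, MemLp (fun ω => sys.obs Z k ω m) 2 P) ∧
      IsUnit (crossCov P (sys.obs Z k) (sys.obs Z k)).det) ∧
    -- all expectations in the bound exist
    ((∀ i, MemLp (sys.gain Z P k i) 2 P) ∧
      Integrable (fun ω => ∑ m, ‖sys.qHat Z P k ω m‖ ^ 2) P) ∧
    -- closed forms of the signal, noise, leakage and interference terms
    ‖∫ ω, sys.gain Z P k k ω ∂P‖ ^ 2 = sys.signalTerm k ∧
    (∫ ω, ∑ m, ‖sys.qHat Z P k ω m‖ ^ 2 ∂P) = sys.noiseTerm k ∧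
    (∫ ω, ‖sys.gain Z P k k ω‖ ^ 2 ∂P) - ‖∫ ω, sys.gain Z P k k ω ∂P‖ ^ 2 = sys.leakTerm k ∧
    (∀ i, i ≠ k → ∫ ω, ‖sys.gain Z P k i ω‖ ^ 2 ∂P = sys.interferenceTerm k i) ∧
    -- the two expressions for `f`
    (∀ i, sys.f i = ∑ n, Complex.exp (Complex.I * ((sys.zeta i n + sys.θ n : ℝ) : ℂ))) ∧
    -- closed form of the use-and-then-forget rate
    sys.uatfSINR Z P k = sys.closedSINR k ∧
    sys.uatfRate Z P k = sys.preLog * Real.logb 2 (1 + sys.closedSINR k) ∧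
    -- it is a lower bound for the ergodic rate, whether the receiver decodes from the MRC output
    -- alone or from the MRC output together with the channel estimates
    ENNReal.ofReal (sys.preLog * Real.logb 2 (1 + sys.closedSINR k)) ≤
      sys.ergodicRate Z P k (sys.mrc Z P k) ∧
    ENNReal.ofReal (sys.preLog * Real.logb 2 (1 + sys.closedSINR k)) ≤
      sys.ergodicRate Z P k
        (fun ω => (sys.mrc Z P k ω, fun (i : Fin K) (m : Fin M) => sys.qHat Z P i ω m)) := by
  have hsig : ‖∫ ω, sys.gain Z P k k ω ∂P‖ ^ 2 = sys.signalTerm k := by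
    rw [hZ.integral_gain_self, Complex.norm_real, Real.norm_eq_abs, sq_abs, RISSystem.signalTerm]
  refine ⟨⟨hZ.memLp_q k, hZ.memLp_obs k, hZ.isUnit_det_crossCov_obs k⟩,
    ⟨fun i => (hZ.hasMoments_gain k i).memLp_two, hZ.integrable_norm_qHat_sq k⟩, hsig,
    hZ.integral_norm_qHat_sq k, ?_, fun i hi => hZ.integral_gain_sq_of_ne hi, sys.f_eq_sum_exp,
    hZ.uatfSINR_eq k, by rw [RISSystem.uatfRate, hZ.uatfSINR_eq], hZ.rate_le_ergodicRate k le_rfl,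
    hZ.rate_le_ergodicRate k ?_⟩
  · rw [hsig, hZ.integral_gain_self_sq, RISSystem.signalTerm, add_sub_cancel_right]
  · exact mutualInformation_fst_le (hZ.hasLaw _).aemeasurable
      (hZ.hasMoments_mrc k).memLp_two.1.aemeasurable
      (aemeasurable_pi_lambda _ fun i => aemeasurable_pi_lambda _ fun m =>
        (hZ.hasMoments_qHat i m).memLp_two.1.aemeasurable)
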